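/- An ordered semiautomaton $\mathcal O=(Q,A,\cdot,\le)$ consists of a non-empty finite set $Q$ of states, a non-empty finite alphabet $A$, a complete transition function $Q\times A\to Q$ and a partial order $\le$ on $Q$ for which every letter acts as an isotone mapping; the action extends to words in $A^*$. An $\omega$-term is built from variables by concatenation and the unary operation $t\mapsto t^\omega$, and an $\omega$-inequality $u\le v$ is a pair of $\omega$-terms. Let $\mathcal C_{ne}$, $\mathcal C_l$, $\mathcal C_s$, $\mathcal C_{lm}$ be the categories of homomorphisms $f:B^*\to A^*$ between free monoids that are, respectively, non-erasing ($f^{-1}(\lambda)=\{\lambda\}$, where $\lambda$ is the empty word), literal ($f(B)\subseteq A$), surjective, and length-multiplying (there is an integer $k\ge 1$ with $|f(b)|=k$ for all $b\in B$). The $\omega$-inequality $u\le v$ holds in $\mathcal O$ with respect to $\mathcal C$ if $p\cdot f(u)\le p\cdot f(v)$ for every $f\in\mathcal C(X^*,A^*)$, where $X$ is the set of variables occurring in $uv$, and every $p\in Q$; here $f(u)$ means $f(u')$, where $u'$ is obtained from $u$ by replacing all occurrences of $\omega$ by an exponent $n\ge 1$ such that $s^n$ is idempotent for every element $s$ of the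 transition monoid of $\mathcal O$ (and similarly for $v$). (1) For each $\mathcal C\in\{\mathcal C_{ne},\mathcal C_l,\mathcal C_s,\mathcal C_{lm}\}$ it is decidable, given an ordered semiautomaton $\mathcal O$ and an $\omega$-inequality $u\le v$, whether $u\le v$ holds in $\mathcal O$ with respect to $\mathcal C$. (2) For each $\mathcal C\in\{\mathcal C_{ne},\mathcal C_l,\mathcal C_s\}$ and each fixed $\omega$-inequality $u\le v$, there is a (deterministic) polynomial space algorithm that decides, given an ordered semiautomaton $\mathcal O$, whether $u\le v$ holds in $\mathcal O$ with respect to $\mathcal C$; the space is measured in the size of $\mathcal O$. -/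

import Mathlib

/-! ### Ordered semiautomata -/

/-- An ordered semiautomaton with state set `Q` over the alphabet `A`: a complete deterministic
transition function together with a (partial) order on the states for which every letter acts as
an isotone mapping. -/
structure OrderedSemiautomaton (Q A : Type) where
  /-- the order on the states -/
  le : Q → Q → Prop
  le_refl : ∀ p, le p p
  le_trans : ∀ p q r, le p q → le q r → le p r
  le_antisymm : ∀ p q, le p q → le q p → p = q
  /-- the transition function -/
  step : Q → A → Q
  step_isotone : ∀ a p q, le p q → le (step p a) (step q a)

namespace OrderedSemiautomaton

variable {Q A : Type}

/-- The state `q · w` reached from `q` by reading the word `w`. -/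
def act (O : OrderedSemiautomaton Q A) (q : Q) (w : FreeMonoid A) : Q :=
  w.toList.foldl O.step q

/-- `n` is a positive integer such that `s ^ n` is idempotent (that is, `s ^ n = s ^ ω`) for every
element `s` of the transition monoid, i.e. for every transformation `q ↦ q · w` given by a
word `w`. -/
def IsOmegaExponent (O : OrderedSemiautomaton Q A) (n : ℕ) : Prop :=
  0 < n ∧ ∀ (w : FreeMonoid A) (q : Q), O.act q (w ^ n * w ^ n) = O.act q (w ^ n)

theorem act_mul (O : OrderedSemiautomaton Q A) (q : Q) (w w' : FreeMonoid A) :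
    O.act q (w * w') = O.act (O.act q w) w' := by
  simp [act]

/-- An exponent as above always exists when there are finitely many states. -/
theorem exists_isOmegaExponent [Finite Q] (O : OrderedSemiautomaton Q A) :
    ∃ n, O.IsOmegaExponent n := by
  classical
  have hpow : ∀ (w : FreeMonoid A) (k : ℕ) (q : Q),
      O.act q (w ^ k) = (fun r => O.act r w)^[k] q := by
    intro w k
    induction k with
    | zero => intro q; simp [act]
    | succ k ih => intro q; rw [pow_succ', act_mul, ih, Function.iterate_succ_apply]
  have key : ∀ g : Q → Q, ∃ k, 0 < k ∧ ∀ j, g^[k * (j + 1)] = g^[k] := by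
    intro g
    obtain ⟨a, b, hab, h⟩ := Finite.exists_ne_map_eq_of_infinite (fun i : ℕ => g^[i])
    have main : ∀ a b : ℕ, a < b → g^[a] = g^[b] →
        ∃ k, 0 < k ∧ ∀ j, g^[k * (j + 1)] = g^[k] := by
      intro a b hab h
      have hper : ∀ i, a ≤ i → ∀ j, g^[i + (b - a) * j] = g^[i] := by
        intro i hi j
        induction j with
        | zero => simp
        | succ j ih =>
          have e1 : i + (b - a) * (j + 1) = (i - a + (b - a) * j) + b := by
            have : (b - a) * (j + 1) = (b - a) * j + (b - a) := by ring
            omega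
          have e2 : i + (b - a) * j = (i - a + (b - a) * j) + a := by omega
          rw [e1, Function.iterate_add, ← h, ← Function.iterate_add, ← e2, ih]
      refine ⟨(b - a) * (a + 1), Nat.mul_pos (by omega) (by omega), fun j => ?_⟩
      have hle : a ≤ (b - a) * (a + 1) := by
        have : 1 * (a + 1) ≤ (b - a) * (a + 1) := Nat.mul_le_mul_right _ (by omega)
        omega
      have := hper _ hle ((a + 1) * j)
      rw [← this]
      congr 1
      ring
    rcases lt_or_gt_of_ne hab with hlt | hlt
    · exact main a b hlt h
    · exact main b a hlt h.symm
  have : Fintype (Q → Q) := Fintype.ofFinite _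
  choose k hk hk' using key
  refine ⟨∏ g, k g, Finset.prod_pos fun g _ => hk g, fun w q => ?_⟩
  obtain ⟨c, hc⟩ := Finset.dvd_prod_of_mem k (Finset.mem_univ (fun r => O.act r w))
  have hcpos : 0 < c := by
    rcases Nat.eq_zero_or_pos c with h0 | h0
    · have : 0 < ∏ g, k g := Finset.prod_pos fun g _ => hk g
      rw [hc, h0] at this
      omega
    · exact h0
  obtain ⟨c, rfl⟩ : ∃ d, c = d + 1 := ⟨c - 1, by omega⟩
  rw [← pow_add, hpow, hpow, hc, hk']
  have e : ∀ m : ℕ, m * (c + 1) + m * (c + 1) = m * ((2 * c + 1) + 1) := fun m => by ring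
  rw [e, hk']

end OrderedSemiautomaton

/-! ### Terms -/

/-- The `ω`-terms over the variables `0, 1, 2, …`: they are built from variables by concatenation
and by the unary operation `t ↦ t ^ ω`. -/
inductive OmegaTerm : Type
  | var : ℕ → OmegaTerm
  | mul : OmegaTerm → OmegaTerm → OmegaTerm
  | omega : OmegaTerm → OmegaTerm

namespace OmegaTerm

/-- The set of variables occurring in a term. -/
def vars : OmegaTerm → Finset ℕ
  | var x => {x}
  | mul s t => s.vars ∪ t.vars
  | omega t => t.vars

/-- The word over an alphabet `X` containing all variables of the term that is obtained
by replacing all occurrences of `ω` by the exponent `n`. -/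
def word {X : Finset ℕ} (n : ℕ) : (t : OmegaTerm) → t.vars ⊆ X → FreeMonoid X
  | var x, h => FreeMonoid.of ⟨x, h (Finset.mem_singleton_self x)⟩
  | mul s t, h =>
      word n s (Finset.union_subset_left h) * word n t (Finset.union_subset_right h)
  | omega t, h => (word n t h) ^ n

end OmegaTerm

/-! ### Categories of homomorphisms -/

/-- Names for the four categories: non-erasing, literal, surjective and length-multiplying
homomorphisms between free monoids. -/
inductive HomCategory : Type
  | ne
  | l
  | s
  | lm

/-- `C.Mem f` says that the homomorphism `f : B* → A*` is a morphism of the category `C`. -/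
def HomCategory.Mem {B A : Type} : HomCategory → (FreeMonoid B →* FreeMonoid A) → Prop
  | .ne, f => f ⁻¹' {1} = {1}
  | .l, f => ∀ b : B, ∃ a : A, f (FreeMonoid.of b) = FreeMonoid.of a
  | .s, f => Function.Surjective f
  | .lm, f => ∃ k : ℕ, 0 < k ∧ ∀ b : B, (f (FreeMonoid.of b)).length = k

/-- The `ω`-inequality `u ≤ v` holds in `O` with respect to the category `C`: for every
homomorphism `f : X* → A*` in `C`, where `X` is the set of variables occurring in `u v`, and every
state `p`, one has `p · f(u) ≤ p · f(v)`. Here `f(u)` stands for `f(u')`, where `u'` is `u` with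
`ω` replaced by an exponent `n` with `s ^ ω = s ^ n` in the transition monoid; the transformation
given by `f(u')` does not depend on the choice of `n`, and such an `n` exists for finite `Q`. -/
def OrderedSemiautomaton.Holds {Q A : Type} (O : OrderedSemiautomaton Q A) (C : HomCategory)
    (u v : OmegaTerm) : Prop :=
  ∀ n : ℕ, O.IsOmegaExponent n →
    ∀ f : FreeMonoid (u.vars ∪ v.vars : Finset ℕ) →* FreeMonoid A, C.Mem f →
      ∀ p : Q, O.le (O.act p (f (u.word n Finset.subset_union_left)))
        (O.act p (f (v.word n Finset.subset_union_right)))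

/-! ### Finite presentations and their encodings -/

/-- An ordered semiautomaton given as an input: the states are `0, …, numStates - 1` and the
letters are `0, …, numLetters - 1`, both sets being non-empty. -/
structure InputSemiautomaton where
  numStates : ℕ
  numLetters : ℕ
  numStates_pos : 0 < numStates
  numLetters_pos : 0 < numLetters
  aut : OrderedSemiautomaton (Fin numStates) (Fin numLetters)

/-- The unary code `1 … 1 0` of a natural number. -/
def unaryCode (k : ℕ) : List Bool := List.replicate k true ++ [false]

open Classical in
/-- The description of a semiautomaton as a binary string: the number of states, the number of
letters, the transition table (row by row) and the matrix of the order. Numbers are written in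
unary; as the table lists a state for each pair of a state and a letter, this is longer than a
description by a table of binary numbers by at most a polynomial. -/
noncomputable def InputSemiautomaton.code (I : InputSemiautomaton) : List Bool :=
  unaryCode I.numStates ++ unaryCode I.numLetters ++
    ((List.finRange I.numStates).flatMap fun q =>
      (List.finRange I.numLetters).flatMap fun a => unaryCode (I.aut.step q a)) ++
    ((List.finRange I.numStates).flatMap fun p =>
      (List.finRange I.numStates).map fun q => decide (I.aut.le p q))

/-- The code of an `ω`-term in reverse Polish notation: `0` stands for concatenation, `1` for the
operation `ω`, and `x + 2` for the variable `x`. -/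
def OmegaTerm.code : OmegaTerm → List ℕ
  | .var x => [x + 2]
  | .mul s t => s.code ++ t.code ++ [0]
  | .omega t => t.code ++ [1]

/-! ### Polynomial space -/

/-- The space occupied by a configuration of a multi-stack Turing machine: the total number of
symbols on its stacks. -/
def Turing.FinTM2.space (tm : Turing.FinTM2) (c : tm.Cfg) : ℕ :=
  (@Finset.univ tm.K tm.kFin).sum fun k => (Turing.TM2.Cfg.stk c k).length

/-- A deterministic Turing machine with finite stack alphabets that computes `f` (with respect to
the encodings `ea` and `eb`), with a polynomial such that no configuration reached on
an input of length `m` occupies more space than the value of the polynomial at `m`. -/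
structure TM2ComputableInPolySpace {α β αΓ βΓ : Type} (ea : α → List αΓ) (eb : β → List βΓ)
    (f : α → β) extends Turing.TM2Computable ea eb f where
  /-- Every stack alphabet is finite. -/
  finite_alphabet : ∀ k, Finite (tm.Γ k)
  /-- the polynomial bounding the space -/
  bound : Polynomial ℕ
  /-- All configurations in the run on an input stay within the bound. -/
  space_le : ∀ (a : α) (c : tm.Cfg),
    StateTransition.Reaches tm.step
      (Turing.initList tm (List.map inputAlphabet.invFun (ea a))) c →
    tm.space c ≤ bound.eval (ea a).length

open Classical in
/-- The predicate `P` on encoded inputs is decided by a polynomial space algorithm, i.e. by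
a Turing machine as above that always halts and outputs one bit, the truth value of `P`. -/
def DecidableInPolySpace {α αΓ : Type} (ea : α → List αΓ) (P : α → Prop) : Prop :=
  Nonempty (TM2ComputableInPolySpace ea (fun b : Bool => [b]) fun a => decide (P a))

/-!
Whether the inequality holds depends only on the transformations of the set of states, which has `n`
elements, that are given by the images of the variables. So the inequality is tested on all tuples of
transformations that come from a morphism of the category (`holds_iff_forall_lt`, `valid_iff`).
For literal morphisms these are the tuples of letters; for non-erasing ones, the tuples of
transformations `a · t` with a letter `a` and `t` in the transition monoid; for surjective ones,
the tuples from the transition monoid where every letter is the image of some variable (a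
homomorphism between free monoids is surjective if and only if every letter is the image of a
generator). For length-multiplying ones all components have to come from words of one common length
`k ≥ 1`; the set of transformations given by the words of length `k + 1` is determined by the one
for length `k`, so by the pigeonhole principle lengths up to `2 ^ (n ^ n)` suffice
(`exists_layer_eq`).

All of this is expressed by arithmetic on the number `N` whose binary digits, the lowest one first
and up to a final `1`, are the code of the semiautomaton; a transformation is represented by a
number below `n ^ n` (namespace `Codes`). The predicates and functions involved are obtained by
composition and primitive recursion (`LimRec`, with the closure properties of `Lim`), hence they are
primitive recursive. When the terms are part of the input, they are evaluated on a stack of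
transformations (`codeValue`); this gives decidability (`exists_computable_holds`).

For the first three categories and fixed terms, all numbers that occur have a length polynomial in
the length of the code: `n` itself is written in unary, and a transformation has length about
`n * log n`. Recursion where all intermediate values have polynomial length can be carried out in
polynomial space (`LimRec.decidableInPolySpace`): it is translated into programs for
binary counters (`CounterProg`), these into structured programs on stacks (`StackProg`), and these
into multi-stack Turing machines. The only point where an exponential amount of information seems
necessary is membership in the transition monoid, whose elements may need words of exponential
length. It is reachability in a graph with `n ^ n ≤ 2 ^ (n * n)` vertices, which is decided
by repeated squaring of the edge relation as in Savitch's theorem (`squared`); the recursion, of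
depth `n * n`, is turned into the iteration of one step on a stack of polynomial length
(namespace `Savitch`).
-/

/-! ### Structured programs on stacks -/

/-- A structured program acting on stacks of bits, indexed by `K`, and on one register of type
`Option Bool` that holds the outcome of the last `pop` or `peek` (`none` for an empty stack). -/
inductive StackProg (K : Type) : Type
  | push : K → Bool → StackProg K
  | pop : K → StackProg K
  | peek : K → StackProg K
  | seq : StackProg K → StackProg K → StackProg K
  | ite : (Option Bool → Bool) → StackProg K → StackProg K → StackProg K
  | loop : (Option Bool → Bool) → StackProg K → StackProg K

namespace StackProg

variable {K : Type}

/-- `Exec P p o S o' S'`: started with register `o` and stacks `S`, the program `p` terminates with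
register `o'` and stacks `S'`, and no stack that it pushes to ever gets higher than `P`. -/
inductive Exec [DecidableEq K] (P : ℕ) : StackProg K → Option Bool → (K → List Bool) → Option Bool →
    (K → List Bool) → Prop
  | push {k b o S} : (S k).length < P →
      Exec P (push k b) o S o (Function.update S k (b :: S k))
  | pop {k o S} : Exec P (pop k) o S (S k).head? (Function.update S k (S k).tail)
  | peek {k o S} : Exec P (peek k) o S (S k).head? S
  | seq {p q o S o₁ S₁ o₂ S₂} : Exec P p o S o₁ S₁ → Exec P q o₁ S₁ o₂ S₂ →
      Exec P (seq p q) o S o₂ S₂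
  | ite_true {c p q o S o₁ S₁} : c o = true → Exec P p o S o₁ S₁ → Exec P (ite c p q) o S o₁ S₁
  | ite_false {c p q o S o₁ S₁} : c o = false → Exec P q o S o₁ S₁ →
      Exec P (ite c p q) o S o₁ S₁
  | loop_done {c p o S} : c o = false → Exec P (loop c p) o S o S
  | loop_step {c p o S o₁ S₁ o₂ S₂} : c o = true → Exec P p o S o₁ S₁ →
      Exec P (loop c p) o₁ S₁ o₂ S₂ → Exec P (loop c p) o S o₂ S₂

/-- The labels of the Turing machine that carries out a program: one for each atomic step and each
test. -/
def Lab : StackProg K → Type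
  | push _ _ => Unit
  | pop _ => Unit
  | peek _ => Unit
  | seq p q => Lab p ⊕ Lab q
  | ite _ p q => Option (Lab p ⊕ Lab q)
  | loop _ p => Option (Lab p)

/-- The label at which a program starts. -/
def entry : (p : StackProg K) → Lab p
  | push _ _ => ()
  | pop _ => ()
  | peek _ => ()
  | seq p _ => .inl (entry p)
  | ite _ _ _ => none
  | loop _ _ => none

theorem finite_lab : ∀ p : StackProg K, Finite (Lab p)
  | push _ _ => inferInstanceAs (Finite Unit)
  | pop _ => inferInstanceAs (Finite Unit)
  | peek _ => inferInstanceAs (Finite Unit)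
  | seq p q => by
    have := finite_lab p
    have := finite_lab q
    exact inferInstanceAs (Finite (Lab p ⊕ Lab q))
  | ite _ p q => by
    have := finite_lab p
    have := finite_lab q
    exact inferInstanceAs (Finite (Option (Lab p ⊕ Lab q)))
  | loop _ p => by
    have := finite_lab p
    exact inferInstanceAs (Finite (Option (Lab p)))

/-- The statements of the Turing machine for a program whose labels are embedded into `L` by `emb`
and which continues at the label `exit` when it is finished. -/
def code {L : Type} : (p : StackProg K) → (Lab p → L) → L → Lab p →
    Turing.TM2.Stmt (fun _ : K => Bool) L (Option Bool)
  | push k b, _, exit => fun _ => .push k (fun _ => b) (.goto fun _ => exit)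
  | pop k, _, exit => fun _ => .pop k (fun _ o => o) (.goto fun _ => exit)
  | peek k, _, exit => fun _ => .peek k (fun _ o => o) (.goto fun _ => exit)
  | seq p q, emb, exit => fun l => match l with
    | .inl l => code p (fun l => emb (.inl l)) (emb (.inr (entry q))) l
    | .inr l => code q (fun l => emb (.inr l)) exit l
  | ite c p q, emb, exit => fun l => match l with
    | none => .branch c (.goto fun _ => emb (some (.inl (entry p))))
        (.goto fun _ => emb (some (.inr (entry q))))
    | some (.inl l) => code p (fun l => emb (some (.inl l))) exit l
    | some (.inr l) => code q (fun l => emb (some (.inr l))) exit l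
  | loop c p, emb, exit => fun l => match l with
    | none => .branch c (.goto fun _ => emb (some (entry p))) (.goto fun _ => exit)
    | some l => code p (fun l => emb (some l)) (emb none) l

end StackProg

/-- `BoundedPath step Φ c d`: iterating the partial function `step` leads from `c` to `d`, and all
configurations on the way satisfy `Φ`. -/
inductive BoundedPath {C : Type} (step : C → Option C) (Φ : C → Prop) : C → C → Prop
  | refl {c} : Φ c → BoundedPath step Φ c c
  | head {c d e} : Φ c → step c = some d → BoundedPath step Φ d e → BoundedPath step Φ c e

namespace BoundedPath

variable {C : Type} {step : C → Option C} {Φ : C → Prop}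

theorem trans {a b c : C} (h : BoundedPath step Φ a b) (h' : BoundedPath step Φ b c) :
    BoundedPath step Φ a c := by
  induction h with
  | refl _ => exact h'
  | head h1 h2 _ ih => exact .head h1 h2 (ih h')

theorem exists_iterate {a b : C} (h : BoundedPath step Φ a b) :
    ∃ n, (flip bind step)^[n] (some a) = some b := by
  induction h with
  | refl _ => exact ⟨0, rfl⟩
  | head _ h2 _ ih =>
    obtain ⟨n, hn⟩ := ih
    exact ⟨n + 1, by rw [Function.iterate_succ_apply, ← hn]; exact congrArg _ h2⟩

theorem of_reaches {a b c : C} (h : BoundedPath step Φ a b) (hb : step b = none)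
    (hc : StateTransition.Reaches step a c) : Φ c := by
  induction h with
  | refl h1 =>
    rcases Relation.ReflTransGen.cases_head hc with rfl | ⟨d, hd, _⟩
    · exact h1
    · simp [hb] at hd
  | head h1 h2 _ ih =>
    rcases Relation.ReflTransGen.cases_head hc with rfl | ⟨d, hd, hdc⟩
    · exact h1
    · rw [h2, Option.mem_def, Option.some.injEq] at hd
      subst hd
      exact ih hb hdc

end BoundedPath

namespace StackProg

variable {K : Type} [DecidableEq K]

theorem Exec.height_le {P : ℕ} {p : StackProg K} {o S o' S'} (h : Exec P p o S o' S')
    (hS : ∀ k, (S k).length ≤ P) : ∀ k, (S' k).length ≤ P := by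
  induction h with
  | @push k b o S hk =>
    intro j
    by_cases hj : j = k
    · subst hj; simpa using hk
    · simpa [hj] using hS j
  | @pop k o S =>
    intro j
    by_cases hj : j = k
    · subst hj; simpa using (hS j).trans (Nat.le_succ P)
    · simpa [hj] using hS j
  | peek => exact hS
  | seq _ _ ih1 ih2 => exact ih2 (ih1 hS)
  | ite_true _ _ ih => exact ih hS
  | ite_false _ _ ih => exact ih hS
  | loop_done _ => exact hS
  | loop_step _ _ _ ih1 ih2 => exact ih2 (ih1 hS)

/-- A machine that contains the statements of `p` carries out the program `p`, without exceeding
the height `P` of the stacks. -/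
theorem Exec.boundedPath {P : ℕ} {p : StackProg K} {o S o' S'} (h : Exec P p o S o' S')
    {L : Type} (m : L → Turing.TM2.Stmt (fun _ : K => Bool) L (Option Bool))
    (emb : Lab p → L) (exit : L) (hm : ∀ l, m (emb l) = code p emb exit l)
    (hS : ∀ k, (S k).length ≤ P) :
    BoundedPath (Turing.TM2.step m) (fun c => ∀ k, (c.stk k).length ≤ P)
      ⟨some (emb (entry p)), o, S⟩ ⟨some exit, o', S'⟩ := by
  induction h generalizing L with
  | @push k b o S hk =>
    have h' := (Exec.push (b := b) (o := o) hk).height_le hS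
    refine .head hS ?_ (.refl h')
    simp [Turing.TM2.step, hm, code, Turing.TM2.stepAux]
  | @pop k o S =>
    have h' := (Exec.pop (k := k) (o := o)).height_le hS
    refine .head hS ?_ (.refl h')
    simp [Turing.TM2.step, hm, code, Turing.TM2.stepAux]
  | peek =>
    refine .head hS ?_ (.refl hS)
    simp [Turing.TM2.step, hm, code, Turing.TM2.stepAux]
  | @seq p q _ _ _ _ _ _ h1 h2 ih1 ih2 =>
    exact (ih1 m (fun l => emb (.inl l)) (emb (.inr (entry q))) (fun l => hm (.inl l)) hS).trans
      (ih2 m (fun l => emb (.inr l)) exit (fun l => hm (.inr l)) (h1.height_le hS))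
  | @ite_true c p q _ _ _ _ hc h1 ih =>
    refine .head hS ?_ (ih m (fun l => emb (some (.inl l))) exit (fun l => hm (some (.inl l))) hS)
    rw [Turing.TM2.step, entry, hm none]
    simp [code, Turing.TM2.stepAux, hc]
  | @ite_false c p q _ _ _ _ hc h1 ih =>
    refine .head hS ?_ (ih m (fun l => emb (some (.inr l))) exit (fun l => hm (some (.inr l))) hS)
    rw [Turing.TM2.step, entry, hm none]
    simp [code, Turing.TM2.stepAux, hc]
  | @loop_done c p _ _ hc =>
    refine .head hS ?_ (.refl hS)
    rw [Turing.TM2.step, entry, hm none]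
    simp [code, Turing.TM2.stepAux, hc]
  | @loop_step c p _ _ _ _ _ _ hc h1 h2 ih1 ih2 =>
    refine .head hS ?_ ((ih1 m (fun l => emb (some l)) (emb none) (fun l => hm (some l)) hS).trans
      (ih2 m emb exit hm (h1.height_le hS)))
    rw [Turing.TM2.step, entry, hm none]
    simp [code, Turing.TM2.stepAux, hc]

/-- The Turing machine for a program `p` that reads its input from the stack `k₀` and leaves its
output there. -/
noncomputable def machine [Fintype K] (p : StackProg K) (k₀ : K) : Turing.FinTM2 :=
  letI := finite_lab p
  letI := Fintype.ofFinite (Lab p)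
  { K := K
    k₀ := k₀
    k₁ := k₀
    Γ := fun _ => Bool
    Λ := Option (Lab p)
    main := some (entry p)
    σ := Option Bool
    initialState := none
    m := fun l => match l with
      | some l => code p some none l
      | none => .halt }

/-- The stacks on which only `k₀` is non-empty. -/
def only (k₀ : K) (l : List Bool) : K → List Bool :=
  Function.update (fun _ => []) k₀ l

theorem only_self (k₀ : K) (l : List Bool) : only k₀ l k₀ = l :=
  Function.update_self ..

theorem only_of_ne {k₀ k : K} (l : List Bool) (h : k ≠ k₀) : only k₀ l k = [] :=
  Function.update_of_ne h ..

/-- A program that decides a predicate on encoded inputs, with stacks of polynomial height, yields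
a polynomial space algorithm. -/
theorem decidableInPolySpace [Fintype K] {α : Type} (ea : α → List Bool) (R : α → Prop)
    (p : StackProg K) (k₀ : K) (b : Polynomial ℕ)
    (hb : ∀ a, (ea a).length ≤ b.eval (ea a).length)
    (h : ∀ a (r : Bool), (r = true ↔ R a) →
      Exec (b.eval (ea a).length) p none (only k₀ (ea a)) none (only k₀ [r])) :
    DecidableInPolySpace ea R := by
  classical
  have hinit : ∀ l : List Bool, Turing.initList (machine p k₀) l =
      ⟨some (some (entry p)), none, only k₀ l⟩ := by
    intro l
    unfold Turing.initList
    congr 1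
    refine funext fun k : K => ?_
    by_cases hk : k = k₀
    · subst hk
      exact (dif_pos rfl).trans (only_self k l).symm
    · exact (dif_neg hk).trans (only_of_ne l hk).symm
  have hhalt : ∀ l : List Bool, Turing.haltList (machine p k₀) l =
      ⟨none, none, only k₀ l⟩ := by
    intro l
    unfold Turing.haltList
    congr 1
    refine funext fun k : K => ?_
    by_cases hk : k = k₀
    · subst hk
      exact (dif_pos rfl).trans (only_self k l).symm
    · exact (dif_neg hk).trans (only_of_ne l hk).symm
  have hpath : ∀ a, BoundedPath (machine p k₀).step
      (fun c => ∀ k : K, (Turing.TM2.Cfg.stk c k).length ≤ b.eval (ea a).length)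
      (Turing.initList (machine p k₀) (ea a))
      (Turing.haltList (machine p k₀) [decide (R a)]) := by
    intro a
    have he := h a (decide (R a)) (by simp)
    have hS : ∀ k, (only k₀ (ea a) k).length ≤ b.eval (ea a).length := by
      intro k
      by_cases hk : k = k₀
      · subst hk; simpa [only] using hb a
      · simp [only, hk]
    have hp := (he.boundedPath (machine p k₀).m some none (fun _ => rfl) hS).trans
      (.head (he.height_le hS) rfl (.refl (he.height_le hS)))
    exact Eq.mpr (congrArg₂ (BoundedPath _ _) (hinit _) (hhalt _)) hp
  refine ⟨{
    tm := machine p k₀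
    inputAlphabet := Equiv.refl Bool
    outputAlphabet := Equiv.refl Bool
    outputsFun := fun a => ?_
    finite_alphabet := fun _ => inferInstanceAs (Finite Bool)
    bound := Polynomial.C (Fintype.card K) * b
    space_le := ?_ }⟩
  · refine ⟨(hpath a).exists_iterate.choose, ?_⟩
    have := (hpath a).exists_iterate.choose_spec
    have hid : ∀ l l' : List Bool, l = ea a → l' = [decide (R a)] →
        (flip bind (machine p k₀).step)^[(hpath a).exists_iterate.choose]
          (some (Turing.initList (machine p k₀) l)) =
          some (Turing.haltList (machine p k₀) l') := by
      rintro _ _ rfl rfl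
      exact this
    exact hid _ _ (List.map_id _) (List.map_id _)
  · intro a c hc
    have hid : ∀ l : List Bool, l = ea a → StateTransition.Reaches (machine p k₀).step
        (Turing.initList (machine p k₀) l) c → StateTransition.Reaches (machine p k₀).step
        (Turing.initList (machine p k₀) (ea a)) c := by
      rintro _ rfl
      exact id
    have := (hpath a).of_reaches rfl (hid _ (List.map_id _) hc)
    rw [Polynomial.eval_mul, Polynomial.eval_C]
    exact (Finset.sum_le_card_nsmul _ _ _ fun k _ => this k).trans_eq (by rfl)

end StackProg

/-! ### Binary counters on stacks -/

namespace StackProg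

variable {K : Type} [DecidableEq K]

/-- Removes the maximal block of bits `b` from the top of `k`, together with the bit below it, and
puts a block of negated bits of the same length on `t`. -/
def strip (k t : K) (b : Bool) : StackProg K :=
  seq (pop k) (loop (fun o => o == some b) (seq (push t (!b)) (pop k)))

/-- Moves the content of the stack `t` to the stack `k`, reversing the order. -/
def move (t k : K) : StackProg K :=
  seq (pop t) (loop (fun o => o.isSome)
    (seq (ite (fun o => o == some true) (push k true) (push k false)) (pop t)))

/-- Empties the stack `k`. -/
def clear (k : K) : StackProg K :=
  seq (pop k) (loop (fun o => o.isSome) (pop k))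

/-- Adds one to the binary number on `k`, least significant bit on top, with `t` as an auxiliary
stack. -/
def incr (k t : K) : StackProg K :=
  seq (strip k t true) (seq (push k true) (move t k))

/-- Subtracts one from the binary number on `k`, with `t` as an auxiliary stack. -/
def decr (k t : K) : StackProg K :=
  seq (strip k t false)
    (seq (ite (fun o => o.isSome)
      (seq (peek k) (ite (fun o => o.isSome) (push k false) (peek k))) (peek k)) (move t k))

theorem exec_strip {P : ℕ} {k t : K} (hkt : k ≠ t) (b : Bool) (r : List Bool)
    (hr : r.head? ≠ some b) : ∀ (j : ℕ) (o : Option Bool) (S : K → List Bool),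
    S k = List.replicate j b ++ r → (S t).length + j ≤ P →
    Exec P (strip k t b) o S r.head?
      (Function.update (Function.update S k r.tail) t (List.replicate j (!b) ++ S t)) := by
  intro j
  induction j with
  | zero =>
    intro o S hS hP
    have h1 := Exec.pop (P := P) (k := k) (o := o) (S := S)
    rw [hS] at h1
    refine .seq h1 ?_
    have e : Function.update (Function.update S k r.tail) t (List.replicate 0 (!b) ++ S t) =
        Function.update S k r.tail := by
      funext i
      by_cases hi : i = t
      · subst hi; simp [Ne.symm hkt]
      · simp [hi]
    rw [e]
    exact .loop_done (by simpa using hr)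
  | succ j ih =>
    intro o S hS hP
    have h1 := Exec.pop (P := P) (k := k) (o := o) (S := S)
    rw [hS] at h1
    refine .seq h1 (.loop_step (by simp [List.replicate_succ]) (.seq (.push ?_) .pop) ?_)
    · simp [Ne.symm hkt]; omega
    -- the remaining run of the loop is the run of the whole program after one bit was moved
    have h2 := ih none (Function.update (Function.update S k (List.replicate j b ++ r)) t
      ((!b) :: S t)) (by simp [hkt]) (by simp; omega)
    cases h2 with
    | seq h3 h4 =>
      cases h3
      convert h4 using 1
      · simp [hkt, Ne.symm hkt, List.replicate_succ]
      · simp [hkt, Ne.symm hkt, List.replicate_succ]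
      · funext i
        by_cases hi : i = t
        · subst hi
          simp [List.replicate_succ', List.append_assoc]
        · by_cases hik : i = k
          · subst hik; simp [hi]
          · simp [hi, hik]

theorem exec_move {P : ℕ} {t k : K} (hkt : k ≠ t) : ∀ (l : List Bool) (o : Option Bool)
    (S : K → List Bool), S t = l → (S k).length + l.length ≤ P →
    Exec P (move t k) o S none
      (Function.update (Function.update S k (l.reverse ++ S k)) t []) := by
  intro l
  induction l with
  | nil =>
    intro o S hS hP
    have h1 := Exec.pop (P := P) (k := t) (o := o) (S := S)
    rw [hS] at h1
    refine .seq h1 ?_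
    simpa using Exec.loop_done (P := P) (by simp)
  | cons b l ih =>
    intro o S hS hP
    have h1 := Exec.pop (P := P) (k := t) (o := o) (S := S)
    rw [hS] at h1
    refine .seq h1 (.loop_step (by simp)
      (.seq (S₁ := Function.update (Function.update S t l) k (b :: S k)) (o₁ := some b) ?_ .pop) ?_)
    · have hl : (Function.update S t l k).length < P := by
        simp only [ne_eq, hkt, not_false_eq_true, Function.update_of_ne]
        simp only [List.length_cons] at hP
        omega
      have h := fun b => Exec.push (b := b) (o := some b) hl
      simp only [ne_eq, hkt, not_false_eq_true, Function.update_of_ne] at h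
      cases b
      · exact .ite_false (by simp) (h false)
      · exact .ite_true (by simp) (h true)
    have h2 := ih none (Function.update (Function.update S t l) k (b :: S k))
      (by simp [Ne.symm hkt]) (by simp at hP ⊢; omega)
    cases h2 with
    | seq h3 h4 =>
      cases h3
      convert h4 using 1
      funext i
      by_cases hi : i = t
      · subst hi; simp
      · by_cases hik : i = k
        · subst hik; simp [hi]
        · simp [hi, hik]

theorem exec_clear {P : ℕ} {k : K} : ∀ (l : List Bool) (o : Option Bool) (S : K → List Bool),
    S k = l → Exec P (clear k) o S none (Function.update S k []) := by
  intro l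
  induction l with
  | nil =>
    intro o S hS
    have h1 := Exec.pop (P := P) (k := k) (o := o) (S := S)
    rw [hS] at h1
    exact .seq h1 (.loop_done (by simp))
  | cons b l ih =>
    intro o S hS
    have h1 := Exec.pop (P := P) (k := k) (o := o) (S := S)
    rw [hS] at h1
    refine .seq h1 (.loop_step (by simp) .pop ?_)
    have h2 := ih none (Function.update S k l) (by simp)
    cases h2 with
    | seq h3 h4 =>
      cases h3
      simpa using h4

/-- The effect of adding one on the binary digits. -/
theorem bits_succ (n : ℕ) : ∃ (j : ℕ) (r : List Bool), (r = [] ∨ ∃ r', r' ≠ [] ∧ r = false :: r') ∧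
    n.bits = List.replicate j true ++ r ∧
    (n + 1).bits = List.replicate j false ++ true :: r.tail := by
  induction n using Nat.binaryRec' with
  | zero => exact ⟨0, [], .inl rfl, by simp, by simp⟩
  | bit b n hn ih =>
    cases b with
    | false =>
      have hn0 : n ≠ 0 := fun h => by simpa using hn h
      refine ⟨0, false :: n.bits, .inr ⟨n.bits, ?_, rfl⟩, ?_, ?_⟩
      · intro h
        apply hn0
        have := Nat.size_eq_bits_len n
        rw [h] at this
        exact Nat.size_eq_zero.1 this.symm
      · rw [Nat.bits_append_bit _ _ hn]; simp
      · have : Nat.bit false n + 1 = Nat.bit true n := by simp [Nat.bit_val]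
        rw [this, Nat.bits_append_bit _ _ (by simp)]
        simp
    | true =>
      obtain ⟨j, r, h1, h2, h3⟩ := ih
      refine ⟨j + 1, r, h1, ?_, ?_⟩
      · rw [Nat.bits_append_bit _ _ hn, h2]; simp [List.replicate_succ]
      · have : Nat.bit true n + 1 = Nat.bit false (n + 1) := by simp [Nat.bit_val]; ring
        rw [this, Nat.bits_append_bit _ _ (by simp), h3]
        simp [List.replicate_succ]

theorem exec_incr {P : ℕ} {k t : K} (hkt : k ≠ t) {n : ℕ} {o : Option Bool} {S : K → List Bool}
    (hk : S k = n.bits) (ht : S t = []) (hP : (n + 1).bits.length ≤ P) :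
    Exec P (incr k t) o S none (Function.update S k (n + 1).bits) := by
  obtain ⟨j, r, h1, h2, h3⟩ := bits_succ n
  have hlen := hP
  rw [h3] at hlen
  simp only [List.length_append, List.length_replicate, List.length_cons,
    List.length_tail] at hlen
  have hr : r.head? ≠ some true := by
    rcases h1 with rfl | ⟨r', _, rfl⟩ <;> simp
  refine .seq (exec_strip hkt true r hr j o S (by rw [hk, h2]) (by rw [ht]; simp; omega))
    (.seq (.push ?_) ?_)
  · simp [hkt]; omega
  · have := exec_move (P := P) hkt (List.replicate j false) r.head? (Function.update
      (Function.update (Function.update S k r.tail) t (List.replicate j false ++ S t)) k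
      (true :: r.tail)) (by simp [ht, Ne.symm hkt]) (by simp; omega)
    convert this using 1
    · simp [hkt]
    · funext i
      by_cases hi : i = t
      · subst hi; simp [ht, Ne.symm hkt]
      · by_cases hik : i = k
        · subst hik; simp [hi, h3]
        · simp [hi, hik]

theorem exec_decr {P : ℕ} {k t : K} (hkt : k ≠ t) {n : ℕ} {o : Option Bool} {S : K → List Bool}
    (hk : S k = n.bits) (ht : S t = []) (hP : n.bits.length ≤ P) :
    Exec P (decr k t) o S none (Function.update S k (n - 1).bits) := by
  rcases n with _ | n
  · refine .seq (exec_strip hkt false [] (by simp) 0 o S (by rw [hk]; simp) (by rw [ht]; simp))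
      (.seq (.ite_false (by simp) .peek) ?_)
    have := exec_move (P := P) hkt [] none S ht (by rw [hk]; simp)
    convert this using 1
    · simp [hkt]
    · funext i
      by_cases hi : i = t
      · subst hi; simp [ht]
      · by_cases hik : i = k
        · subst hik; simp [hi, hk]
        · simp [hi, hik]
    · funext i
      by_cases hi : i = t
      · subst hi; simp [ht, Ne.symm hkt]
      · by_cases hik : i = k
        · subst hik; simp [hi, hk]
        · simp [hi, hik]
  · obtain ⟨j, r, h1, h2, h3⟩ := bits_succ n
    have hlen := hP
    rw [h3] at hlen
    simp only [List.length_append, List.length_replicate, List.length_cons] at hlen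
    rw [Nat.add_sub_cancel, h2]
    refine .seq (exec_strip hkt false (true :: r.tail) (by simp) j o S (by rw [hk, h3])
      (by rw [ht]; simp; omega)) ?_
    have hmove : ∀ o, Exec P (move t k) o (Function.update (Function.update S k r) t
        (List.replicate j true)) none (Function.update S k (List.replicate j true ++ r)) := by
      intro o
      have := exec_move (P := P) hkt (List.replicate j true) o (Function.update
        (Function.update S k r) t (List.replicate j true)) (by simp) (by
          rcases h1 with rfl | ⟨r', _, rfl⟩ <;> simp [hkt] at hlen ⊢ <;> omega)
      convert this using 1
      funext i
      by_cases hi : i = t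
      · subst hi; simp [ht, Ne.symm hkt]
      · by_cases hik : i = k
        · subst hik; simp [hi]
        · simp [hi, hik]
    rcases h1 with rfl | ⟨r', hr', rfl⟩
    · refine .seq (.ite_true (by simp) (.seq .peek (.ite_false (by simp [hkt]) .peek))) ?_
      simpa [ht] using hmove _
    · obtain ⟨b, r'', rfl⟩ := List.exists_cons_of_ne_nil hr'
      refine .seq (.ite_true (by simp) (.seq .peek (.ite_true (by simp [hkt]) (.push ?_)))) ?_
      · simp [hkt] at hlen ⊢; omega
      · convert hmove _ using 1
        funext i
        by_cases hi : i = t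
        · subst hi; simp [ht, Ne.symm hkt]
        · by_cases hik : i = k
          · subst hik; simp [hi]
          · simp [hi, hik]

end StackProg

/-! ### Counter programs -/

/-- A structured program on counters, which are indexed by natural numbers; `loop r p` repeats `p`
as long as the counter `r` is not zero. -/
inductive CounterProg : Type
  | inc : ℕ → CounterProg
  | dec : ℕ → CounterProg
  | seq : CounterProg → CounterProg → CounterProg
  | loop : ℕ → CounterProg → CounterProg

namespace CounterProg

/-- `Exec B p s s'`: started with the values `s` of the counters, the program `p` terminates with
the values `s'`, and never increases a counter beyond `B`. -/
inductive Exec (B : ℕ) : CounterProg → (ℕ → ℕ) → (ℕ → ℕ) → Prop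
  | inc {r s} : s r < B → Exec B (inc r) s (Function.update s r (s r + 1))
  | dec {r s} : Exec B (dec r) s (Function.update s r (s r - 1))
  | seq {p q s s₁ s₂} : Exec B p s s₁ → Exec B q s₁ s₂ → Exec B (seq p q) s s₂
  | loop_done {r p s} : s r = 0 → Exec B (loop r p) s s
  | loop_step {r p s s₁ s₂} : s r ≠ 0 → Exec B p s s₁ → Exec B (loop r p) s₁ s₂ →
      Exec B (loop r p) s s₂

/-- A number above all counters that a program mentions. -/
def width : CounterProg → ℕ
  | inc r => r + 1
  | dec r => r + 1
  | seq p q => max (width p) (width q)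
  | loop r p => max (r + 1) (width p)

theorem Exec.le {B : ℕ} {p : CounterProg} {s s' : ℕ → ℕ} (h : Exec B p s s')
    (hs : ∀ r, s r ≤ B) : ∀ r, s' r ≤ B := by
  induction h with
  | @inc r s hr =>
    intro j
    by_cases hj : j = r
    · subst hj; simpa using hr
    · simpa [hj] using hs j
  | @dec r s =>
    intro j
    by_cases hj : j = r
    · subst hj; simpa using (hs j).trans (Nat.le_succ B)
    · simpa [hj] using hs j
  | seq _ _ ih1 ih2 => exact ih2 (ih1 hs)
  | loop_done _ => exact hs
  | loop_step _ _ _ ih1 ih2 => exact ih2 (ih1 hs)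

/-- The stack that holds the counter `r`, among stacks `some 0`, …, `some (M - 1)` for counters
and an auxiliary stack `none`. -/
def reg (M r : ℕ) : Option (Fin M) :=
  if h : r < M then some ⟨r, h⟩ else none

/-- The stack program that performs a counter program on binary numbers. -/
def toStack (M : ℕ) : CounterProg → StackProg (Option (Fin M))
  | inc r => .incr (reg M r) none
  | dec r => .decr (reg M r) none
  | seq p q => .seq (toStack M p) (toStack M q)
  | loop r p => .seq (.peek (reg M r))
      (.loop (fun o => o.isSome) (.seq (toStack M p) (.peek (reg M r))))

/-- The contents of the stacks for given values of the counters. -/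
def cells (M : ℕ) (s : ℕ → ℕ) : Option (Fin M) → List Bool :=
  fun k => k.elim [] fun i => (s i).bits

theorem cells_reg {M r : ℕ} (h : r < M) (s : ℕ → ℕ) : cells M s (reg M r) = (s r).bits := by
  simp [cells, reg, h]

theorem cells_update {M r : ℕ} (h : r < M) (s : ℕ → ℕ) (n : ℕ) :
    cells M (Function.update s r n) = Function.update (cells M s) (reg M r) n.bits := by
  funext k
  cases k with
  | none => simp [cells, reg, h]
  | some i =>
    by_cases hi : (i : ℕ) = r
    · subst hi; simp [cells, reg]
    · have : (some i : Option (Fin M)) ≠ reg M r := by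
        simp only [reg, h, ↓reduceDIte, ne_eq, Option.some.injEq]
        exact fun h => hi (by rw [h])
      simp [cells, hi, this]

theorem reg_ne_none {M r : ℕ} (h : r < M) : reg M r ≠ none := by
  simp [reg, h]

theorem head?_bits_isSome (n : ℕ) : n.bits.head?.isSome = true ↔ n ≠ 0 := by
  rw [Ne, ← Nat.size_eq_zero, ← Nat.size_eq_bits_len]
  cases n.bits <;> simp

theorem bits_length_le {n B : ℕ} (h : n ≤ B) : n.bits.length ≤ B.size := by
  rw [Nat.size_eq_bits_len]
  exact Nat.size_le_size h

theorem Exec.toStack {B : ℕ} {p : CounterProg} {s s' : ℕ → ℕ} (h : Exec B p s s') {M P : ℕ}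
    (hM : p.width ≤ M) (hP : B.size ≤ P) (hs : ∀ r, s r ≤ B) (o : Option Bool) :
    ∃ o', StackProg.Exec P (toStack M p) o (cells M s) o' (cells M s') := by
  induction h generalizing o with
  | @inc r s hr =>
    have hrM : r < M := hM
    exact ⟨none, by
      rw [cells_update hrM]
      exact StackProg.exec_incr (reg_ne_none hrM) (cells_reg hrM s) rfl
        ((bits_length_le hr).trans hP)⟩
  | @dec r s =>
    have hrM : r < M := hM
    exact ⟨none, by
      rw [cells_update hrM]
      exact StackProg.exec_decr (reg_ne_none hrM) (cells_reg hrM s) rfl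
        ((bits_length_le (hs r)).trans hP)⟩
  | seq h1 _ ih1 ih2 =>
    obtain ⟨o₁, e1⟩ := ih1 (le_trans (le_max_left _ _) hM) hs o
    obtain ⟨o₂, e2⟩ := ih2 (le_trans (le_max_right _ _) hM) (h1.le hs) o₁
    exact ⟨o₂, .seq e1 e2⟩
  | @loop_done r p s h0 =>
    have hrM : r < M := le_trans (le_max_left _ _) hM
    refine ⟨_, .seq .peek (.loop_done ?_)⟩
    rw [cells_reg hrM, h0]
    simp
  | @loop_step r p s s₁ s₂ h0 h1 _ ih1 ih2 =>
    have hrM : r < M := le_trans (le_max_left _ _) hM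
    obtain ⟨o₁, e1⟩ := ih1 (le_trans (le_max_right _ _) hM) hs
      (cells M s (reg M r)).head?
    obtain ⟨o₂, e2⟩ := ih2 hM (h1.le hs) o₁
    cases e2 with
    | seq e3 e4 =>
      cases e3
      refine ⟨o₂, .seq .peek (.loop_step ?_ (.seq e1 .peek) e4)⟩
      rw [cells_reg hrM]
      exact (head?_bits_isSome _).2 h0

/-- The number whose binary digits, from the least significant one, are the bits of the list,
followed by `1`. -/
def _root_.List.toMarkedNat (l : List Bool) : ℕ :=
  l.foldr Nat.bit 1

theorem bits_toMarkedNat (l : List Bool) : l.toMarkedNat.bits = l ++ [true] := by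
  have hpos : ∀ l : List Bool, l.toMarkedNat ≠ 0 := by
    intro l
    induction l with
    | nil => simp [List.toMarkedNat]
    | cons b l ih =>
      change Nat.bit b l.toMarkedNat ≠ 0
      simp [Nat.bit_eq_zero_iff, ih]
  induction l with
  | nil => simp [List.toMarkedNat]
  | cons b l ih =>
    change (Nat.bit b l.toMarkedNat).bits = _
    rw [Nat.bits_append_bit _ _ (fun h => absurd h (hpos l)), ih]
    rfl

theorem size_toMarkedNat (l : List Bool) : l.toMarkedNat.size = l.length + 1 := by
  rw [← Nat.size_eq_bits_len, bits_toMarkedNat]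
  simp

/-- A counter program that decides a predicate on encoded inputs, read as binary numbers from
the counter `0`, yields a polynomial space algorithm if the lengths of its numbers are bounded by
a polynomial. -/
theorem decidableInPolySpace {α : Type} (ea : α → List Bool) (R : α → Prop)
    (p : CounterProg) (B : α → ℕ) (b : Polynomial ℕ)
    (hb : ∀ a, (B a).size ≤ b.eval (ea a).length)
    (hB : ∀ a, (ea a).toMarkedNat ≤ B a)
    (h : ∀ a (r : Bool), (r = true ↔ R a) →
      Exec (B a) p (Function.update (fun _ => 0) 0 (ea a).toMarkedNat)
        (Function.update (Function.update (fun _ => 0) 0 (ea a).toMarkedNat) 1 r.toNat)) :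
    DecidableInPolySpace ea R := by
  obtain ⟨M, hM2, hMp⟩ : ∃ M, 2 ≤ M ∧ p.width ≤ M := ⟨max 2 p.width, by simp, by simp⟩
  have h0 : 0 < M := by omega
  have h1 : 1 < M := by omega
  have h01 : reg M 0 ≠ reg M 1 := by simp [reg, h0, h1]
  refine StackProg.decidableInPolySpace ea R
    (.seq (.move none (reg M 1)) (.seq (.push (reg M 0) true) (.seq (.move (reg M 1) (reg M 0))
      (.seq (toStack M p) (.seq (.clear (reg M 0)) (.seq (.pop (reg M 1)) (.seq
        (.ite (fun o => o.isSome) (.push none true) (.push none false)) (.peek (reg M 1)))))))))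
    none (b + Polynomial.X + 2) (fun a => by simp; omega) fun a r hr => ?_
  generalize hP : (b + Polynomial.X + 2 : Polynomial ℕ).eval (ea a).length = P
  have hP' : (B a).size + (ea a).length + 2 ≤ P := by
    rw [← hP]
    simpa using hb a
  set N := (ea a).toMarkedNat with hN
  have e1 := StackProg.exec_move (P := P) (reg_ne_none h1) (ea a) none
    (StackProg.only none (ea a)) (StackProg.only_self _ _)
    (by rw [StackProg.only_of_ne _ (reg_ne_none h1)]; simp; omega)
  have e2 := StackProg.Exec.push (P := P) (k := reg M 0) (b := true) (o := none)
    (S := Function.update (fun _ => []) (reg M 1) (ea a).reverse) (by simp [h01]; omega)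
  have e3 := StackProg.exec_move (P := P) h01 (ea a).reverse none
    (Function.update (Function.update (fun _ => []) (reg M 1) (ea a).reverse) (reg M 0) [true])
    (by simp [Ne.symm h01]) (by simp; omega)
  have hs : ∀ i, Function.update (fun _ => 0) 0 N i ≤ B a := by
    intro i
    by_cases hi : i = 0
    · subst hi; simpa using hB a
    · simp [hi]
  obtain ⟨o₁, e4⟩ := (h a r hr).toStack hMp (P := P) (by omega) hs none
  have e5 := StackProg.exec_clear (P := P) (k := reg M 0) _ o₁
    (cells M (Function.update (Function.update (fun _ => 0) 0 N) 1 r.toNat)) rfl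
  have e0 : cells M (fun _ => 0) = fun _ => [] := by
    funext k
    cases k <;> simp [cells]
  rw [cells_update h1, cells_update h0, e0] at e4 e5
  have e6 := StackProg.Exec.pop (P := P) (k := reg M 1) (o := none)
    (S := Function.update (fun _ => []) (reg M 1) r.toNat.bits)
  refine .seq (o₁ := none) (S₁ := Function.update (fun _ => []) (reg M 1) (ea a).reverse) ?_
    (.seq (o₁ := none) (S₁ := Function.update (Function.update (fun _ => []) (reg M 1)
      (ea a).reverse) (reg M 0) [true]) ?_
    (.seq (o₁ := none) (S₁ := Function.update (fun _ => []) (reg M 0) N.bits) ?_ (.seq e4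
      (.seq (o₁ := none) (S₁ := Function.update (fun _ => []) (reg M 1) r.toNat.bits) ?_
        (.seq (o₁ := r.toNat.bits.head?) (S₁ := fun _ => []) ?_
          (.seq (o₁ := r.toNat.bits.head?) (S₁ := StackProg.only none [r]) ?_ ?_))))))
  · convert e1 using 1
    funext k
    cases k with
    | none => simp [(reg_ne_none h1).symm]
    | some i =>
      by_cases hi : some i = reg M 1
      · rw [← hi]; simp [StackProg.only]
      · simp [hi, StackProg.only]
  · simpa [h01] using e2
  · convert e3 using 1
    funext k
    by_cases hk : k = reg M 0
    · subst hk; simp [h01, hN, bits_toMarkedNat]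
    · by_cases hk1 : k = reg M 1
      · subst hk1; simp [hk]
      · simp [hk, hk1]
  · convert e5 using 1
    funext k
    by_cases hk : k = reg M 0
    · subst hk; simp [h01]
    · by_cases hk1 : k = reg M 1
      · subst hk1; simp [hk]
      · simp [hk, hk1]
  · convert e6 using 1
    · simp
    · funext k
      by_cases hk : k = reg M 1
      · subst hk; cases r <;> simp
      · simp [hk]
  · have e7 := fun c => StackProg.Exec.push (P := P) (k := (none : Option (Fin M))) (b := c)
      (o := r.toNat.bits.head?) (S := fun _ => []) (by simp; omega)
    cases r
    · exact .ite_false (by simp) (e7 false)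
    · exact .ite_true (by simp) (e7 true)
  · have := StackProg.Exec.peek (P := P) (k := reg M 1) (o := r.toNat.bits.head?)
      (S := StackProg.only none [r])
    rwa [StackProg.only_of_ne _ (reg_ne_none h1)] at this

end CounterProg

/-! ### Recursion with results of polynomial length -/

open Matrix (vecCons)

/-- A measure for the total binary length of a tuple. -/
def weight {k : ℕ} (v : Fin k → ℕ) : ℕ := 2 + ∑ i, (v i).size

theorem two_le_weight {k : ℕ} (v : Fin k → ℕ) : 2 ≤ weight v := Nat.le_add_right _ _

theorem weight_vecCons {k : ℕ} (a : ℕ) (v : Fin k → ℕ) :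
    weight (vecCons a v) = a.size + weight v := by
  simp [weight, Fin.sum_univ_succ]
  ring

theorem size_le_weight {k : ℕ} (v : Fin k → ℕ) (i : Fin k) : (v i).size ≤ weight v :=
  (Finset.single_le_sum (f := fun i => (v i).size) (fun _ _ => Nat.zero_le _)
    (Finset.mem_univ i)).trans (Nat.le_add_left _ _)

/-- The value after `i` steps of a primitive recursion with parameters `v`. -/
def recVal {k : ℕ} (g : (Fin k → ℕ) → ℕ) (h : (Fin (k + 2) → ℕ) → ℕ) (v : Fin k → ℕ) : ℕ → ℕ
  | 0 => g v
  | i + 1 => h (vecCons i (vecCons (recVal g h v i) v))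

/-- The functions obtained by composition and by primitive recursion where, provided that the
proposition `bd` holds, the binary length of all intermediate values of a recursion is bounded by a
polynomial in the binary length of the parameters. For `bd := True` these functions are computed in
polynomial space, and for `bd := False` they are just the primitive recursive functions. -/
inductive LimRec (bd : Prop) : ∀ {k : ℕ}, ((Fin k → ℕ) → ℕ) → Prop
  | zero {k : ℕ} : LimRec bd (fun _ : Fin k → ℕ => 0)
  | succ {k : ℕ} {f : (Fin k → ℕ) → ℕ} : LimRec bd f → LimRec bd (fun v => f v + 1)
  | get {k : ℕ} (i : Fin k) : LimRec bd (fun v => v i)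
  | comp {k l : ℕ} {f : (Fin l → ℕ) → ℕ} {g : Fin l → (Fin k → ℕ) → ℕ} :
      LimRec bd f → (∀ i, LimRec bd (g i)) → LimRec bd (fun v => f fun i => g i v)
  | prec {k : ℕ} {n g : (Fin k → ℕ) → ℕ} {h : (Fin (k + 2) → ℕ) → ℕ} :
      LimRec bd n → LimRec bd g → LimRec bd h →
      (bd → ∃ c, ∀ v, ∀ i ≤ n v, recVal g h v i ≤ 2 ^ weight v ^ c) →
      LimRec bd (fun v => recVal g h v (n v))

theorem size_le_of_le_two_pow {n m : ℕ} (h : n ≤ 2 ^ m) : n.size ≤ m + 1 :=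
  Nat.size_le.2 (h.trans_lt (Nat.pow_lt_pow_right (by norm_num) (Nat.lt_succ_self m)))

theorem const_le_pow {L : ℕ} (hL : 2 ≤ L) (m : ℕ) : m ≤ L ^ m :=
  (Nat.lt_two_pow_self (n := m)).le.trans (Nat.pow_le_pow_left hL m)

theorem pow_add_pow_le_pow_succ {L : ℕ} (hL : 2 ≤ L) (a b : ℕ) :
    L ^ a + L ^ b ≤ L ^ (a + b + 1) := by
  have h1 : L ^ a ≤ L ^ (a + b) := Nat.pow_le_pow_right (by omega) (by omega)
  have h2 : L ^ b ≤ L ^ (a + b) := Nat.pow_le_pow_right (by omega) (by omega)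
  calc L ^ a + L ^ b ≤ L ^ (a + b) * 2 := by omega
    _ ≤ L ^ (a + b) * L := Nat.mul_le_mul_left _ hL
    _ = L ^ (a + b + 1) := (pow_succ _ _).symm

theorem two_pow_pow_mono {L : ℕ} (hL : 2 ≤ L) {a b : ℕ} (h : a ≤ b) : 2 ^ L ^ a ≤ 2 ^ L ^ b :=
  Nat.pow_le_pow_right (by norm_num) (Nat.pow_le_pow_right (by omega) h)

/-- The weight of a tuple of polynomially long numbers is polynomial. -/
theorem exists_weight_le {k l : ℕ} {g : Fin l → (Fin k → ℕ) → ℕ}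
    (h : ∀ i, ∃ c, ∀ v, g i v ≤ 2 ^ weight v ^ c) :
    ∃ c, ∀ v, weight (fun i => g i v) ≤ weight v ^ c := by
  choose c hc using h
  refine ⟨2 + (∑ i, (c i + 1 + 1)) + l + 1, fun v => ?_⟩
  have hL := two_le_weight v
  have h1 : ∀ i, (g i v).size ≤ weight v ^ (c i + 1 + 1) := by
    intro i
    have := size_le_of_le_two_pow (hc i v)
    have h2 := pow_add_pow_le_pow_succ hL (c i) 0
    rw [pow_zero, add_zero] at h2
    exact (this.trans h2).trans (Nat.pow_le_pow_right (by omega) (by omega))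
  have h2 : ∀ i, (g i v).size ≤ weight v ^ (∑ i, (c i + 1 + 1)) := fun i =>
    (h1 i).trans (Nat.pow_le_pow_right (by omega)
      (Finset.single_le_sum (f := fun i => c i + 1 + 1) (fun _ _ => Nat.zero_le _)
        (Finset.mem_univ i)))
  have h3 : ∑ i, (g i v).size ≤ l * weight v ^ (∑ i, (c i + 1 + 1)) := by
    simpa using Finset.sum_le_card_nsmul Finset.univ _ _ fun i _ => h2 i
  have h4 : l * weight v ^ (∑ i, (c i + 1 + 1)) ≤ weight v ^ ((∑ i, (c i + 1 + 1)) + l) := by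
    rw [pow_add, mul_comm]
    exact Nat.mul_le_mul_left _ (const_le_pow hL l)
  calc weight (fun i => g i v) = 2 + ∑ i, (g i v).size := rfl
    _ ≤ weight v ^ 2 + weight v ^ ((∑ i, (c i + 1 + 1)) + l) :=
        Nat.add_le_add (const_le_pow hL 2) (h3.trans h4)
    _ ≤ weight v ^ (2 + ((∑ i, (c i + 1 + 1)) + l) + 1) := pow_add_pow_le_pow_succ hL _ _
    _ ≤ _ := Nat.pow_le_pow_right (by omega) (by omega)

theorem LimRec.exists_le {k : ℕ} {f : (Fin k → ℕ) → ℕ} (hf : LimRec True f) :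
    ∃ c, ∀ v, f v ≤ 2 ^ weight v ^ c := by
  induction hf with
  | zero => exact ⟨0, fun v => Nat.zero_le _⟩
  | succ _ ih =>
    obtain ⟨c, hc⟩ := ih
    refine ⟨c + 0 + 1, fun v => ?_⟩
    have h1 := pow_add_pow_le_pow_succ (two_le_weight v) c 0
    rw [pow_zero] at h1
    have h2 : 2 ^ (weight v ^ c + 1) ≤ 2 ^ weight v ^ (c + 0 + 1) :=
      Nat.pow_le_pow_right (by norm_num) h1
    have h3 := hc v
    have h4 : 0 < 2 ^ weight v ^ c := by positivity
    rw [pow_succ] at h2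
    dsimp only
    omega
  | get i =>
    refine ⟨1, fun v => ?_⟩
    rw [pow_one]
    exact (Nat.lt_size_self _).le.trans
      (Nat.pow_le_pow_right (by norm_num) (size_le_weight v i))
  | comp _ _ ih1 ih2 =>
    obtain ⟨c, hc⟩ := ih1
    obtain ⟨d, hd⟩ := exists_weight_le ih2
    refine ⟨d * c, fun v => (hc _).trans (Nat.pow_le_pow_right (by norm_num) ?_)⟩
    rw [pow_mul]
    exact Nat.pow_le_pow_left (hd v) c
  | prec _ _ _ hb _ _ _ =>
    obtain ⟨c, hc⟩ := hb trivial
    exact ⟨c, fun v => hc v _ le_rfl⟩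

namespace CounterProg

theorem Exec.of_eq' {B : ℕ} {p : CounterProg} {s₁ s₂ s : ℕ → ℕ} (h : Exec B p s₁ s)
    (e : s₂ = s₁) : Exec B p s₂ s := e ▸ h

theorem Exec.of_eq {B : ℕ} {p : CounterProg} {s s₁ s₂ : ℕ → ℕ} (h : Exec B p s s₁)
    (e : s₁ = s₂) : Exec B p s s₂ := e ▸ h

/-- Sets a counter to zero. -/
def reset (x : ℕ) : CounterProg := loop x (dec x)

/-- Adds the counter `x` to the counter `y` and sets it to zero. -/
def shift (x y : ℕ) : CounterProg := loop x (seq (dec x) (inc y))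

/-- Adds the counter `x` to the counters `y` and `t` and sets it to zero. -/
def shift₂ (x y t : ℕ) : CounterProg := loop x (seq (dec x) (seq (inc y) (inc t)))

/-- Adds the counter `x` to the counter `y`, with the counter `t` as an auxiliary one. -/
def copy (x y t : ℕ) : CounterProg := seq (shift₂ x y t) (shift t x)

theorem exec_reset (B x : ℕ) : ∀ (n : ℕ) (s : ℕ → ℕ), s x = n →
    Exec B (reset x) s (Function.update s x 0) := by
  intro n
  induction n with
  | zero =>
    intro s hs
    exact (Exec.loop_done hs).of_eq (by rw [← hs, Function.update_eq_self])
  | succ n ih =>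
    intro s hs
    exact .loop_step (by omega) .dec ((ih _ (by simp [hs])).of_eq (by simp))

theorem exec_shift {B x y : ℕ} (hxy : x ≠ y) : ∀ (n : ℕ) (s : ℕ → ℕ), s x = n → s y + n ≤ B →
    Exec B (shift x y) s (Function.update (Function.update s x 0) y (s y + n)) := by
  intro n
  induction n with
  | zero =>
    intro s hs _
    refine (Exec.loop_done hs).of_eq ?_
    rw [← hs, Function.update_eq_self, hs, add_zero, Function.update_eq_self]
  | succ n ih =>
    intro s hs hB
    refine .loop_step (by omega) (.seq .dec (.inc ?_)) ((ih _ ?_ ?_).of_eq ?_)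
    · simp [Ne.symm hxy]; omega
    · simp [hxy, hs]
    · simp [Ne.symm hxy]; omega
    · funext r
      by_cases h1 : r = y
      · subst h1; simp [Ne.symm hxy]; omega
      · by_cases h2 : r = x
        · subst h2; simp [h1]
        · simp [h1, h2]

theorem exec_shift₂ {B x y t : ℕ} (hxy : x ≠ y) (hxt : x ≠ t) (hyt : y ≠ t) :
    ∀ (n : ℕ) (s : ℕ → ℕ), s x = n → s y + n ≤ B → s t + n ≤ B →
    Exec B (shift₂ x y t) s (Function.update (Function.update (Function.update s x 0) y (s y + n))
      t (s t + n)) := by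
  intro n
  induction n with
  | zero =>
    intro s hs _ _
    refine (Exec.loop_done hs).of_eq ?_
    rw [← hs, Function.update_eq_self, hs, add_zero, Function.update_eq_self, add_zero,
      Function.update_eq_self]
  | succ n ih =>
    intro s hs hB hB'
    refine .loop_step (by omega) (.seq .dec (.seq (.inc ?_) (.inc ?_))) ((ih _ ?_ ?_ ?_).of_eq ?_)
    · simp [Ne.symm hxy]; omega
    · simp [Ne.symm hxt, Ne.symm hyt]; omega
    · simp [hxy, hxt, hs]
    · simp [Ne.symm hxy, hyt]; omega
    · simp [Ne.symm hxt, Ne.symm hyt]; omega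
    · funext r
      by_cases h3 : r = t
      · subst h3; simp [Ne.symm hxt, Ne.symm hyt]; omega
      · by_cases h1 : r = y
        · subst h1; simp [Ne.symm hxy, h3]; omega
        · by_cases h2 : r = x
          · subst h2; simp [h1, h3]
          · simp [h1, h2, h3]

theorem exec_copy {B x y t : ℕ} (hxy : x ≠ y) (hxt : x ≠ t) (hyt : y ≠ t) {s : ℕ → ℕ}
    (hy : s y = 0) (ht : s t = 0) (hB : s x ≤ B) :
    Exec B (copy x y t) s (Function.update s y (s x)) := by
  refine .seq (exec_shift₂ hxy hxt hyt (s x) s rfl (by omega) (by omega))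
    ((exec_shift (Ne.symm hxt) (s x) _ ?_ ?_).of_eq ?_)
  · simp [ht]
  · simp [hxy, hxt]; omega
  · funext r
    by_cases h1 : r = x
    · subst h1; simp [hxy, hxt]
    · by_cases h2 : r = t
      · subst h2; simp [h1, ht, Ne.symm hyt]
      · by_cases h3 : r = y
        · subst h3; simp [h1, h2, hy]
        · simp [h1, h2, h3]

end CounterProg

namespace CounterProg

/-- `Computes f c args out base p`: reading its arguments from the counters `args`, the program `p`
computes `f` into the counter `out`; it leaves everything else unchanged, provided that
the counters from `base` on are zero and available, and its numbers have a length bounded by the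
`c`-th power of the length of the arguments. -/
def Computes {k : ℕ} (f : (Fin k → ℕ) → ℕ) (c : ℕ) (args : Fin k → ℕ) (out base : ℕ)
    (p : CounterProg) : Prop :=
  ∀ (s : ℕ → ℕ) (B : ℕ), (∀ r, base ≤ r → s r = 0) → s out = 0 → (∀ r, s r ≤ B) →
    2 ^ weight (fun i => s (args i)) ^ c ≤ B →
    Exec B p s (Function.update s out (f fun i => s (args i)))

/-- The function `f` can be computed by counter programs with numbers of polynomial length. -/
def Computable {k : ℕ} (f : (Fin k → ℕ) → ℕ) : Prop :=
  ∃ c, ∀ (args : Fin k → ℕ) (out base : ℕ), (∀ i, args i < base) → out < base →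
    (∀ i, args i ≠ out) → ∃ p, Computes f c args out base p

theorem Computes.mono {k : ℕ} {f : (Fin k → ℕ) → ℕ} {c d : ℕ} {args : Fin k → ℕ} {out base : ℕ}
    {p : CounterProg} (h : Computes f c args out base p) (hcd : c ≤ d) :
    Computes f d args out base p := fun s B h1 h2 h3 h4 =>
  h s B h1 h2 h3 ((two_pow_pow_mono (two_le_weight _) hcd).trans h4)

theorem Computable.zero {k : ℕ} : Computable (fun _ : Fin k → ℕ => 0) := by
  refine ⟨0, fun args out base _ _ _ => ⟨reset out, fun s B _ h0 _ _ => ?_⟩⟩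
  exact exec_reset B out 0 s h0

theorem Computable.get {k : ℕ} (i : Fin k) : Computable (fun v : Fin k → ℕ => v i) := by
  refine ⟨0, fun args out base hargs hout hne => ⟨copy (args i) out base,
    fun s B hbase h0 hB _ => ?_⟩⟩
  exact exec_copy (hne i) (hargs i).ne hout.ne h0 (hbase _ le_rfl) (hB _)

theorem Computable.succ {k : ℕ} {f : (Fin k → ℕ) → ℕ} (hf : Computable f)
    (hb : ∃ c, ∀ v, f v + 1 ≤ 2 ^ weight v ^ c) : Computable (fun v => f v + 1) := by
  obtain ⟨c, hc⟩ := hf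
  obtain ⟨d, hd⟩ := hb
  refine ⟨max c d, fun args out base hargs hout hne => ?_⟩
  obtain ⟨p, hp⟩ := hc args out base hargs hout hne
  refine ⟨.seq p (.inc out), fun s B hbase h0 hB hB' => ?_⟩
  refine .seq (hp.mono (le_max_left c d) s B hbase h0 hB hB') ((Exec.inc ?_).of_eq (by simp))
  have := (hd fun i => s (args i)).trans
    ((two_pow_pow_mono (two_le_weight _) (le_max_right c d)).trans hB')
  simpa using this

/-- Computes several functions one after the other, into consecutive counters. -/
theorem exists_exec_tuple {k l : ℕ} {g : Fin l → (Fin k → ℕ) → ℕ} {c : ℕ}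
    (hc : ∀ i, ∀ (args : Fin k → ℕ) (out base : ℕ), (∀ i, args i < base) → out < base →
      (∀ i, args i ≠ out) → ∃ p, Computes (g i) c args out base p)
    (args : Fin k → ℕ) (base : ℕ) (hargs : ∀ i, args i < base) : ∀ j ≤ l, ∃ p : CounterProg,
      ∀ (s : ℕ → ℕ) (B : ℕ), (∀ r, base ≤ r → s r = 0) → (∀ r, s r ≤ B) →
        2 ^ weight (fun i => s (args i)) ^ c ≤ B →
        Exec B p s (fun r => if h : base ≤ r ∧ r < base + j ∧ r < base + l then
          g ⟨r - base, by omega⟩ (fun i => s (args i)) else s r) := by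
  intro j
  induction j with
  | zero =>
    intro _
    refine ⟨reset base, fun s B hbase _ _ => (exec_reset B base 0 s (hbase _ le_rfl)).of_eq ?_⟩
    funext r
    rw [dif_neg (by omega)]
    by_cases hr : r = base
    · subst hr; simp [hbase r le_rfl]
    · simp [hr]
  | succ j ih =>
    intro hj
    obtain ⟨p, hp⟩ := ih (by omega)
    obtain ⟨q, hq⟩ := hc ⟨j, hj⟩ args (base + j) (base + l)
      (fun i => (hargs i).trans_le (by omega)) (by omega)
      (fun i => ((hargs i).trans_le (by omega)).ne)
    refine ⟨.seq p q, fun s B hbase hB hB' => ?_⟩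
    have e1 := hp s B hbase hB hB'
    have hargs' : ∀ i, ¬ (base ≤ args i ∧ args i < base + j ∧ args i < base + l) := fun i => by
      have := hargs i
      omega
    have e2 := hq _ B (fun r hr => by rw [dif_neg (by omega)]; exact hbase r (by omega))
      (by rw [dif_neg (by omega)]; exact hbase _ (by omega)) (e1.le hB)
      (by simpa only [hargs', dif_neg, not_false_eq_true] using hB')
    refine .seq e1 (e2.of_eq ?_)
    simp only [hargs', dif_neg, not_false_eq_true]
    funext r
    by_cases hr : r = base + j
    · subst hr
      have : base ≤ base + j ∧ base + j < base + (j + 1) ∧ base + j < base + l := by omega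
      simp [this]
    · rw [Function.update_of_ne hr]
      by_cases h : base ≤ r ∧ r < base + j ∧ r < base + l
      · rw [dif_pos h, dif_pos (by omega)]
      · rw [dif_neg h, dif_neg (by omega)]

/-- Resets consecutive counters. -/
theorem exists_exec_reset (base : ℕ) : ∀ l : ℕ, ∃ p : CounterProg, ∀ (s : ℕ → ℕ) (B : ℕ),
    Exec B p s (fun r => if base ≤ r ∧ r < base + l + 1 then 0 else s r) := by
  intro l
  induction l with
  | zero =>
    refine ⟨reset base, fun s B => (exec_reset B base _ s rfl).of_eq ?_⟩
    funext r
    by_cases hr : r = base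
    · subst hr; simp
    · rw [Function.update_of_ne hr, if_neg (by omega)]
  | succ l ih =>
    obtain ⟨p, hp⟩ := ih
    refine ⟨.seq p (reset (base + l + 1)), fun s B =>
      .seq (hp s B) ((exec_reset B _ _ _ rfl).of_eq ?_)⟩
    funext r
    by_cases hr : r = base + l + 1
    · subst hr; rw [Function.update_self, if_pos (by omega)]
    · rw [Function.update_of_ne hr]
      by_cases h : base ≤ r ∧ r < base + l + 1
      · rw [if_pos h, if_pos (by omega)]
      · rw [if_neg h, if_neg (by omega)]

theorem Computable.comp {k l : ℕ} {f : (Fin l → ℕ) → ℕ} {g : Fin l → (Fin k → ℕ) → ℕ}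
    (hf : Computable f) (hg : ∀ i, Computable (g i))
    (hb : ∃ c, ∀ v, weight (fun i => g i v) ≤ weight v ^ c) :
    Computable (fun v => f fun i => g i v) := by
  obtain ⟨cf, hf⟩ := hf
  choose cg hg using hg
  obtain ⟨d, hd⟩ := hb
  have hcg : ∀ i, cg i ≤ ∑ i, cg i := fun i =>
    Finset.single_le_sum (f := cg) (fun _ _ => Nat.zero_le _) (Finset.mem_univ i)
  refine ⟨(∑ i, cg i) + d * cf, fun args out base hargs hout hne => ?_⟩
  obtain ⟨p, hp⟩ := exists_exec_tuple (c := ∑ i, cg i) (fun i args out base h1 h2 h3 =>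
    (hg i args out base h1 h2 h3).imp fun p h => h.mono (hcg i)) args base hargs l le_rfl
  obtain ⟨q, hq⟩ := hf (fun i => base + i) out (base + l) (fun i => by omega) (by omega)
    (fun i => by omega)
  obtain ⟨r, hr⟩ := exists_exec_reset base l
  refine ⟨.seq p (.seq q r), fun s B hbase h0 hB hB' => ?_⟩
  have e1 := hp s B hbase hB
    ((two_pow_pow_mono (two_le_weight _) (Nat.le_add_right _ _)).trans hB')
  have hv : ∀ i : Fin l, base ≤ base + (i : ℕ) ∧ base + (i : ℕ) < base + l ∧
      base + (i : ℕ) < base + l := fun i => by omega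
  have e2 := hq _ B (fun r hr => by rw [dif_neg (by omega)]; exact hbase r (by omega))
    (by rw [dif_neg (by omega)]; exact h0) (e1.le hB) (by
      simp only [hv, and_self, dif_pos, Nat.add_sub_cancel_left]
      refine le_trans ?_ hB'
      refine Nat.pow_le_pow_right (by norm_num) ?_
      refine (Nat.pow_le_pow_left (hd _) cf).trans ?_
      rw [← pow_mul]
      exact Nat.pow_le_pow_right (by have := two_le_weight fun i => s (args i); omega)
        (Nat.le_add_left _ _))
  refine .seq e1 (.seq e2 ((hr _ B).of_eq ?_))
  simp only [hv, and_self, dif_pos, Nat.add_sub_cancel_left]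
  funext x
  by_cases hx : x = out
  · subst hx; rw [if_neg (by omega)]; simp
  · rw [Function.update_of_ne hx, Function.update_of_ne hx]
    by_cases h : base ≤ x ∧ x < base + l + 1
    · rw [if_pos h, hbase x h.1]
    · rw [if_neg h, dif_neg (by omega)]

theorem Computable.prec {k : ℕ} {n g : (Fin k → ℕ) → ℕ} {h : (Fin (k + 2) → ℕ) → ℕ}
    (hn : Computable n) (hg : Computable g) (hh : Computable h)
    (hnb : ∃ c, ∀ v, n v ≤ 2 ^ weight v ^ c)
    (hb : ∃ c, ∀ v, ∀ i ≤ n v, recVal g h v i ≤ 2 ^ weight v ^ c) :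
    Computable (fun v => recVal g h v (n v)) := by
  obtain ⟨cn, hn⟩ := hn
  obtain ⟨cg, hg⟩ := hg
  obtain ⟨ch, hh⟩ := hh
  obtain ⟨d, hd⟩ := hnb
  obtain ⟨e, he⟩ := hb
  -- a bound for the weight of the arguments of `h`
  obtain ⟨m, hm⟩ : ∃ m, ∀ v : Fin k → ℕ, ∀ i ≤ n v,
      weight (vecCons i (vecCons (recVal g h v i) v)) ≤ weight v ^ m := by
    refine ⟨(d + 0 + 1) + ((e + 0 + 1) + 1 + 1) + 1, fun v i hi => ?_⟩
    have hL := two_le_weight v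
    have h1 := size_le_of_le_two_pow (hi.trans (hd v))
    have h2 := size_le_of_le_two_pow (he v i hi)
    have h3 := pow_add_pow_le_pow_succ hL d 0
    have h4 := pow_add_pow_le_pow_succ hL e 0
    have h5 := pow_add_pow_le_pow_succ hL (e + 0 + 1) 1
    have h6 := pow_add_pow_le_pow_succ hL (d + 0 + 1) ((e + 0 + 1) + 1 + 1)
    rw [pow_zero] at h3 h4
    rw [pow_one] at h5
    rw [weight_vecCons, weight_vecCons]
    omega
  refine ⟨cn + cg + m * ch + d + e, fun args out base hargs hout hne => ?_⟩
  -- the counters from `base` on: rounds to go, rounds done, current value, next value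
  obtain ⟨pn, hpn⟩ := hn args base (base + 4) (fun i => by have := hargs i; omega) (by omega)
    (fun i => (hargs i).ne)
  obtain ⟨pg, hpg⟩ := hg args (base + 2) (base + 4) (fun i => by have := hargs i; omega)
    (by omega) (fun i => by have := hargs i; omega)
  obtain ⟨ph, hph⟩ := hh (vecCons (base + 1) (vecCons (base + 2) args)) (base + 3) (base + 4)
    (fun i => by
      refine Fin.cases ?_ (fun i => ?_) i
      · simp
      · refine Fin.cases ?_ (fun i => ?_) i
        · simp
        · have := hargs i
          simp; omega)
    (by omega)
    (fun i => by
      refine Fin.cases ?_ (fun i => ?_) i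
      · simp
      · refine Fin.cases ?_ (fun i => ?_) i
        · simp
        · have := hargs i
          simp; omega)
  refine ⟨.seq pn (.seq pg (.seq (loop base (.seq (dec base) (.seq ph (.seq (reset (base + 2))
    (.seq (shift (base + 3) (base + 2)) (inc (base + 1)))))))
    (.seq (shift (base + 2) out) (reset (base + 1))))), fun s B hbase h0 hB hB' => ?_⟩
  set v : Fin k → ℕ := fun i => s (args i) with hv
  have hL := two_le_weight v
  have hpow : ∀ a, a ≤ cn + cg + m * ch + d + e → 2 ^ weight v ^ a ≤ B := fun a ha =>
    (two_pow_pow_mono hL ha).trans hB'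
  have hnB : n v ≤ B := (hd v).trans (hpow d (by omega))
  have hrB : ∀ i ≤ n v, recVal g h v i ≤ B := fun i hi => (he v i hi).trans (hpow e (by omega))
  have e1 := hpn s B (fun r hr => hbase r (by omega)) (hbase _ le_rfl) hB (hpow cn (by omega))
  have ha : ∀ i, args i ≠ base := fun i => (hargs i).ne
  have ha1 : ∀ i, args i ≠ base + 1 := fun i => by have := hargs i; omega
  have ha2 : ∀ i, args i ≠ base + 2 := fun i => by have := hargs i; omega
  have ha3 : ∀ i, args i ≠ base + 3 := fun i => by have := hargs i; omega
  have e2 := hpg _ B (fun r hr => by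
      rw [Function.update_of_ne (by omega)]; exact hbase r (by omega))
    (by rw [Function.update_of_ne (by omega)]; exact hbase _ (by omega)) (e1.le hB)
    (by simp only [ne_eq, ha, not_false_eq_true, Function.update_of_ne]; exact hpow cg (by omega))
  simp only [ne_eq, ha, not_false_eq_true, Function.update_of_ne] at e2
  -- the state after `j` rounds
  let st : ℕ → ℕ → ℕ := fun j r => if r = base then n v - j else if r = base + 1 then j else
    if r = base + 2 then recVal g h v j else s r
  have hst : Function.update (Function.update s base (n v)) (base + 2) (g v) = st 0 := by
    funext r
    by_cases h1 : r = base + 2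
    · subst h1; simp [st, recVal]
    · by_cases h2 : r = base
      · subst h2; simp [st]
      · by_cases h3 : r = base + 1
        · subst h3; simp [st, hbase]
        · simp [st, h1, h2, h3]
  have hstB : ∀ j ≤ n v, ∀ r, st j r ≤ B := by
    intro j hj r
    simp only [st]
    split_ifs
    · omega
    · omega
    · exact hrB j hj
    · exact hB r
  have e3 : ∀ i j, i + j = n v → Exec B (loop base (.seq (dec base) (.seq ph
      (.seq (reset (base + 2)) (.seq (shift (base + 3) (base + 2)) (inc (base + 1))))))) (st j)
      (st (n v)) := by
    intro i
    induction i with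
    | zero =>
      intro j hj
      obtain rfl : j = n v := by omega
      exact .loop_done (by simp [st])
    | succ i ih =>
      intro j hj
      have f1 : Exec B (dec base) (st j) (Function.update (st j) base (n v - (j + 1))) :=
        Exec.dec.of_eq (by simp [st]; rw [Nat.sub_sub])
      have hargs3 : (fun i => Function.update (st j) base (n v - (j + 1))
          (vecCons (base + 1) (vecCons (base + 2) args) i)) =
          vecCons j (vecCons (recVal g h v j) v) := by
        funext i
        refine Fin.cases ?_ (fun i => ?_) i
        · simp [st]
        · refine Fin.cases ?_ (fun i => ?_) i
          · simp [st]
          · simp [st, ha, ha1, ha2, hv]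
      have f2 := hph (Function.update (st j) base (n v - (j + 1))) B (fun r hr => by
          rw [Function.update_of_ne (by omega)]
          simp only [st]
          rw [if_neg (by omega), if_neg (by omega), if_neg (by omega)]
          exact hbase r (by omega))
        (by
          rw [Function.update_of_ne (by omega)]
          simp only [st]
          rw [if_neg (by omega), if_neg (by omega), if_neg (by omega)]
          exact hbase _ (by omega)) (f1.le (hstB j (by omega)))
        (by
          rw [hargs3]
          refine le_trans (Nat.pow_le_pow_right (by norm_num) ?_) (hpow (m * ch) (by omega))
          rw [pow_mul]
          exact Nat.pow_le_pow_left (hm v j (by omega)) ch)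
      rw [hargs3] at f2
      refine .loop_step (by simp [st]; omega) (.seq f1 (.seq f2 (.seq (exec_reset B _ _ _ rfl)
        (.seq (exec_shift (by omega) _ _ rfl ?_) (.inc ?_))))) ((ih (j + 1) (by omega)).of_eq' ?_)
      · simpa [recVal] using hrB (j + 1) (by omega)
      · simp [st]; omega
      · funext r
        by_cases h1 : r = base
        · subst h1; simp [st]
        · by_cases h2 : r = base + 1
          · subst h2; simp [st]
          · by_cases h3 : r = base + 2
            · subst h3; simp [st, recVal]
            · by_cases h4 : r = base + 3
              · subst h4; simp [st, hbase]
              · simp [st, h1, h2, h3, h4]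
  rw [hst] at e2
  have hob : out ≠ base ∧ out ≠ base + 1 ∧ out ≠ base + 2 := by omega
  refine .seq e1 (.seq e2 (.seq (e3 (n v) 0 rfl) (.seq
    (exec_shift (by omega) (recVal g h v (n v)) (st (n v)) (by simp [st]) ?_)
      ((exec_reset B _ _ _ rfl).of_eq ?_))))
  · simp [st, hob, h0, hrB]
  · funext r
    by_cases h1 : r = out
    · subst h1; simp [st, hob, h0]
    · by_cases h2 : r = base
      · subst h2; simp [st, h1, hbase]
      · by_cases h3 : r = base + 1
        · subst h3; simp [h1, hbase]
        · by_cases h4 : r = base + 2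
          · subst h4; simp [h1, hbase]
          · simp [st, h1, h2, h3, h4]

end CounterProg

theorem LimRec.computable {k : ℕ} {f : (Fin k → ℕ) → ℕ} (hf : LimRec True f) :
    CounterProg.Computable f := by
  induction hf with
  | zero => exact .zero
  | succ h ih => exact ih.succ h.succ.exists_le
  | get i => exact .get i
  | comp _ h ih1 ih2 => exact ih1.comp ih2 (exists_weight_le fun i => (h i).exists_le)
  | prec h _ _ hb ih1 ih2 ih3 => exact ih1.prec ih2 ih3 h.exists_le (hb trivial)

/-- A predicate on encoded inputs is decided in polynomial space if its truth value is computed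
from the numerical value of the code by recursion with results of polynomial length. -/
theorem LimRec.decidableInPolySpace {α : Type} (ea : α → List Bool) (R : α → Prop)
    {f : (Fin 1 → ℕ) → ℕ} (hf : LimRec True f)
    (h : ∀ a (r : Bool), (r = true ↔ R a) → f (fun _ => (ea a).toMarkedNat) = r.toNat) :
    DecidableInPolySpace ea R := by
  obtain ⟨c, hc⟩ := hf.computable
  obtain ⟨p, hp⟩ := hc (fun _ => 0) 1 2 (by simp) (by simp) (by simp)
  have hw : ∀ a, weight (fun _ : Fin 1 => (ea a).toMarkedNat) = (ea a).length + 3 := fun a => by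
    simp [weight, CounterProg.size_toMarkedNat]; ring
  refine CounterProg.decidableInPolySpace ea R p
    (fun a => 2 ^ ((ea a).length + 3) ^ (c + 1)) ((Polynomial.X + 3) ^ (c + 1) + 1) (fun a => ?_)
    (fun a => ?_) fun a r hr => ?_
  · simp [Nat.size_pow]
  · refine (Nat.lt_size_self _).le.trans (Nat.pow_le_pow_right (by norm_num) ?_)
    rw [CounterProg.size_toMarkedNat]
    exact le_trans (by omega) (Nat.le_self_pow (by omega) _)
  · have hN : (ea a).toMarkedNat ≤ 2 ^ ((ea a).length + 3) ^ (c + 1) := by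
      refine (Nat.lt_size_self _).le.trans (Nat.pow_le_pow_right (by norm_num) ?_)
      rw [CounterProg.size_toMarkedNat]
      exact le_trans (by omega) (Nat.le_self_pow (by omega) _)
    have := hp (Function.update (fun _ => 0) 0 (ea a).toMarkedNat)
      (2 ^ ((ea a).length + 3) ^ (c + 1)) (fun r hr => Function.update_of_ne (by omega) _ _)
      (by simp) (fun r => by
        by_cases hr : r = 0
        · subst hr; simpa using hN
        · simp [hr]) (by
        simp only [Function.update_self]
        rw [hw]
        exact two_pow_pow_mono (by omega) (by omega))
    simp only [Function.update_self] at this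
    rwa [h a r hr] at this

/-! ### Closure properties -/

/-- Types whose elements are described by a fixed number of natural numbers. -/
class Ctx (α : Type) where
  /-- the number of natural numbers in the description -/
  dim : ℕ
  /-- the description of an element -/
  coord : α → Fin dim → ℕ

instance : Ctx ℕ := ⟨1, fun n _ => n⟩

instance {α : Type} [Ctx α] : Ctx (ℕ × α) := ⟨Ctx.dim α + 1, fun p => vecCons p.1 (Ctx.coord p.2)⟩

/-- Every tuple of natural numbers describes an element. -/
class Ctx.Full (α : Type) [Ctx α] : Prop where
  surj : Function.Surjective (Ctx.coord (α := α))

instance : Ctx.Full ℕ :=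
  ⟨fun v => ⟨v 0, funext fun _ => congrArg v (Subsingleton.elim (α := Fin 1) _ _)⟩⟩

instance {α : Type} [Ctx α] [Ctx.Full α] : Ctx.Full (ℕ × α) := ⟨fun v => by
  obtain ⟨a, ha⟩ := Ctx.Full.surj (α := α) (fun i => v i.succ)
  refine ⟨(v 0, a), funext fun i => ?_⟩
  refine Fin.cases rfl (fun i => ?_) i
  exact congrFun ha i⟩

open Classical in
/-- Propositions are described by their truth value, which allows to treat predicates as functions.
-/
noncomputable instance : Ctx Prop := ⟨1, fun p _ => if p then 1 else 0⟩

/-- The functions between such types that are obtained by recursion as in `LimRec`. -/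
@[fun_prop]
def Lim (bd : Prop) {α β : Type} [Ctx α] [Ctx β] (f : α → β) : Prop :=
  ∀ i, ∃ F, LimRec bd F ∧ ∀ a, F (Ctx.coord a) = Ctx.coord (f a) i

/-- The binary length of the description of an element. -/
def Ctx.size {α : Type} [Ctx α] (a : α) : ℕ := weight (Ctx.coord a)

/-- The function is bounded by a polynomial in the length of the argument. -/
def PolyBdd {α : Type} [Ctx α] (f : α → ℕ) : Prop := ∃ c, ∀ a, f a ≤ Ctx.size a ^ c

/-- The binary length of the function is bounded by a polynomial in the length of the argument. -/
def ExpBdd {α : Type} [Ctx α] (f : α → ℕ) : Prop := ∃ c, ∀ a, f a ≤ 2 ^ Ctx.size a ^ c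

section

variable {bd : Prop} {α β γ : Type} [Ctx α] [Ctx β] [Ctx γ]

theorem Ctx.two_le_size (a : α) : 2 ≤ Ctx.size a := two_le_weight _

theorem Ctx.size_prod (i : ℕ) (a : α) : Ctx.size (i, a) = i.size + Ctx.size a :=
  weight_vecCons _ _

namespace PolyBdd

theorem mono {f g : α → ℕ} (hg : PolyBdd g) (h : ∀ a, f a ≤ g a) : PolyBdd f :=
  hg.imp fun _ hc a => (h a).trans (hc a)

theorem const (n : ℕ) : PolyBdd (fun _ : α => n) :=
  ⟨n, fun a => const_le_pow (Ctx.two_le_size a) n⟩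

theorem size : PolyBdd (fun a : α => Ctx.size a) := ⟨1, fun a => by simp⟩

theorem add {f g : α → ℕ} (hf : PolyBdd f) (hg : PolyBdd g) : PolyBdd (fun a => f a + g a) := by
  obtain ⟨c, hc⟩ := hf
  obtain ⟨d, hd⟩ := hg
  exact ⟨c + d + 1, fun a => (Nat.add_le_add (hc a) (hd a)).trans
    (pow_add_pow_le_pow_succ (Ctx.two_le_size a) c d)⟩

theorem mul {f g : α → ℕ} (hf : PolyBdd f) (hg : PolyBdd g) : PolyBdd (fun a => f a * g a) := by
  obtain ⟨c, hc⟩ := hf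
  obtain ⟨d, hd⟩ := hg
  exact ⟨c + d, fun a => (Nat.mul_le_mul (hc a) (hd a)).trans_eq (pow_add _ _ _).symm⟩

theorem pow {f : α → ℕ} (hf : PolyBdd f) (n : ℕ) : PolyBdd (fun a => f a ^ n) := by
  obtain ⟨c, hc⟩ := hf
  exact ⟨c * n, fun a => (Nat.pow_le_pow_left (hc a) n).trans_eq (pow_mul _ _ _).symm⟩

theorem two_pow {f : α → ℕ} (hf : PolyBdd f) : ExpBdd (fun a => 2 ^ f a) :=
  hf.imp fun _ hc a => Nat.pow_le_pow_right (by norm_num) (hc a)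

end PolyBdd

namespace ExpBdd

theorem mono {f g : α → ℕ} (hg : ExpBdd g) (h : ∀ a, f a ≤ g a) : ExpBdd f :=
  hg.imp fun _ hc a => (h a).trans (hc a)

theorem size {f : α → ℕ} (hf : ExpBdd f) : PolyBdd (fun a => (f a).size) := by
  obtain ⟨c, hc⟩ := hf
  exact (PolyBdd.add (f := fun a : α => Ctx.size a ^ c) ⟨c, fun _ => le_rfl⟩ (.const 1)).mono
    fun a => size_le_of_le_two_pow (hc a)

theorem pow {f g : α → ℕ} (hf : ExpBdd f) (hg : PolyBdd g) : ExpBdd (fun a => f a ^ g a) :=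
  (hf.size.mul hg).two_pow.mono fun a => by
    rw [pow_mul]
    exact Nat.pow_le_pow_left (Nat.lt_size_self _).le _

theorem mul {f g : α → ℕ} (hf : ExpBdd f) (hg : ExpBdd g) : ExpBdd (fun a => f a * g a) :=
  (hf.size.add hg.size).two_pow.mono fun a => by
    rw [pow_add]
    exact Nat.mul_le_mul (Nat.lt_size_self _).le (Nat.lt_size_self _).le

theorem add {f g : α → ℕ} (hf : ExpBdd f) (hg : ExpBdd g) : ExpBdd (fun a => f a + g a) :=
  ((hf.size.add hg.size).add (.const 1)).two_pow.mono fun a => by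
    have h1 : (f a).size ≤ (f a).size + (g a).size := Nat.le_add_right _ _
    have h2 : (g a).size ≤ (f a).size + (g a).size := Nat.le_add_left _ _
    have h3 := (Nat.lt_size_self (f a)).le.trans (Nat.pow_le_pow_right (by norm_num) h1)
    have h4 := (Nat.lt_size_self (g a)).le.trans (Nat.pow_le_pow_right (by norm_num) h2)
    rw [pow_succ]
    omega

end ExpBdd

namespace Lim

@[fun_prop]
theorem id : Lim bd (fun a : α => a) := fun i => ⟨_, .get i, fun _ => rfl⟩

@[fun_prop]
theorem comp {g : β → γ} {f : α → β} (hg : Lim bd g) (hf : Lim bd f) :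
    Lim bd (fun a => g (f a)) := fun i => by
  obtain ⟨G, hG, hG'⟩ := hg i
  choose F hF hF' using hf
  refine ⟨_, .comp hG hF, fun a => ?_⟩
  rw [← hG']
  exact congrArg G (funext fun j => hF' j a)

@[fun_prop]
theorem prodMk {f : α → ℕ} {g : α → β} (hf : Lim bd f) (hg : Lim bd g) :
    Lim bd (fun a => (f a, g a)) := fun i => by
  refine Fin.cases ?_ (fun i => ?_) i
  · obtain ⟨F, hF, hF'⟩ := hf 0
    exact ⟨F, hF, fun a => hF' a⟩
  · obtain ⟨G, hG, hG'⟩ := hg i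
    exact ⟨G, hG, fun a => hG' a⟩

theorem of_nat {f : α → ℕ} {F : (Fin (Ctx.dim α) → ℕ) → ℕ} (hF : LimRec bd F)
    (h : ∀ a, F (Ctx.coord a) = f a) : Lim bd f := fun _ => ⟨F, hF, h⟩

theorem exists_limRec {f : α → ℕ} (hf : Lim bd f) :
    ∃ F, LimRec bd F ∧ ∀ a, F (Ctx.coord a) = f a := hf 0

@[fun_prop]
theorem fst : Lim bd (fun p : ℕ × α => p.1) := of_nat (.get 0) fun _ => rfl

@[fun_prop]
theorem snd : Lim bd (fun p : ℕ × α => p.2) := fun i => ⟨_, .get i.succ, fun _ => rfl⟩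

@[fun_prop]
theorem succ {f : α → ℕ} (hf : Lim bd f) : Lim bd (fun a => f a + 1) := by
  obtain ⟨F, hF, hF'⟩ := hf.exists_limRec
  exact of_nat hF.succ fun a => by rw [hF']

@[fun_prop]
theorem const (n : ℕ) : Lim bd (fun _ : α => n) := by
  induction n with
  | zero => exact of_nat .zero fun _ => rfl
  | succ n ih => exact ih.succ

theorem expBdd {f : α → ℕ} (hf : Lim bd f) (h : bd) : ExpBdd f := by
  obtain ⟨F, hF, hF'⟩ := hf.exists_limRec
  rw [eq_true h] at hF
  obtain ⟨c, hc⟩ := hF.exists_le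
  exact ⟨c, fun a => by rw [← hF']; exact hc _⟩

theorem congr {f g : α → β} (hf : Lim bd f) (h : ∀ a, f a = g a) : Lim bd g :=
  funext h ▸ hf

theorem of_indicator {P : α → Prop} [DecidablePred P]
    (h : Lim bd (fun a => if P a then 1 else 0)) : Lim bd P := by
  obtain ⟨F, hF, hF'⟩ := h.exists_limRec
  refine fun _ => ⟨F, hF, fun a => (hF' a).trans ?_⟩
  by_cases hP : P a <;> simp [hP, Ctx.coord]

theorem indicator {P : α → Prop} [DecidablePred P] (h : Lim bd P) :
    Lim bd (fun a => if P a then 1 else 0) := by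
  obtain ⟨F, hF, hF'⟩ := h 0
  refine of_nat hF fun a => (hF' a).trans ?_
  by_cases hP : P a <;> simp [hP, Ctx.coord]

variable [Ctx.Full α]

/-- Bounded primitive recursion. -/
theorem natRec {n g : α → ℕ} {h : ℕ → ℕ → α → ℕ} (hn : Lim bd n) (hg : Lim bd g)
    (hh : Lim bd (fun p : ℕ × ℕ × α => h p.1 p.2.1 p.2.2))
    (hb : bd → ∃ b : α → ℕ, ExpBdd b ∧
      ∀ a, ∀ i ≤ n a, (Nat.rec (g a) (fun i x => h i x a) i : ℕ) ≤ b a) :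
    Lim bd (fun a => (Nat.rec (g a) (fun i x => h i x a) (n a) : ℕ)) := by
  obtain ⟨N, hN, hN'⟩ := hn.exists_limRec
  obtain ⟨G, hG, hG'⟩ := hg.exists_limRec
  obtain ⟨H, hH, hH'⟩ := hh.exists_limRec
  have key : ∀ a i, recVal G H (Ctx.coord a) i = (Nat.rec (g a) (fun i x => h i x a) i : ℕ) := by
    intro a i
    induction i with
    | zero => exact hG' a
    | succ i ih =>
      rw [recVal, ih]
      exact hH' (i, _, a)
  refine of_nat (.prec hN hG hH fun h => ?_) fun a => (key a _).trans (by rw [hN'])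
  obtain ⟨b, ⟨c, hc⟩, hb⟩ := hb h
  refine ⟨c, fun v i hi => ?_⟩
  obtain ⟨a, rfl⟩ := Ctx.Full.surj v
  rw [key]
  exact (hb a i (by rwa [← hN'])).trans (hc a)

@[fun_prop]
theorem add {f g : α → ℕ} (hf : Lim bd f) (hg : Lim bd g) : Lim bd (fun a => f a + g a) := by
  have key : ∀ a i, (Nat.rec (f a) (fun _ x => x + 1) i : ℕ) = f a + i := fun a i => by
    induction i with
    | zero => rfl
    | succ i ih => exact congrArg (· + 1) ih
  refine (natRec (h := fun _ x _ => x + 1) hg hf (by fun_prop) fun h =>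
    ⟨_, (hf.expBdd h).add (hg.expBdd h), fun a i hi => ?_⟩).congr fun a => key a _
  rw [key]
  omega

theorem pred {f : α → ℕ} (hf : Lim bd f) : Lim bd (fun a => f a - 1) := by
  have key : ∀ i, (Nat.rec 0 (fun i _ => i) i : ℕ) = i - 1 := fun i => by cases i <;> rfl
  refine (natRec (h := fun i _ _ => i) hf (const 0) (by fun_prop) fun h =>
    ⟨_, hf.expBdd h, fun a i hi => ?_⟩).congr fun a => key _
  rw [key]
  omega

@[fun_prop]
theorem sub {f g : α → ℕ} (hf : Lim bd f) (hg : Lim bd g) : Lim bd (fun a => f a - g a) := by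
  have key : ∀ a i, (Nat.rec (f a) (fun _ x => x - 1) i : ℕ) = f a - i := fun a i => by
    induction i with
    | zero => rfl
    | succ i ih => exact (congrArg (· - 1) ih).trans (Nat.sub_sub _ _ _)
  refine (natRec (h := fun _ x _ => x - 1) hg hf (pred (by fun_prop)) fun h =>
    ⟨_, hf.expBdd h, fun a i hi => ?_⟩).congr fun a => key a _
  rw [key]
  omega

@[fun_prop]
theorem mul {f g : α → ℕ} (hf : Lim bd f) (hg : Lim bd g) : Lim bd (fun a => f a * g a) := by
  have key : ∀ a i, (Nat.rec 0 (fun _ x => x + f a) i : ℕ) = f a * i := fun a i => by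
    induction i with
    | zero => rfl
    | succ i ih => exact (congrArg (· + f a) ih).trans (Nat.mul_succ _ _).symm
  refine (natRec (h := fun _ x a => x + f a) hg (const 0) (by fun_prop) fun h =>
    ⟨_, (hf.expBdd h).mul (hg.expBdd h), fun a i hi => ?_⟩).congr fun a => key a _
  rw [key]
  exact Nat.mul_le_mul_left _ hi

/-- Bounded summation. -/
@[fun_prop]
theorem sum {b : α → ℕ} {f : α → ℕ → ℕ} (hb : Lim bd b)
    (hf : Lim bd (fun p : ℕ × α => f p.2 p.1)) :
    Lim bd (fun a => ∑ i ∈ Finset.range (b a), f a i) := by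
  have key : ∀ a i, (Nat.rec 0 (fun i x => x + f a i) i : ℕ) = ∑ j ∈ Finset.range i, f a j :=
    fun a i => by
      induction i with
      | zero => rfl
      | succ i ih => exact (congrArg (· + f a i) ih).trans (Finset.sum_range_succ _ _).symm
  refine (natRec (h := fun i x a => x + f a i) hb (const 0)
    (add (by fun_prop) (hf.comp (f := fun p : ℕ × ℕ × α => (p.1, p.2.2)) (by fun_prop)))
    fun h => ?_).congr fun a => key a _
  obtain ⟨c, hc⟩ := hf.expBdd h
  have h1 : PolyBdd fun a => ((b a).size + Ctx.size a) ^ c := ((hb.expBdd h).size.add .size).pow c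
  refine ⟨_, (hb.expBdd h).mul h1.two_pow, fun a i hi => ?_⟩
  rw [key]
  refine (Finset.sum_le_card_nsmul (Finset.range i) _ (2 ^ ((b a).size + Ctx.size a) ^ c)
    fun j hj => (hc (j, a)).trans (Nat.pow_le_pow_right (by norm_num) (Nat.pow_le_pow_left ?_ c)
    )).trans ?_
  · rw [Ctx.size_prod]
    exact Nat.add_le_add_right (Nat.size_le_size ((Finset.mem_range.1 hj).le.trans hi)) _
  · rw [Finset.card_range, smul_eq_mul]
    exact Nat.mul_le_mul_right _ hi

/-- The predicate that a function is not zero. -/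
theorem ne_zero {f : α → ℕ} (hf : Lim bd f) : Lim bd (fun a => f a ≠ 0) := by
  classical
  refine of_indicator (congr (f := fun a => 1 - (1 - f a)) (by fun_prop) fun a => ?_)
  split_ifs <;> omega

@[fun_prop]
theorem not {P : α → Prop} (h : Lim bd P) : Lim bd (fun a => ¬ P a) := by
  classical
  have h' := h.indicator
  refine of_indicator (congr (f := fun a => 1 - if P a then 1 else 0) (by fun_prop) fun a => ?_)
  by_cases hP : P a <;> simp [hP]

@[fun_prop]
theorem and {P Q : α → Prop} (h : Lim bd P) (h' : Lim bd Q) : Lim bd (fun a => P a ∧ Q a) := by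
  classical
  have h1 := h.indicator
  have h2 := h'.indicator
  refine of_indicator (congr (f := fun a => (if P a then 1 else 0) * if Q a then 1 else 0)
    (by fun_prop) fun a => ?_)
  by_cases hP : P a <;> by_cases hQ : Q a <;> simp [hP, hQ]

@[fun_prop]
theorem or {P Q : α → Prop} (h : Lim bd P) (h' : Lim bd Q) : Lim bd (fun a => P a ∨ Q a) :=
  congr (f := fun a => ¬ (¬ P a ∧ ¬ Q a)) (by fun_prop) fun a => by
    rw [not_and_or, not_not, not_not]

@[fun_prop]
theorem imp {P Q : α → Prop} (h : Lim bd P) (h' : Lim bd Q) : Lim bd (fun a => P a → Q a) :=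
  congr (f := fun a => ¬ P a ∨ Q a) (by fun_prop) fun a => by rw [imp_iff_not_or]

@[fun_prop]
theorem lt {f g : α → ℕ} (hf : Lim bd f) (hg : Lim bd g) : Lim bd (fun a => f a < g a) :=
  congr (f := fun a => g a - f a ≠ 0) (ne_zero (by fun_prop)) fun a => by
    rw [eq_iff_iff]; omega

@[fun_prop]
theorem le {f g : α → ℕ} (hf : Lim bd f) (hg : Lim bd g) : Lim bd (fun a => f a ≤ g a) :=
  congr (f := fun a => ¬ g a < f a) (by fun_prop) fun a => by rw [not_lt]

@[fun_prop]
theorem eq {f g : α → ℕ} (hf : Lim bd f) (hg : Lim bd g) : Lim bd (fun a => f a = g a) :=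
  congr (f := fun a => f a ≤ g a ∧ g a ≤ f a) (by fun_prop) fun a => by
    rw [eq_iff_iff]; omega

/-- Bounded existential quantification. -/
@[fun_prop]
theorem exists_lt {b : α → ℕ} {P : α → ℕ → Prop} (hb : Lim bd b)
    (hP : Lim bd (fun p : ℕ × α => P p.2 p.1)) : Lim bd (fun a => ∃ i < b a, P a i) := by
  classical
  refine congr (f := fun a => ∑ i ∈ Finset.range (b a), (if P a i then 1 else 0) ≠ 0)
    (ne_zero (sum hb hP.indicator)) fun a => ?_
  simp

/-- Bounded universal quantification. -/
@[fun_prop]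
theorem forall_lt {b : α → ℕ} {P : α → ℕ → Prop} (hb : Lim bd b)
    (hP : Lim bd (fun p : ℕ × α => P p.2 p.1)) : Lim bd (fun a => ∀ i < b a, P a i) :=
  congr (f := fun a => ¬ ∃ i < b a, ¬ P a i) (not (exists_lt hb (not hP))) fun a => by simp

theorem forall_mem {ι : Type} (s : List ι) {P : ι → α → Prop} (hP : ∀ i, Lim bd (P i)) :
    Lim bd (fun a => ∀ i ∈ s, P i a) := by
  induction s with
  | nil => exact congr (f := fun _ => 0 = 0) (by fun_prop) fun a => by simp
  | cons i s ih =>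
    have := hP i
    exact congr (f := fun a => P i a ∧ ∀ i ∈ s, P i a) (by fun_prop) fun a => by simp

theorem exists_mem {ι : Type} (s : List ι) {P : ι → α → Prop} (hP : ∀ i, Lim bd (P i)) :
    Lim bd (fun a => ∃ i ∈ s, P i a) :=
  congr (f := fun a => ¬ ∀ i ∈ s, ¬ P i a) (not (forall_mem s fun i => not (hP i))) fun a => by simp

@[fun_prop]
theorem ite {P : α → Prop} [DecidablePred P] {f g : α → ℕ} (hP : Lim bd P) (hf : Lim bd f)
    (hg : Lim bd g) : Lim bd (fun a => if P a then f a else g a) := by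
  classical
  have h1 := hP.indicator
  have h2 : Lim bd (fun a => if ¬ P a then 1 else 0) := hP.not.indicator
  refine congr (f := fun a => (if P a then 1 else 0) * f a + (if ¬ P a then 1 else 0) * g a)
    (by fun_prop) fun a => ?_
  by_cases h : P a <;> simp [h]

/-- A function is obtained from its graph and a bound. -/
theorem of_graph {f g : α → ℕ} (hg : Lim bd g) (h : ∀ a, f a ≤ g a)
    (hf : Lim bd (fun p : ℕ × α => p.1 = f p.2)) : Lim bd f := by
  classical
  refine congr (f := fun a => ∑ i ∈ Finset.range (g a + 1), i * if i = f a then 1 else 0)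
    (sum hg.succ (mul fst (indicator hf))) fun a => ?_
  simp [Nat.lt_succ_of_le (h a)]

/-- Iteration of a function, with a bound for the iterates. -/
theorem iterate {n g : α → ℕ} {h : α → ℕ → ℕ} (hn : Lim bd n) (hg : Lim bd g)
    (hh : Lim bd (fun p : ℕ × α => h p.2 p.1))
    (hb : bd → ∃ b : α → ℕ, ExpBdd b ∧ ∀ a, ∀ i ≤ n a, (h a)^[i] (g a) ≤ b a) :
    Lim bd (fun a => (h a)^[n a] (g a)) := by
  have key : ∀ a i, (Nat.rec (g a) (fun _ x => h a x) i : ℕ) = (h a)^[i] (g a) := fun a i => by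
    induction i with
    | zero => rfl
    | succ i ih => rw [Function.iterate_succ_apply']; exact congrArg (h a) ih
  refine (natRec (h := fun _ x a => h a x) hn hg
    (hh.comp (f := fun p : ℕ × ℕ × α => (p.2.1, p.2.2)) (by fun_prop)) fun hbd => ?_).congr
    fun a => key a _
  obtain ⟨b, hb1, hb2⟩ := hb hbd
  exact ⟨b, hb1, fun a i hi => by rw [key]; exact hb2 a i hi⟩

theorem pow {f g : α → ℕ} (hf : Lim bd f) (hg : Lim bd g)
    (hb : bd → ∃ b : α → ℕ, ExpBdd b ∧ ∀ a, ∀ i ≤ g a, f a ^ i ≤ b a) :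
    Lim bd (fun a => f a ^ g a) := by
  have key : ∀ a i, (fun x => x * f a)^[i] 1 = f a ^ i := fun a i => by
    induction i with
    | zero => rfl
    | succ i ih => rw [Function.iterate_succ_apply', ih, pow_succ]
  refine (iterate (h := fun a x => x * f a) hg (const 1) (by fun_prop) fun h => ?_).congr
    fun a => key a _
  obtain ⟨b, hb1, hb2⟩ := hb h
  exact ⟨b, hb1, fun a i hi => by rw [key]; exact hb2 a i hi⟩

@[fun_prop]
theorem div {f g : α → ℕ} (hf : Lim bd f) (hg : Lim bd g) : Lim bd (fun a => f a / g a) := by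
  refine of_graph hf (fun a => Nat.div_le_self _ _) (congr (f := fun p : ℕ × α =>
    (g p.2 = 0 ∧ p.1 = 0) ∨ (0 < g p.2 ∧ p.1 * g p.2 ≤ f p.2 ∧ f p.2 < (p.1 + 1) * g p.2))
    (by fun_prop) fun p => ?_)
  rw [eq_iff_iff]
  rcases Nat.eq_zero_or_pos (g p.2) with h | h
  · simp [h]
  · rw [@eq_comm _ p.1 (f p.2 / g p.2), Nat.div_eq_iff h]
    simp only [h.ne', false_and, h, true_and, false_or]
    have : (p.1 + 1) * g p.2 = p.1 * g p.2 + g p.2 := by ring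
    omega

@[fun_prop]
theorem mod {f g : α → ℕ} (hf : Lim bd f) (hg : Lim bd g) : Lim bd (fun a => f a % g a) :=
  congr (f := fun a => f a - g a * (f a / g a)) (by fun_prop) fun a => by
    have := Nat.div_add_mod (f a) (g a)
    omega

end Lim

end

/-! ### Reachability by repeated squaring -/

/-- In a finite set every element of an orbit is attained after few iterations. -/
theorem exists_iterate_lt_card {α : Type*} (f : α → α) (x : α) (s : Finset α)
    (hs : ∀ i, f^[i] x ∈ s) (k : ℕ) : ∃ j < s.card, f^[j] x = f^[k] x := by
  induction k using Nat.strong_induction_on with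
  | _ k ih =>
    rcases lt_or_ge k s.card with hk | hk
    · exact ⟨k, hk, rfl⟩
    · obtain ⟨i, hi, j, hj, hij, h⟩ := Finset.exists_ne_map_eq_of_card_lt_of_maps_to
        (s := Finset.range (s.card + 1)) (t := s) (by simp) (f := fun i => f^[i] x)
        (fun i _ => hs i)
      have key : ∀ i j, i < j → j < s.card + 1 → f^[i] x = f^[j] x →
          ∃ j < s.card, f^[j] x = f^[k] x := by
        intro i j hij hj h
        obtain ⟨l, hl, hl'⟩ := ih (k - j + i) (by omega)
        refine ⟨l, hl, hl'.trans ?_⟩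
        rw [Function.iterate_add_apply, h, ← Function.iterate_add_apply]
        congr 2
        omega
      rcases lt_or_gt_of_ne hij with hlt | hlt
      · exact key i j hlt (Finset.mem_range.1 hj) h
      · exact key j i hlt (Finset.mem_range.1 hi) h.symm

/-- The relation on `{0, …, B - 1}` obtained from `E` by squaring it `k` times. -/
def squared (E : ℕ → ℕ → Prop) (B : ℕ) : ℕ → ℕ → ℕ → Prop
  | 0, s, t => E s t
  | k + 1, s, t => ∃ r < B, squared E B k s r ∧ squared E B k r t

theorem add_mul_mod_of_lt {x n : ℕ} (h : x < n) (y : ℕ) : (x + n * y) % n = x := by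
  rw [Nat.add_mul_mod_self_left, Nat.mod_eq_of_lt h]

theorem add_mul_div_of_lt {x n : ℕ} (h : x < n) (y : ℕ) : (x + n * y) / n = y := by
  rw [Nat.add_mul_div_left _ _ (Nat.zero_lt_of_lt h), Nat.div_eq_of_lt h, zero_add]

theorem add_mul_lt {x n y m : ℕ} (hx : x < n) (hy : y < m) : x + n * y < n * m := by
  have : n * (y + 1) ≤ n * m := Nat.mul_le_mul_left _ hy
  rw [mul_add] at this
  omega

namespace Savitch

/-! The depth-first evaluation of `squared E B K` uses states that consist of a stack `c`, a pair of
vertices `s`, `t`, a level `k ≤ K` and a mode `m`. In the mode `2`, the truth value of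
`squared E B k s t` is to be computed; in the modes `0` and `1`, it has been computed and is the
value of the mode. The stack is a number in base `2 * B ^ 3`. Its digits are the pending existential
quantifiers: the digit `s`, `t`, `r`, `b` stands for the evaluation of the first (`b = 0`) or
second (`b = 1`) condition on the midpoint `r` between `s` and `t`. -/

section

variable (E : ℕ → ℕ → Prop) (B K : ℕ)

/-- A digit of the stack. -/
def frame (s t r b : ℕ) : ℕ := b + 2 * (r + B * (t + B * s))

/-- The base of the number that represents the stack. -/
def base : ℕ := 2 * (B * (B * B))

/-- The code of a state. -/
def pack (c s t k m : ℕ) : ℕ := m + 3 * (k + (K + 1) * (t + B * (s + B * c)))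

open Classical in
/-- One step of the evaluation, on the components of a state. -/
noncomputable def stepTuple (c s t k m : ℕ) : ℕ :=
  if m = 2 then
    if k = 0 then pack B K c 0 0 0 (if E s t then 1 else 0)
    else pack B K (frame B s t 0 0 + base B * c) s 0 (k - 1) 2
  else if k = K then pack B K c s t k m
  else if m = 1 then
    if c % base B % 2 = 0 then
      pack B K (frame B (c % base B / 2 / B / B) (c % base B / 2 / B % B)
        (c % base B / 2 % B) 1 + base B * (c / base B)) (c % base B / 2 % B)
        (c % base B / 2 / B % B) k 2
    else pack B K (c / base B) 0 0 (k + 1) 1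
  else if c % base B / 2 % B + 1 < B then
    pack B K (frame B (c % base B / 2 / B / B) (c % base B / 2 / B % B)
      (c % base B / 2 % B + 1) 0 + base B * (c / base B)) (c % base B / 2 / B / B)
      (c % base B / 2 % B + 1) k 2
  else pack B K (c / base B) 0 0 (k + 1) 0

/-- One step of the evaluation, on the code of a state. -/
noncomputable def step (z : ℕ) : ℕ :=
  stepTuple E B K (z / 3 / (K + 1) / B / B) (z / 3 / (K + 1) / B % B) (z / 3 / (K + 1) % B)
    (z / 3 % (K + 1)) (z % 3)

variable {E B K}

theorem frame_lt {s t r b : ℕ} (hs : s < B) (ht : t < B) (hr : r < B) (hb : b < 2) :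
    frame B s t r b < base B :=
  add_mul_lt hb (add_mul_lt hr (add_mul_lt ht hs))

theorem step_pack {c s t k m : ℕ} (hs : s < B) (ht : t < B) (hk : k ≤ K) (hm : m < 3) :
    step E B K (pack B K c s t k m) = stepTuple E B K c s t k m := by
  simp only [step, pack, add_mul_mod_of_lt hm, add_mul_div_of_lt hm,
    add_mul_mod_of_lt (Nat.lt_succ_of_le hk), add_mul_div_of_lt (Nat.lt_succ_of_le hk),
    add_mul_mod_of_lt ht, add_mul_div_of_lt ht, add_mul_mod_of_lt hs, add_mul_div_of_lt hs]

theorem step_frame {c s t r b x y k m : ℕ} (hs : s < B) (ht : t < B) (hr : r < B) (hb : b < 2)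
    (hx : x < B) (hy : y < B) (hk : k < K) (hm : m < 2) :
    step E B K (pack B K (frame B s t r b + base B * c) x y k m) =
      if m = 1 then
        if b = 0 then pack B K (frame B s t r 1 + base B * c) r t k 2
        else pack B K c 0 0 (k + 1) 1
      else if r + 1 < B then pack B K (frame B s t (r + 1) 0 + base B * c) s (r + 1) k 2
      else pack B K c 0 0 (k + 1) 0 := by
  have hf := frame_lt hs ht hr hb
  rw [step_pack hx hy hk.le (by omega), stepTuple, if_neg (by omega), if_neg hk.ne]
  simp only [add_mul_mod_of_lt hf, add_mul_div_of_lt hf]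
  simp only [frame, add_mul_mod_of_lt hb, add_mul_div_of_lt hb, add_mul_mod_of_lt hr,
    add_mul_div_of_lt hr, add_mul_mod_of_lt ht, add_mul_div_of_lt ht]

/-- The states that occur in the evaluation: the higher the stack, the lower the level. -/
def Valid (B K z : ℕ) : Prop :=
  ∃ c s t k m, z = pack B K c s t k m ∧ s < B ∧ t < B ∧ k ≤ K ∧ m < 3 ∧ c < base B ^ (K - k)

theorem Valid.lt {z : ℕ} (h : Valid B K z) : z < 3 * ((K + 1) * (B * (B * base B ^ K))) := by
  obtain ⟨c, s, t, k, m, rfl, hs, ht, hk, hm, hc⟩ := h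
  refine add_mul_lt hm (add_mul_lt (Nat.lt_succ_of_le hk) (add_mul_lt ht (add_mul_lt hs ?_)))
  refine hc.trans_le (Nat.pow_le_pow_right ?_ (Nat.sub_le _ _))
  have : 0 < B := by omega
  unfold base
  positivity

theorem Valid.step {z : ℕ} (h : Valid B K z) : Valid B K (step E B K z) := by
  obtain ⟨c, s, t, k, m, rfl, hs, ht, hk, hm, hc⟩ := h
  have hB : 0 < B := by omega
  have hbase : 0 < base B := by unfold base; positivity
  rw [step_pack hs ht hk hm, stepTuple]
  have hcmod : c % base B < 2 * (B * (B * B)) := Nat.mod_lt _ hbase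
  have hr : c % base B / 2 % B < B := Nat.mod_lt _ hB
  have ht' : c % base B / 2 / B % B < B := Nat.mod_lt _ hB
  have hs' : c % base B / 2 / B / B < B := by
    rw [Nat.div_div_eq_div_mul, Nat.div_div_eq_div_mul]
    refine Nat.div_lt_of_lt_mul ?_
    calc _ < _ := hcmod
      _ = _ := by ring
  have hpow : k < K → base B ^ (K - k) = base B * base B ^ (K - (k + 1)) := fun h => by
    rw [← pow_succ']
    congr 1
    omega
  have hdiv : k < K → c / base B < base B ^ (K - (k + 1)) := fun h => by
    refine Nat.div_lt_of_lt_mul ?_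
    rwa [← hpow h]
  split_ifs with h1 h2 h3 h4 h5 h6 h7
  · exact ⟨_, _, _, _, _, rfl, hB, hB, by omega, by omega, by rwa [h2] at hc⟩
  · exact ⟨_, _, _, _, _, rfl, hB, hB, by omega, by omega, by rwa [h2] at hc⟩
  · refine ⟨_, _, _, _, _, rfl, hs, hB, by omega, by omega, ?_⟩
    have : K - (k - 1) = (K - k) + 1 := by omega
    rw [this, pow_succ']
    exact add_mul_lt (frame_lt hs ht hB (by omega)) hc
  · exact ⟨_, _, _, _, _, rfl, hs, ht, hk, hm, hc⟩
  · refine ⟨_, _, _, _, _, rfl, hr, ht', hk, by omega, ?_⟩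
    rw [hpow (by omega)]
    exact add_mul_lt (frame_lt hs' ht' hr (by omega)) (hdiv (by omega))
  · exact ⟨_, _, _, _, _, rfl, hB, hB, by omega, by omega, hdiv (by omega)⟩
  · refine ⟨_, _, _, _, _, rfl, hs', h7, hk, by omega, ?_⟩
    rw [hpow (by omega)]
    exact add_mul_lt (frame_lt hs' ht' h7 (by omega)) (hdiv (by omega))
  · exact ⟨_, _, _, _, _, rfl, hB, hB, by omega, by omega, hdiv (by omega)⟩

open Classical in
/-- The evaluation of a subproblem ends with its truth value, and restores the stack. -/
theorem exists_iterate_step : ∀ k ≤ K, ∀ c s t, s < B → t < B → ∃ i,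
    (step E B K)^[i] (pack B K c s t k 2) =
      pack B K c 0 0 k (if squared E B k s t then 1 else 0) := by
  intro k
  induction k with
  | zero =>
    intro _ c s t hs ht
    refine ⟨1, ?_⟩
    rw [Function.iterate_one, step_pack hs ht (Nat.zero_le _) (by norm_num), stepTuple,
      if_pos rfl, if_pos rfl]
    rfl
  | succ k ih =>
    intro hk c s t hs ht
    have hB : 0 < B := by omega
    have key : ∀ d r, r + d + 1 = B → ∃ i,
        (step E B K)^[i] (pack B K (frame B s t r 0 + base B * c) s r k 2) =
          pack B K c 0 0 (k + 1) (if ∃ r' < B, r ≤ r' ∧ squared E B k s r' ∧ squared E B k r' t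
            then 1 else 0) := by
      intro d
      induction d with
      | zero =>
        intro r hr
        obtain ⟨i, hi⟩ := ih (by omega) (frame B s t r 0 + base B * c) s r hs (by omega)
        obtain ⟨j, hj⟩ := ih (by omega) (frame B s t r 1 + base B * c) r t (by omega) ht
        have hiff : (∃ r' < B, r ≤ r' ∧ squared E B k s r' ∧ squared E B k r' t) ↔
            squared E B k s r ∧ squared E B k r t := by
          constructor
          · rintro ⟨r', h1, h2, h3⟩
            obtain rfl : r' = r := by omega
            exact h3
          · exact fun h => ⟨r, by omega, le_rfl, h⟩
        by_cases h1 : squared E B k s r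
        · by_cases h2 : squared E B k r t
          · refine ⟨1 + (j + (1 + i)), ?_⟩
            rw [Function.iterate_add_apply, Function.iterate_add_apply _ j,
              Function.iterate_add_apply _ 1 i, hi, Function.iterate_one,
              step_frame hs ht (by omega) (by omega) hB hB (by omega) (by simp [h1]), if_pos h1,
              if_pos rfl, if_pos rfl, hj, if_pos h2,
              step_frame hs ht (by omega) (by omega) hB hB (by omega) (by omega), if_pos rfl,
              if_neg (by omega), if_pos (hiff.2 ⟨h1, h2⟩)]
          · refine ⟨1 + (j + (1 + i)), ?_⟩
            rw [Function.iterate_add_apply, Function.iterate_add_apply _ j,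
              Function.iterate_add_apply _ 1 i, hi, Function.iterate_one,
              step_frame hs ht (by omega) (by omega) hB hB (by omega) (by simp [h1]), if_pos h1,
              if_pos rfl, if_pos rfl, hj, if_neg h2,
              step_frame hs ht (by omega) (by omega) hB hB (by omega) (by omega),
              if_neg (by omega), if_neg (by omega), if_neg fun h => h2 (hiff.1 h).2]
        · refine ⟨1 + i, ?_⟩
          rw [Function.iterate_add_apply, hi, Function.iterate_one, if_neg h1,
            step_frame hs ht (by omega) (by omega) hB hB (by omega) (by omega),
            if_neg (by omega), if_neg (by omega), if_neg fun h => h1 (hiff.1 h).1]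
      | succ d ihd =>
        intro r hr
        obtain ⟨i, hi⟩ := ih (by omega) (frame B s t r 0 + base B * c) s r hs (by omega)
        obtain ⟨j, hj⟩ := ih (by omega) (frame B s t r 1 + base B * c) r t (by omega) ht
        obtain ⟨l, hl⟩ := ihd (r + 1) (by omega)
        have hiff : ¬ (squared E B k s r ∧ squared E B k r t) →
            ((∃ r' < B, r ≤ r' ∧ squared E B k s r' ∧ squared E B k r' t) ↔
            ∃ r' < B, r + 1 ≤ r' ∧ squared E B k s r' ∧ squared E B k r' t) := by
          intro h0
          constructor
          · rintro ⟨r', h1, h2, h3⟩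
            rcases eq_or_lt_of_le h2 with rfl | h2
            · exact absurd h3 h0
            · exact ⟨r', h1, h2, h3⟩
          · rintro ⟨r', h1, h2, h3⟩
            exact ⟨r', h1, by omega, h3⟩
        by_cases h1 : squared E B k s r
        · by_cases h2 : squared E B k r t
          · refine ⟨1 + (j + (1 + i)), ?_⟩
            rw [Function.iterate_add_apply, Function.iterate_add_apply _ j,
              Function.iterate_add_apply _ 1 i, hi, Function.iterate_one,
              step_frame hs ht (by omega) (by omega) hB hB (by omega) (by simp [h1]), if_pos h1,
              if_pos rfl, if_pos rfl, hj, if_pos h2,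
              step_frame hs ht (by omega) (by omega) hB hB (by omega) (by omega), if_pos rfl,
              if_neg (by omega), if_pos ⟨r, by omega, le_rfl, h1, h2⟩]
          · refine ⟨l + (1 + (j + (1 + i))), ?_⟩
            rw [Function.iterate_add_apply, Function.iterate_add_apply _ 1,
              Function.iterate_add_apply _ j,
              Function.iterate_add_apply _ 1 i, hi, Function.iterate_one,
              step_frame hs ht (by omega) (by omega) hB hB (by omega) (by simp [h1]), if_pos h1,
              if_pos rfl, if_pos rfl, hj, if_neg h2,
              step_frame hs ht (by omega) (by omega) hB hB (by omega) (by omega),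
              if_neg (by omega), if_pos (by omega), hl]
            congr 1
            simp only [hiff fun h => h2 h.2]
        · refine ⟨l + (1 + i), ?_⟩
          rw [Function.iterate_add_apply, Function.iterate_add_apply _ 1, hi,
            Function.iterate_one, if_neg h1,
            step_frame hs ht (by omega) (by omega) hB hB (by omega) (by omega),
            if_neg (by omega), if_pos (by omega), hl]
          congr 1
          simp only [hiff fun h => h1 h.1]
    obtain ⟨i, hi⟩ := key (B - 1) 0 (by omega)
    refine ⟨i + 1, ?_⟩
    rw [Function.iterate_add_apply, Function.iterate_one, step_pack hs ht hk (by norm_num),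
      stepTuple, if_pos rfl, if_neg (Nat.succ_ne_zero k), Nat.add_sub_cancel, hi]
    exact congrArg _ (if_congr (by simp [squared]) rfl rfl)

/-- The relation is decided by a search through the orbit of the initial state. -/
theorem squared_iff {s t : ℕ} (hs : s < B) (ht : t < B) :
    squared E B K s t ↔ ∃ i < 3 * ((K + 1) * (B * (B * base B ^ K))),
      (step E B K)^[i] (pack B K 0 s t K 2) = pack B K 0 0 0 K 1 := by
  classical
  have hB : 0 < B := by omega
  have hvalid : ∀ i, Valid B K ((step E B K)^[i] (pack B K 0 s t K 2)) := by
    intro i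
    induction i with
    | zero => exact ⟨_, _, _, _, _, rfl, hs, ht, le_rfl, by norm_num, by simp⟩
    | succ i ih => rw [Function.iterate_succ_apply']; exact ih.step
  have hfix : ∀ m < 2, ∀ i, (step E B K)^[i] (pack B K 0 0 0 K m) = pack B K 0 0 0 K m := by
    intro m hm i
    refine Function.iterate_fixed ?_ i
    rw [step_pack hB hB le_rfl (by omega), stepTuple, if_neg (by omega), if_pos rfl]
  obtain ⟨i, hi⟩ := exists_iterate_step (E := E) K le_rfl 0 s t hs ht
  constructor
  · intro h
    rw [if_pos h] at hi
    obtain ⟨j, hj, hj'⟩ := exists_iterate_lt_card (step E B K) (pack B K 0 s t K 2)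
      (Finset.range (3 * ((K + 1) * (B * (B * base B ^ K)))))
      (fun i => Finset.mem_range.2 (hvalid i).lt) i
    exact ⟨j, by simpa using hj, hj'.trans hi⟩
  · rintro ⟨j, -, hj⟩
    by_contra h
    rw [if_neg h] at hi
    -- both final states are fixed, hence they cannot both be reached
    have h1 : (step E B K)^[i + j] (pack B K 0 s t K 2) = pack B K 0 0 0 K 1 := by
      rw [Function.iterate_add_apply, hj, hfix 1 (by norm_num)]
    have h2 : (step E B K)^[i + j] (pack B K 0 s t K 2) = pack B K 0 0 0 K 0 := by
      rw [add_comm, Function.iterate_add_apply, hi, hfix 0 (by norm_num)]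
    rw [h1] at h2
    simp [pack] at h2

end

variable {bd : Prop} {α : Type} [Ctx α] [Ctx.Full α]

@[fun_prop]
theorem lim_frame {B s t r b : α → ℕ} (hB : Lim bd B) (hs : Lim bd s) (ht : Lim bd t)
    (hr : Lim bd r) (hb : Lim bd b) :
    Lim bd (fun a => frame (B a) (s a) (t a) (r a) (b a)) := by
  unfold frame
  fun_prop

@[fun_prop]
theorem lim_base {B : α → ℕ} (hB : Lim bd B) : Lim bd (fun a => base (B a)) := by
  unfold base
  fun_prop

@[fun_prop]
theorem lim_pack {B K c s t k m : α → ℕ} (hB : Lim bd B) (hK : Lim bd K) (hc : Lim bd c)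
    (hs : Lim bd s) (ht : Lim bd t) (hk : Lim bd k) (hm : Lim bd m) :
    Lim bd (fun a => pack (B a) (K a) (c a) (s a) (t a) (k a) (m a)) := by
  unfold pack
  fun_prop

theorem lim_stepTuple {E : α → ℕ → ℕ → Prop} {B K c s t k m : α → ℕ}
    (hE : Lim bd (fun p : ℕ × ℕ × α => E p.2.2 p.1 p.2.1)) (hB : Lim bd B) (hK : Lim bd K)
    (hc : Lim bd c) (hs : Lim bd s) (ht : Lim bd t) (hk : Lim bd k) (hm : Lim bd m) :
    Lim bd (fun a => stepTuple (E a) (B a) (K a) (c a) (s a) (t a) (k a) (m a)) := by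
  classical
  have hE' : Lim bd (fun a => E a (s a) (t a)) :=
    hE.comp (f := fun a => (s a, t a, a)) (by fun_prop)
  have hE'' : Lim bd (fun a => if E a (s a) (t a) then 1 else 0) := hE'.indicator
  unfold stepTuple
  refine .ite (by fun_prop) (.ite (by fun_prop) ?_ (by fun_prop)) (.ite (by fun_prop) (by fun_prop)
    (.ite (by fun_prop) (.ite (by fun_prop) (by fun_prop) (by fun_prop))
      (.ite (by fun_prop) (by fun_prop) (by fun_prop))))
  exact lim_pack hB hK hc (.const 0) (.const 0) (.const 0) hE''

theorem lim_step {E : α → ℕ → ℕ → Prop} {B K : α → ℕ}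
    (hE : Lim bd (fun p : ℕ × ℕ × α => E p.2.2 p.1 p.2.1)) (hB : Lim bd B) (hK : Lim bd K) :
    Lim bd (fun p : ℕ × α => step (E p.2) (B p.2) (K p.2) p.1) := by
  unfold step
  refine lim_stepTuple (E := fun p : ℕ × α => E p.2)
    (hE.comp (f := fun p : ℕ × ℕ × ℕ × α => (p.1, p.2.1, p.2.2.2)) (by fun_prop))
    ?_ ?_ ?_ ?_ ?_ ?_ ?_ <;> fun_prop

/-- Savitch's theorem: reachability in a graph is decided in polynomial space if adjacency is and
if the vertices have polynomial length. -/
theorem _root_.Lim.squared {E : α → ℕ → ℕ → Prop} {B K s t : α → ℕ}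
    (hE : Lim bd (fun p : ℕ × ℕ × α => E p.2.2 p.1 p.2.1)) (hB : Lim bd B) (hK : Lim bd K)
    (hs : Lim bd s) (ht : Lim bd t) (hsB : ∀ a, s a < B a) (htB : ∀ a, t a < B a)
    (hKb : bd → PolyBdd K) : Lim bd (fun a => squared (E a) (B a) (K a) (s a) (t a)) := by
  have hbase : ∀ a, 0 < base (B a) := fun a => by
    have : 0 < B a := by have := hsB a; omega
    unfold base
    positivity
  have hpow : Lim bd (fun a => base (B a) ^ K a) := by
    refine .pow (by fun_prop) hK fun h => ⟨_, ((lim_base hB).expBdd h).pow (hKb h), ?_⟩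
    exact fun a i hi => Nat.pow_le_pow_right (hbase a) hi
  have hiter : Lim bd (fun p : ℕ × α => (step (E p.2) (B p.2) (K p.2))^[p.1]
      (pack (B p.2) (K p.2) 0 (s p.2) (t p.2) (K p.2) 2)) := by
    refine .iterate (h := fun p : ℕ × α => step (E p.2) (B p.2) (K p.2)) (by fun_prop)
      (by fun_prop) ((lim_step hE hB hK).comp (f := fun p : ℕ × ℕ × α => (p.1, p.2.2))
        (by fun_prop)) fun h => ?_
    refine ⟨fun p : ℕ × α =>
      3 * ((K p.2 + 1) * (B p.2 * (B p.2 * base (B p.2) ^ K p.2))), ?_, ?_⟩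
    · exact Lim.expBdd (bd := bd) ((show Lim bd fun a =>
        3 * ((K a + 1) * (B a * (B a * base (B a) ^ K a))) by fun_prop).comp Lim.snd) h
    · intro p i _
      have : ∀ i, Valid (B p.2) (K p.2) ((step (E p.2) (B p.2) (K p.2))^[i]
          (pack (B p.2) (K p.2) 0 (s p.2) (t p.2) (K p.2) 2)) := by
        intro i
        induction i with
        | zero => exact ⟨_, _, _, _, _, rfl, hsB _, htB _, le_rfl, by norm_num, by simp⟩
        | succ i ih => rw [Function.iterate_succ_apply']; exact ih.step
      exact (this i).lt.le
  refine Lim.congr (f := fun a => ∃ i < 3 * ((K a + 1) * (B a * (B a * base (B a) ^ K a))),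
    (step (E a) (B a) (K a))^[i] (pack (B a) (K a) 0 (s a) (t a) (K a) 2) =
      pack (B a) (K a) 0 0 0 (K a) 1) ?_ fun a => propext (squared_iff (hsB a) (htB a)).symm
  exact .exists_lt (by fun_prop) (.eq hiter (by fun_prop))

end Savitch

/-! ### Arithmetic on codes of semiautomata -/

section Arithmetic

variable {bd : Prop} {α : Type} [Ctx α] [Ctx.Full α]

/-- The digit number `i` of `t` in base `n`. -/
def dig (n t i : ℕ) : ℕ := t / n ^ i % n

@[fun_prop]
theorem Lim.div_pow {f g h : α → ℕ} (hf : Lim bd f) (hg : Lim bd g) (hh : Lim bd h) :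
    Lim bd (fun a => f a / g a ^ h a) := by
  have key : ∀ a i, (fun x => x / g a)^[i] (f a) = f a / g a ^ i := fun a i => by
    induction i with
    | zero => simp
    | succ i ih => rw [Function.iterate_succ_apply', ih, Nat.div_div_eq_div_mul, pow_succ]
  refine (iterate (h := fun a x => x / g a) hh hf (by fun_prop) fun hbd =>
    ⟨f, hf.expBdd hbd, fun a i _ => ?_⟩).congr fun a => key a _
  rw [key]
  exact Nat.div_le_self _ _

@[fun_prop]
theorem lim_dig {f g h : α → ℕ} (hf : Lim bd f) (hg : Lim bd g) (hh : Lim bd h) :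
    Lim bd (fun a => dig (f a) (g a) (h a)) := by
  unfold dig
  fun_prop

theorem exists_bit_eq_zero (N : ℕ) : ∃ i, N / 2 ^ i % 2 = 0 :=
  ⟨N.size, by rw [Nat.div_eq_of_lt (Nat.lt_size_self N)]⟩

/-- The number of trailing ones in the binary expansion of `N`. -/
def run (N : ℕ) : ℕ := Nat.find (exists_bit_eq_zero N)

/-- What is left of the binary expansion of `N` after the trailing ones and the next zero. -/
def rest (N : ℕ) : ℕ := N / 2 ^ (run N + 1)

theorem run_le_size (N : ℕ) : run N ≤ N.size :=
  Nat.find_min' _ (by rw [Nat.div_eq_of_lt (Nat.lt_size_self N)])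

theorem run_bit_false (N : ℕ) : run (Nat.bit false N) = 0 := by
  rw [run, Nat.find_eq_zero]
  simp [Nat.bit_val]

theorem run_bit_true (N : ℕ) : run (Nat.bit true N) = run N + 1 := by
  have h : ∀ i, Nat.bit true N / 2 ^ (i + 1) = N / 2 ^ i := fun i => by
    rw [pow_succ', ← Nat.div_div_eq_div_mul, Nat.bit_val]
    congr 1
    simp only [Bool.toNat_true]
    omega
  rw [run, Nat.find_eq_iff]
  constructor
  · rw [h]
    exact Nat.find_spec (exists_bit_eq_zero N)
  · intro i hi
    cases i with
    | zero => simp [Nat.bit_val]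
    | succ i =>
      rw [h]
      exact Nat.find_min (exists_bit_eq_zero N) (Nat.lt_of_succ_lt_succ hi)

theorem rest_bit_false (N : ℕ) : rest (Nat.bit false N) = N := by
  rw [rest, run_bit_false, Nat.bit_val]
  simp

theorem rest_bit_true (N : ℕ) : rest (Nat.bit true N) = rest N := by
  rw [rest, rest, run_bit_true, pow_succ', ← Nat.div_div_eq_div_mul, Nat.bit_val]
  congr 1
  simp only [Bool.toNat_true]
  omega

@[fun_prop]
theorem lim_run {β : Type} [Ctx β] {f : β → ℕ} (hf : Lim bd f) : Lim bd (fun a => run (f a)) := by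
  have h : Lim bd (fun n : ℕ => run n) := by
    refine .of_graph (g := fun n => n) .id
      (fun n => Nat.find_min' _ (by rw [Nat.div_eq_of_lt Nat.lt_two_pow_self]))
      (.congr (f := fun p : ℕ × ℕ => p.2 / 2 ^ p.1 % 2 = 0 ∧ ∀ i < p.1, ¬ p.2 / 2 ^ i % 2 = 0)
        (by fun_prop) fun p => ?_)
    rw [@eq_comm ℕ p.1, run, Nat.find_eq_iff]
  exact h.comp hf

@[fun_prop]
theorem lim_rest {f : α → ℕ} (hf : Lim bd f) : Lim bd (fun a => rest (f a)) := by
  unfold rest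
  fun_prop

theorem rest_le (N : ℕ) : rest N ≤ N := Nat.div_le_self _ _

@[fun_prop]
theorem lim_iterate_rest {f g : α → ℕ} (hf : Lim bd f) (hg : Lim bd g) :
    Lim bd (fun a => rest^[f a] (g a)) := by
  refine .iterate (h := fun _ => rest) hf hg (by fun_prop) fun h =>
    ⟨g, hg.expBdd h, fun a i hi => ?_⟩
  clear hi
  generalize g a = N
  induction i with
  | zero => exact le_rfl
  | succ i ih => rw [Function.iterate_succ_apply']; exact (rest_le _).trans ih

/-- The number whose digits in base `n` are `f 0`, …, `f (k - 1)`. -/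
def tab (n k : ℕ) (f : ℕ → ℕ) : ℕ := ∑ i ∈ Finset.range k, f i * n ^ i

theorem Lim.tab {n : α → ℕ} {f : α → ℕ → ℕ} (hn : Lim bd n)
    (hf : Lim bd (fun p : ℕ × α => f p.2 p.1)) (hb : bd → PolyBdd n) :
    Lim bd (fun a => _root_.tab (n a) (n a) (f a)) := by
  have hpow : Lim bd (fun p : ℕ × α => n p.2 ^ if p.1 < n p.2 then p.1 else 0) := by
    refine .pow (by fun_prop) (by fun_prop) fun h => ?_
    have h1 : ExpBdd (fun p : ℕ × α => n p.2 + 1) :=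
      (show Lim bd (fun p : ℕ × α => n p.2 + 1) by fun_prop).expBdd h
    have h2 : PolyBdd (fun p : ℕ × α => n p.2) := by
      obtain ⟨c, hc⟩ := hb h
      refine ⟨c, fun p => (hc _).trans (Nat.pow_le_pow_left ?_ c)⟩
      rw [show p = (p.1, p.2) from rfl, Ctx.size_prod]
      exact Nat.le_add_left _ _
    refine ⟨_, h1.pow h2, fun p i hi => ?_⟩
    refine (Nat.pow_le_pow_left (Nat.le_succ _) i).trans (Nat.pow_le_pow_right (by omega) ?_)
    split_ifs at hi <;> omega
  refine (Lim.sum hn (f := fun a i => f a i * n a ^ if i < n a then i else 0)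
    (.mul hf hpow)).congr fun a => Finset.sum_congr rfl fun i hi => ?_
  rw [if_pos (Finset.mem_range.1 hi)]

theorem tab_eq {n k : ℕ} {f : ℕ → ℕ} (g : Fin k → Fin n) (h : ∀ i : Fin k, f i = g i) :
    tab n k f = (finFunctionFinEquiv g : ℕ) := by
  rw [finFunctionFinEquiv_apply, tab, Finset.sum_range]
  exact Finset.sum_congr rfl fun i _ => by rw [h]

theorem dig_finFunctionFinEquiv {n k : ℕ} (g : Fin k → Fin n) (i : Fin k) :
    dig n (finFunctionFinEquiv g : ℕ) i = g i := by
  conv_rhs => rw [← finFunctionFinEquiv.symm_apply_apply g]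
  rfl

end Arithmetic

namespace Codes

/-! In this part, `N` stands for the code of a semiautomaton, read as a number. A transformation of
its set of states is represented by the number `t` with `dig n t q` the image of `q`, where `n` is
the number of states. -/

/-- The number of states. -/
def nS (N : ℕ) : ℕ := run N

/-- The number of letters. -/
def nA (N : ℕ) : ℕ := run (rest N)

/-- The transition function. -/
def delta (N q a : ℕ) : ℕ := run (rest^[2 + (q * nA N + a)] N)

/-- The order of the states. -/
def leq (N p q : ℕ) : Prop := rest^[2 + nS N * nA N] N / 2 ^ (p * nS N + q) % 2 = 1

/-- The number of transformations of the set of states. -/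
def nT (N : ℕ) : ℕ := nS N ^ nS N

/-- The transformation with given values. -/
def trans (N : ℕ) (f : ℕ → ℕ) : ℕ := tab (nS N) (nS N) f

/-- The image of a state under a transformation. -/
def app (N t q : ℕ) : ℕ := dig (nS N) t q

/-- The identical transformation. -/
def one (N : ℕ) : ℕ := trans N fun q => q

/-- The transformation given by a letter. -/
def letter (N a : ℕ) : ℕ := trans N fun q => delta N q a

/-- The composition of two transformations, the first of which acts first. -/
def comp (N s t : ℕ) : ℕ := trans N fun q => app N t (app N s q)

/-- The power of a transformation. -/
def power (N t k : ℕ) : ℕ := (fun r => comp N r t)^[k] (one N)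

open Classical in
/-- The idempotent power of a transformation, as the sum over all idempotent powers, of which
there is only one. -/
noncomputable def omegaPower (N t : ℕ) : ℕ :=
  ∑ r ∈ Finset.range (nT N), if comp N r r = r ∧ ∃ k < nT N, r = power N t (k + 1) then r else 0

/-- The transformation is given by some word. It then is given by a word of length at most
`2 ^ (n * n)`, where `n` is the number of states. -/
def InMonoid (N t : ℕ) : Prop :=
  squared (fun s t => s = t ∨ ∃ a < nA N, t = comp N s (letter N a)) (nT N) (nS N * nS N)
    (one N % nT N) (t % nT N)

/-- The value of a term, if the transformation for the variable `x` is the digit number `x` of `e`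
in base `nT N`. -/
noncomputable def value (N e : ℕ) : OmegaTerm → ℕ
  | .var x => dig (nT N) e x
  | .mul s t => comp N (value N e s) (value N e t)
  | .omega t => omegaPower N (value N e t)

theorem nT_pos (N : ℕ) : 0 < nT N := by
  unfold nT
  rcases Nat.eq_zero_or_pos (nS N) with h | h
  · simp [h]
  · positivity

theorem app_lt {N : ℕ} (h : 0 < nS N) (t q : ℕ) : app N t q < nS N := Nat.mod_lt _ h

theorem trans_lt {N : ℕ} {f : ℕ → ℕ} (hf : ∀ q < nS N, f q < nS N) : trans N f < nT N := by
  rw [trans, tab_eq (fun q => ⟨f q, hf q q.2⟩) fun _ => rfl]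
  exact Fin.is_lt _

theorem comp_lt (N s t : ℕ) : comp N s t < nT N :=
  trans_lt fun q hq => app_lt (by omega) _ _

theorem one_lt (N : ℕ) : one N < nT N := trans_lt fun _ => id

theorem power_lt (N t : ℕ) : ∀ k, power N t k < nT N
  | 0 => one_lt N
  | k + 1 => by
    rw [power, Function.iterate_succ_apply']
    exact comp_lt _ _ _

section

variable {bd : Prop} {α : Type} [Ctx α] [Ctx.Full α] {N : α → ℕ}

@[fun_prop]
theorem lim_nS {β : Type} [Ctx β] {N : β → ℕ} (hN : Lim bd N) : Lim bd (fun a => nS (N a)) :=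
  lim_run hN

@[fun_prop]
theorem lim_nA (hN : Lim bd N) : Lim bd (fun a => nA (N a)) := lim_run (lim_rest hN)

@[fun_prop]
theorem lim_delta {q b : α → ℕ} (hN : Lim bd N) (hq : Lim bd q) (hb : Lim bd b) :
    Lim bd (fun a => delta (N a) (q a) (b a)) := by
  unfold delta
  fun_prop

@[fun_prop]
theorem lim_leq {p q : α → ℕ} (hN : Lim bd N) (hp : Lim bd p) (hq : Lim bd q) :
    Lim bd (fun a => leq (N a) (p a) (q a)) := by
  unfold leq
  fun_prop

theorem polyBdd_nS {β : Type} [Ctx β] {N : β → ℕ} (hN : Lim bd N) (h : bd) :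
    PolyBdd (fun a => nS (N a)) :=
  (hN.expBdd h).size.mono fun _ => run_le_size _

@[fun_prop]
theorem lim_nT (hN : Lim bd N) : Lim bd (fun a => nT (N a)) := by
  unfold nT
  refine .pow (by fun_prop) (by fun_prop) fun h => ⟨_, ((show Lim bd (fun a => nS (N a) + 1)
    by fun_prop).expBdd h).pow (polyBdd_nS hN h), fun a i hi => ?_⟩
  exact (Nat.pow_le_pow_left (Nat.le_succ _) i).trans (Nat.pow_le_pow_right (by omega) hi)

@[fun_prop]
theorem lim_trans {f : α → ℕ → ℕ} (hN : Lim bd N) (hf : Lim bd (fun p : ℕ × α => f p.2 p.1)) :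
    Lim bd (fun a => trans (N a) (f a)) :=
  .tab (lim_nS hN) hf (polyBdd_nS hN)

@[fun_prop]
theorem lim_app {t q : α → ℕ} (hN : Lim bd N) (ht : Lim bd t) (hq : Lim bd q) :
    Lim bd (fun a => app (N a) (t a) (q a)) := by
  unfold app
  fun_prop

@[fun_prop]
theorem lim_one (hN : Lim bd N) : Lim bd (fun a => one (N a)) := by
  unfold one
  fun_prop

@[fun_prop]
theorem lim_letter {b : α → ℕ} (hN : Lim bd N) (hb : Lim bd b) :
    Lim bd (fun a => letter (N a) (b a)) := by
  unfold letter
  fun_prop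

@[fun_prop]
theorem lim_comp {s t : α → ℕ} (hN : Lim bd N) (hs : Lim bd s) (ht : Lim bd t) :
    Lim bd (fun a => comp (N a) (s a) (t a)) := by
  unfold comp
  fun_prop

@[fun_prop]
theorem lim_power {t k : α → ℕ} (hN : Lim bd N) (ht : Lim bd t) (hk : Lim bd k) :
    Lim bd (fun a => power (N a) (t a) (k a)) := by
  unfold power
  exact .iterate (h := fun a r => comp (N a) r (t a)) hk (by fun_prop) (by fun_prop) fun h =>
    ⟨_, (lim_nT hN).expBdd h, fun a i _ => (power_lt _ _ _).le⟩

@[fun_prop]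
theorem lim_omegaPower {t : α → ℕ} (hN : Lim bd N) (ht : Lim bd t) :
    Lim bd (fun a => omegaPower (N a) (t a)) := by
  classical
  unfold omegaPower
  exact .sum (by fun_prop) (.ite (by fun_prop) (by fun_prop) (by fun_prop))

@[fun_prop]
theorem lim_inMonoid {t : α → ℕ} (hN : Lim bd N) (ht : Lim bd t) :
    Lim bd (fun a => InMonoid (N a) (t a)) := by
  unfold InMonoid
  exact .squared (E := fun a s t => s = t ∨ ∃ b < nA (N a), t = comp (N a) s (letter (N a) b))
    (by fun_prop) (by fun_prop) (by fun_prop) (by fun_prop) (by fun_prop)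
    (fun a => Nat.mod_lt _ (nT_pos _)) (fun a => Nat.mod_lt _ (nT_pos _))
    fun h => (polyBdd_nS hN h).mul (polyBdd_nS hN h)

@[fun_prop]
theorem lim_value {e : α → ℕ} (hN : Lim bd N) (he : Lim bd e) (u : OmegaTerm) :
    Lim bd (fun a => value (N a) (e a) u) := by
  induction u with
  | var x => simp only [value]; fun_prop
  | mul s t ihs iht => simp only [value]; fun_prop
  | omega t ih => simp only [value]; fun_prop

end

end Codes

/-! ### The code of a semiautomaton -/

theorem run_unaryCode_append (k : ℕ) (l : List Bool) :
    run (unaryCode k ++ l).toMarkedNat = k := by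
  induction k with
  | zero => exact run_bit_false _
  | succ k ih => exact (run_bit_true _).trans (congrArg (· + 1) ih)

theorem rest_unaryCode_append (k : ℕ) (l : List Bool) :
    rest (unaryCode k ++ l).toMarkedNat = l.toMarkedNat := by
  induction k with
  | zero => exact rest_bit_false _
  | succ k ih => exact (rest_bit_true _).trans ih

theorem iterate_rest (R : List Bool) : ∀ (j : ℕ) (L : List ℕ), j ≤ L.length →
    rest^[j] (L.flatMap unaryCode ++ R).toMarkedNat =
      ((L.drop j).flatMap unaryCode ++ R).toMarkedNat
  | 0, _, _ => rfl
  | j + 1, [], h => by simp at h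
  | j + 1, k :: L, h => by
    rw [Function.iterate_succ_apply, List.flatMap_cons, List.append_assoc, rest_unaryCode_append]
    exact iterate_rest R j L (by simpa using h)

theorem run_iterate_rest (R : List Bool) (L : List ℕ) (j : ℕ) (h : j < L.length) :
    run (rest^[j] (L.flatMap unaryCode ++ R).toMarkedNat) = L[j] := by
  rw [iterate_rest R j L h.le, List.drop_eq_getElem_cons h, List.flatMap_cons, List.append_assoc,
    run_unaryCode_append]

theorem toMarkedNat_div_mod : ∀ (l : List Bool) (i : ℕ) (h : i < l.length),
    l.toMarkedNat / 2 ^ i % 2 = 1 ↔ l[i] = true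
  | b :: l, 0, _ => by
    change Nat.bit b l.toMarkedNat / 2 ^ 0 % 2 = 1 ↔ b = true
    cases b <;> simp [Nat.bit_val]
  | b :: l, i + 1, h => by
    have h2 : Nat.bit b l.toMarkedNat / 2 = l.toMarkedNat := by
      cases b
      · simp [Nat.bit_val]
      · simp only [Nat.bit_val, Bool.toNat_true]; omega
    have hi : i < l.length := by simpa using h
    change Nat.bit b l.toMarkedNat / 2 ^ (i + 1) % 2 = 1 ↔ l[i] = true
    rw [pow_succ', ← Nat.div_div_eq_div_mul, h2]
    exact toMarkedNat_div_mod l i hi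

theorem Fin.divNat_mul_add {n m : ℕ} (q : Fin n) (a : Fin m) (h : (q : ℕ) * m + a < n * m) :
    Fin.divNat (⟨q * m + a, h⟩ : Fin (n * m)) = q := by
  have hm : 0 < m := a.pos
  ext
  simp [Fin.divNat, Nat.add_div_of_dvd_right, Nat.mul_div_cancel _ hm, Nat.div_eq_of_lt a.2]

theorem Fin.modNat_mul_add {n m : ℕ} (q : Fin n) (a : Fin m) (h : (q : ℕ) * m + a < n * m) :
    Fin.modNat (⟨q * m + a, h⟩ : Fin (n * m)) = a := by
  ext
  simp [Fin.modNat, Nat.mod_eq_of_lt a.2]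

theorem flatMap_finRange_map {β : Type*} (n m : ℕ) (f : Fin n → Fin m → β) :
    ((List.finRange n).flatMap fun q => (List.finRange m).map (f q)) =
      List.ofFn fun i : Fin (n * m) => f i.divNat i.modNat := by
  rw [List.ofFn_mul, List.flatMap_def, List.ofFn_eq_map]
  congr 1
  refine List.map_congr_left fun q _ => ?_
  rw [List.ofFn_eq_map]
  refine List.map_congr_left fun a _ => ?_
  rw [Fin.divNat_mul_add, Fin.modNat_mul_add]

namespace InputSemiautomaton

open Codes

variable (I : InputSemiautomaton)

/-- The code of a semiautomaton as a number. -/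
noncomputable def num : ℕ := I.code.toMarkedNat

/-- The list of all numbers in the description of a semiautomaton. -/
def entries : List ℕ :=
  I.numStates :: I.numLetters ::
    (List.finRange I.numStates).flatMap fun q => (List.finRange I.numLetters).map fun a =>
      (I.aut.step q a : ℕ)

open Classical in
/-- The list of the truth values in the description of a semiautomaton. -/
noncomputable def leEntries : List Bool :=
  (List.finRange I.numStates).flatMap fun p =>
    (List.finRange I.numStates).map fun q => decide (I.aut.le p q)

theorem code_eq : I.code = I.entries.flatMap unaryCode ++ I.leEntries := by
  simp only [code, entries, leEntries, List.flatMap_cons, List.flatMap_assoc, List.flatMap_map,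
    List.append_assoc]

theorem length_entries : I.entries.length = 2 + I.numStates * I.numLetters := by
  simp only [entries, flatMap_finRange_map, List.length_cons, List.length_ofFn]
  ring

theorem nS_num : nS I.num = I.numStates := by
  rw [num, code_eq]
  exact run_iterate_rest _ I.entries 0 (by rw [length_entries]; omega)

theorem nA_num : nA I.num = I.numLetters := by
  rw [num, code_eq]
  exact run_iterate_rest _ I.entries 1 (by rw [length_entries]; omega)

theorem mul_add_lt {n m : ℕ} (q : Fin n) (a : Fin m) : (q : ℕ) * m + a < n * m := by
  have : ((q : ℕ) + 1) * m ≤ n * m := Nat.mul_le_mul_right _ q.2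
  have := a.2
  rw [add_mul] at *
  omega

theorem delta_num (q : Fin I.numStates) (a : Fin I.numLetters) :
    delta I.num q a = I.aut.step q a := by
  have hlt := mul_add_lt q a
  rw [delta, nA_num, num, code_eq, run_iterate_rest _ I.entries _ (by rw [length_entries]; omega)]
  simp only [entries, flatMap_finRange_map]
  simp only [add_comm 2, List.getElem_cons_succ, List.getElem_ofFn]
  rw [Fin.divNat_mul_add, Fin.modNat_mul_add]

theorem leq_num (p q : Fin I.numStates) : leq I.num p q ↔ I.aut.le p q := by
  classical
  have hlt := mul_add_lt p q
  rw [leq, nA_num, nS_num, num, code_eq, iterate_rest _ _ I.entries (by rw [length_entries]),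
    List.drop_eq_nil_of_le (by rw [length_entries]), List.flatMap_nil, List.nil_append]
  have hlen : I.leEntries.length = I.numStates * I.numStates := by
    rw [leEntries, flatMap_finRange_map, List.length_ofFn]
  rw [toMarkedNat_div_mod _ _ (by omega)]
  simp only [leEntries, flatMap_finRange_map, List.getElem_ofFn, decide_eq_true_eq]
  rw [Fin.divNat_mul_add, Fin.modNat_mul_add]

end InputSemiautomaton

/-! ### Transformations and their numbers -/

namespace InputSemiautomaton

open Codes

variable (I : InputSemiautomaton)

/-- The transformations of the set of states. -/
abbrev Trf : Type := Fin I.numStates → Fin I.numStates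

/-- The words over the alphabet. -/
abbrev Word : Type := FreeMonoid (Fin I.numLetters)

/-- The transformation that is given by a word. -/
def trf (w : I.Word) : I.Trf := fun q => I.aut.act q w

/-- The number that represents a transformation. -/
def cod (g : I.Trf) : ℕ := finFunctionFinEquiv g

theorem trf_mul (w w' : I.Word) : I.trf (w * w') = I.trf w' ∘ I.trf w :=
  funext fun q => I.aut.act_mul q w w'

theorem trf_pow (w : I.Word) (k : ℕ) : I.trf (w ^ k) = (I.trf w)^[k] := by
  induction k with
  | zero => rfl
  | succ k ih => rw [pow_succ, trf_mul, ih, Function.iterate_succ']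

variable {I}

theorem cod_injective : Function.Injective I.cod :=
  Fin.val_injective.comp finFunctionFinEquiv.injective

theorem nT_num : nT I.num = I.numStates ^ I.numStates := by
  rw [nT, nS_num]

theorem cod_lt (g : I.Trf) : I.cod g < nT I.num := by
  rw [nT_num]
  exact Fin.is_lt _

theorem exists_cod {t : ℕ} (h : t < nT I.num) : ∃ g, I.cod g = t := by
  rw [nT_num] at h
  exact ⟨finFunctionFinEquiv.symm ⟨t, h⟩, by simp [cod]⟩

theorem app_cod (g : I.Trf) (q : Fin I.numStates) : app I.num (I.cod g) q = g q := by
  rw [app, nS_num]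
  exact dig_finFunctionFinEquiv g q

theorem trans_num {f : ℕ → ℕ} (g : I.Trf) (h : ∀ q : Fin I.numStates, f q = g q) :
    Codes.trans I.num f = I.cod g := by
  rw [Codes.trans, nS_num]
  exact tab_eq g h

theorem one_num : one I.num = I.cod (I.trf 1) := trans_num _ fun _ => rfl

theorem letter_num (a : Fin I.numLetters) : letter I.num a = I.cod (I.trf (FreeMonoid.of a)) :=
  trans_num _ fun q => I.delta_num q a

theorem comp_num (g h : I.Trf) : comp I.num (I.cod g) (I.cod h) = I.cod (h ∘ g) :=
  trans_num _ fun q => by rw [app_cod, app_cod]; rfl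

theorem power_num (g : I.Trf) (k : ℕ) : power I.num (I.cod g) k = I.cod g^[k] := by
  induction k with
  | zero => exact one_num
  | succ k ih =>
    rw [power, Function.iterate_succ_apply', ← power, ih, comp_num, Function.iterate_succ']

theorem card_trf : Fintype.card I.Trf = nT I.num := by
  simp [nT_num]

/-- The number for the idempotent power of a transformation. -/
theorem omegaPower_num (g : I.Trf) {k : ℕ} (hk : 0 < k) (h : g^[k] ∘ g^[k] = g^[k]) :
    omegaPower I.num (I.cod g) = I.cod g^[k] := by
  have hiter : ∀ (j : ℕ) (e : I.Trf), e ∘ e = e → e^[j + 1] = e := by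
    intro j e he
    induction j with
    | zero => rfl
    | succ j ih => rw [Function.iterate_succ, ih, he]
  have hmul : ∀ i, (fun r => g ∘ r)^[i] g = g^[i + 1] := by
    intro i
    induction i with
    | zero => rfl
    | succ i ih => rw [Function.iterate_succ_apply', ih, ← Function.iterate_succ']
  rw [omegaPower, Finset.sum_eq_single (I.cod g^[k]), if_pos]
  · refine ⟨by rw [comp_num, h], ?_⟩
    obtain ⟨j, hj, hj'⟩ := exists_iterate_lt_card (fun r : I.Trf => g ∘ r) g Finset.univ
      (fun _ => Finset.mem_univ _) (k - 1)
    refine ⟨j, by rwa [Finset.card_univ, card_trf] at hj, ?_⟩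
    rw [hmul, hmul, Nat.sub_add_cancel hk] at hj'
    rw [power_num, hj']
  · intro r _ hr
    refine if_neg ?_
    rintro ⟨h1, i, _, rfl⟩
    rw [power_num, comp_num] at h1
    refine hr ?_
    rw [power_num]
    -- both are equal to a common power
    have h2 := hiter (k - 1) _ (cod_injective h1)
    have h3 := hiter i _ h
    rw [Nat.sub_add_cancel hk, ← Function.iterate_mul, mul_comm, Function.iterate_mul, h3] at h2
    rw [h2]
  · intro h
    exact absurd (Finset.mem_range.2 (cod_lt _)) h

/-- A word can be replaced by a shorter one than there are transformations. -/
theorem exists_short_word (w : I.Word) :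
    ∃ w', w'.length < nT I.num ∧ I.trf w' = I.trf w := by
  induction h : w.length using Nat.strong_induction_on generalizing w with
  | _ l ih =>
    rcases lt_or_ge l (nT I.num) with hl | hl
    · exact ⟨w, by omega, rfl⟩
    · let pre : ℕ → I.Word := fun i => FreeMonoid.ofList (w.toList.take i)
      let suf : ℕ → I.Word := fun i => FreeMonoid.ofList (w.toList.drop i)
      have hsplit : ∀ i, pre i * suf i = w := fun i => List.take_append_drop i w.toList
      obtain ⟨i, hi, j, hj, hij, he⟩ := Finset.exists_ne_map_eq_of_card_lt_of_maps_to
        (s := Finset.range (l + 1)) (t := (Finset.univ : Finset I.Trf))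
        (by rw [Finset.card_univ, card_trf, Finset.card_range]; omega)
        (f := fun i => I.trf (pre i)) (fun i _ => Finset.mem_univ _)
      have key : ∀ i j, i < j → j < l + 1 → I.trf (pre i) = I.trf (pre j) →
          ∃ w', w'.length < nT I.num ∧ I.trf w' = I.trf w := by
        intro i j hij hj he
        have hw : w.toList.length = l := h
        obtain ⟨w', h1, h2⟩ := ih (pre i * suf j).length (by
          change (w.toList.take i ++ w.toList.drop j).length < l
          rw [List.length_append, List.length_take, List.length_drop, hw]
          omega) (pre i * suf j) rfl
        refine ⟨w', h1, h2.trans ?_⟩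
        rw [trf_mul, he, ← trf_mul, hsplit]
      rcases lt_or_gt_of_ne hij with hlt | hlt
      · exact key i j hlt (Finset.mem_range.1 hj) he
      · exact key j i hlt (Finset.mem_range.1 hi) he.symm

theorem squared_num (k : ℕ) (g h : I.Trf) :
    squared (fun s t => s = t ∨ ∃ a < nA I.num, t = comp I.num s (letter I.num a)) (nT I.num) k
      (I.cod g) (I.cod h) ↔ ∃ w : I.Word, w.length ≤ 2 ^ k ∧ h = I.trf w ∘ g := by
  induction k generalizing g h with
  | zero =>
    rw [squared, nA_num]
    constructor
    · rintro (h' | ⟨a, ha, h'⟩)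
      · exact ⟨1, by simp, (cod_injective h').symm⟩
      · have := letter_num (I := I) ⟨a, ha⟩
        simp only at this
        rw [this, comp_num] at h'
        exact ⟨FreeMonoid.of ⟨a, ha⟩, by simp, cod_injective h'⟩
    · rintro ⟨w, hw, rfl⟩
      rw [pow_zero] at hw
      rcases Nat.le_one_iff_eq_zero_or_eq_one.1 hw with hw | hw
      · obtain rfl := FreeMonoid.length_eq_zero.1 hw
        exact .inl rfl
      · obtain ⟨a, rfl⟩ := FreeMonoid.length_eq_one.1 hw
        exact .inr ⟨a, a.2, by rw [letter_num, comp_num]⟩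
  | succ k ih =>
    rw [squared]
    constructor
    · rintro ⟨r, hr, h1, h2⟩
      obtain ⟨f, rfl⟩ := exists_cod hr
      obtain ⟨w, hw, rfl⟩ := (ih _ _).1 h1
      obtain ⟨w', hw', rfl⟩ := (ih _ _).1 h2
      refine ⟨w * w', ?_, by rw [trf_mul]; rfl⟩
      rw [FreeMonoid.length_mul, pow_succ]
      omega
    · rintro ⟨w, hw, rfl⟩
      have hw' : w.toList.length ≤ 2 ^ k * 2 := by rw [← pow_succ]; exact hw
      have hsplit : FreeMonoid.ofList (w.toList.take (2 ^ k)) *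
        FreeMonoid.ofList (w.toList.drop (2 ^ k)) = w := List.take_append_drop _ w.toList
      refine ⟨I.cod (I.trf (FreeMonoid.ofList (w.toList.take (2 ^ k))) ∘ g), cod_lt _,
        (ih _ _).2 ⟨_, ?_, rfl⟩, (ih _ _).2 ⟨FreeMonoid.ofList (w.toList.drop (2 ^ k)), ?_, ?_⟩⟩
      · change (w.toList.take (2 ^ k)).length ≤ 2 ^ k
        rw [List.length_take]
        omega
      · change (w.toList.drop (2 ^ k)).length ≤ 2 ^ k
        rw [List.length_drop]
        omega
      · conv_lhs => rw [← hsplit, trf_mul]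
        rfl

theorem inMonoid_num (g : I.Trf) : InMonoid I.num (I.cod g) ↔ ∃ w : I.Word, I.trf w = g := by
  rw [InMonoid, Nat.mod_eq_of_lt (cod_lt g), Nat.mod_eq_of_lt (one_lt _), one_num, squared_num]
  constructor
  · rintro ⟨w, -, rfl⟩
    exact ⟨w, rfl⟩
  · rintro ⟨w, rfl⟩
    obtain ⟨w', h1, h2⟩ := exists_short_word w
    refine ⟨w', h1.le.trans ?_, h2.symm⟩
    rw [nT, pow_mul]
    exact Nat.pow_le_pow_left Nat.lt_two_pow_self.le _

/-- The value of a term is the transformation given by the word for the term. -/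
theorem value_num {X : Finset ℕ} {e : ℕ} {f : FreeMonoid X →* I.Word}
    (he : ∀ x : X, dig (nT I.num) e x = I.cod (I.trf (f (FreeMonoid.of x)))) {n : ℕ}
    (hn : I.aut.IsOmegaExponent n) (t : OmegaTerm) (ht : t.vars ⊆ X) :
    value I.num e t = I.cod (I.trf (f (t.word n ht))) := by
  induction t with
  | var x => exact he ⟨x, _⟩
  | mul s t ihs iht =>
    rw [value, ihs (Finset.union_subset_left ht), iht (Finset.union_subset_right ht), comp_num,
      ← trf_mul, ← map_mul]
    rfl
  | omega t ih =>
    have hidem : (I.trf (f (t.word n ht)))^[n] ∘ (I.trf (f (t.word n ht)))^[n] =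
        (I.trf (f (t.word n ht)))^[n] := by
      rw [← trf_pow, ← trf_mul]
      exact funext fun q => hn.2 _ q
    rw [value, ih ht, omegaPower_num _ hn.1 hidem, ← trf_pow, ← map_pow]
    rfl

/-- The inequality can be tested on the transformations for the variables. -/
theorem holds_iff (C : HomCategory) (u v : OmegaTerm) {B : ℕ}
    (hB : ∀ f : FreeMonoid (u.vars ∪ v.vars : Finset ℕ) →* I.Word, C.Mem f →
      ∃ e < B, ∀ x : (u.vars ∪ v.vars : Finset ℕ),
        dig (nT I.num) e x = I.cod (I.trf (f (FreeMonoid.of x)))) :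
    I.aut.Holds C u v ↔ ∀ e < B, (∃ f : FreeMonoid (u.vars ∪ v.vars : Finset ℕ) →* I.Word,
      C.Mem f ∧ ∀ x : (u.vars ∪ v.vars : Finset ℕ),
        dig (nT I.num) e x = I.cod (I.trf (f (FreeMonoid.of x)))) →
      ∀ p < nS I.num, leq I.num (app I.num (value I.num e u) p)
        (app I.num (value I.num e v) p) := by
  constructor
  · rintro h e _ ⟨f, hf, hfe⟩ p hp
    obtain ⟨n, hn⟩ := I.aut.exists_isOmegaExponent
    rw [nS_num] at hp
    have h1 := app_cod (I := I) (I.trf (f (u.word n Finset.subset_union_left))) ⟨p, hp⟩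
    have h2 := app_cod (I := I) (I.trf (f (v.word n Finset.subset_union_right))) ⟨p, hp⟩
    rw [value_num hfe hn u Finset.subset_union_left, value_num hfe hn v Finset.subset_union_right]
    simp only at h1 h2
    rw [h1, h2, leq_num]
    exact h n hn f hf ⟨p, hp⟩
  · intro h n hn f hf p
    obtain ⟨e, heB, he⟩ := hB f hf
    have := h e heB ⟨f, hf, he⟩ p (by rw [nS_num]; exact p.2)
    rwa [value_num he hn u Finset.subset_union_left, value_num he hn v Finset.subset_union_right,
      app_cod, app_cod, leq_num] at this

end InputSemiautomaton

/-! ### The morphisms of the four categories -/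

namespace Codes

/-- The set of all transformations given by words of length `k`, as a bit mask. -/
noncomputable def layer (N : ℕ) : ℕ → ℕ
  | 0 => 2 ^ one N
  | k + 1 => open Classical in tab 2 (nT N) fun t => if ∃ s < nT N, dig 2 (layer N k) s = 1 ∧
      ∃ a < nA N, t = comp N s (letter N a) then 1 else 0

/-- The transformations that are the digits of `e` in base `nT N` with numbers from the list `X`
are given by the images of the variables `X` under some morphism of the category. In the case of
surjective morphisms, the digits of `r` tell which variables are mapped to which letters. -/
def Valid (X : List ℕ) (V N e : ℕ) : HomCategory → Prop
  | .ne => ∀ x ∈ X, ∃ a < nA N, ∃ t < nT N, InMonoid N t ∧ dig (nT N) e x = comp N (letter N a) t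
  | .l => ∀ x ∈ X, ∃ a < nA N, dig (nT N) e x = letter N a
  | .s => ∃ r < (nA N + 1) ^ V,
      (∀ x ∈ X, InMonoid N (dig (nT N) e x) ∧
        (dig (nA N + 1) r x ≠ 0 → dig (nT N) e x = letter N (dig (nA N + 1) r x - 1))) ∧
      ∀ a < nA N, ∃ x ∈ X, dig (nA N + 1) r x = a + 1
  | .lm => ∃ k < 2 ^ nT N, ∀ x ∈ X, dig 2 (layer N (k + 1)) (dig (nT N) e x) = 1

end Codes

theorem dig_tab {n k : ℕ} {f : ℕ → ℕ} (hf : ∀ i < k, f i < n) {i : ℕ} (hi : i < k) :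
    dig n (tab n k f) i = f i := by
  rw [tab_eq (fun j : Fin k => ⟨f j, hf j j.2⟩) fun _ => rfl]
  exact dig_finFunctionFinEquiv _ ⟨i, hi⟩

theorem tab_lt {n k : ℕ} {f : ℕ → ℕ} (hf : ∀ i < k, f i < n) : tab n k f < n ^ k := by
  rw [tab_eq (fun j : Fin k => ⟨f j, hf j j.2⟩) fun _ => rfl]
  exact Fin.is_lt _

/-- Numbers with prescribed digits at the places from a finite set. -/
theorem exists_dig_eq {X : Finset ℕ} {n V : ℕ} (hn : 0 < n) (hV : ∀ x ∈ X, x < V) (f : X → ℕ)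
    (hf : ∀ x, f x < n) : ∃ e < n ^ V, ∀ x : X, dig n e x = f x := by
  classical
  have h : ∀ i < V, (fun i => if h : i ∈ X then f ⟨i, h⟩ else 0) i < n := by
    intro i _
    dsimp only
    split_ifs
    · exact hf _
    · exact hn
  refine ⟨tab n V _, tab_lt h, fun x => ?_⟩
  rw [dig_tab h (hV x x.2)]
  simp

namespace FreeMonoid

variable {X A : Type}

theorem left_eq_one_of_mul_eq_one {w w' : FreeMonoid A} (h : w * w' = 1) : w = 1 := by
  have := congrArg length h
  rw [length_mul, length_one] at this
  exact length_eq_zero.1 (by omega)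

theorem exists_eq_mul_of {w : FreeMonoid A} {k : ℕ} (hw : w.length = k + 1) :
    ∃ w' a, w'.length = k ∧ w = w' * of a := by
  have hw' : w.toList ≠ [] := fun h => by
    have : w.toList.length = k + 1 := hw
    rw [h] at this
    simp at this
  refine ⟨ofList w.toList.dropLast, w.toList.getLast hw', ?_,
    (List.dropLast_append_getLast hw').symm⟩
  change w.toList.dropLast.length = k
  rw [List.length_dropLast]
  exact (congrArg (· - 1) hw).trans (Nat.add_sub_cancel k 1)

theorem preimage_one_iff (f : FreeMonoid X →* FreeMonoid A) :
    f ⁻¹' {1} = {1} ↔ ∀ x, f (of x) ≠ 1 := by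
  constructor
  · intro h x hx
    have : of x ∈ f ⁻¹' {1} := hx
    rw [h] at this
    exact of_ne_one x this
  · intro h
    ext w
    refine ⟨fun hw => ?_, fun hw => ?_⟩
    · induction w using FreeMonoid.casesOn with
      | one => rfl
      | of_mul x w =>
        have hw : f (of x * w) = 1 := hw
        rw [map_mul] at hw
        exact absurd (FreeMonoid.left_eq_one_of_mul_eq_one hw) (h x)
    · obtain rfl : w = 1 := hw
      exact map_one f

theorem surjective_iff (f : FreeMonoid X →* FreeMonoid A) :
    Function.Surjective f ↔ ∀ a, ∃ x, f (of x) = of a := by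
  constructor
  · intro h a
    obtain ⟨w, hw⟩ := h (of a)
    induction w using FreeMonoid.inductionOn' with
    | one => exact absurd ((map_one f).symm.trans hw).symm (of_ne_one a)
    | of_mul x w ih =>
      rw [map_mul] at hw
      have hlen := congrArg length hw
      rw [length_mul, length_of] at hlen
      rcases Nat.eq_zero_or_pos (f (of x)).length with h0 | h0
      · rw [length_eq_zero.1 h0, one_mul] at hw
        exact ih hw
      · rw [length_eq_zero.1 (show (f w).length = 0 by omega), mul_one] at hw
        exact ⟨x, hw⟩
  · intro h w
    induction w using FreeMonoid.inductionOn' with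
    | one => exact ⟨1, map_one f⟩
    | of_mul a w ih =>
      obtain ⟨x, hx⟩ := h a
      obtain ⟨w', hw'⟩ := ih
      exact ⟨of x * w', by rw [map_mul, hx, hw']⟩

end FreeMonoid

namespace InputSemiautomaton

open Codes

variable {I : InputSemiautomaton}

theorem layer_num (k : ℕ) (g : I.Trf) :
    dig 2 (layer I.num k) (I.cod g) = 1 ↔ ∃ w : I.Word, w.length = k ∧ I.trf w = g := by
  induction k generalizing g with
  | zero =>
    have : dig 2 (layer I.num 0) (I.cod g) = 1 ↔ I.cod g = one I.num := by
      rw [layer, dig]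
      rcases lt_trichotomy (I.cod g) (one I.num) with h | h | h
      · have : 2 ^ one I.num / 2 ^ I.cod g = 2 * 2 ^ (one I.num - I.cod g - 1) := by
          rw [Nat.pow_div h.le (by norm_num), ← pow_succ']
          congr 1
          omega
        rw [this]
        simp [h.ne]
      · simp [h]
      · rw [Nat.div_eq_of_lt (Nat.pow_lt_pow_right (by norm_num) h)]
        simp [h.ne']
    rw [this, one_num, cod_injective.eq_iff]
    constructor
    · rintro rfl
      exact ⟨1, rfl, rfl⟩
    · rintro ⟨w, hw, rfl⟩
      rw [FreeMonoid.length_eq_zero.1 hw]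
  | succ k ih =>
    rw [layer, dig_tab (fun i _ => by split_ifs <;> norm_num) (cod_lt g)]
    simp only [ite_eq_left_iff, zero_ne_one, imp_false, not_not, nA_num]
    constructor
    · rintro ⟨s, hs, h1, a, ha, h2⟩
      obtain ⟨h, rfl⟩ := exists_cod hs
      obtain ⟨w, hw, rfl⟩ := (ih h).1 h1
      have := letter_num (I := I) ⟨a, ha⟩
      simp only at this
      rw [this, comp_num] at h2
      refine ⟨w * FreeMonoid.of ⟨a, ha⟩, ?_, ?_⟩
      · rw [FreeMonoid.length_mul, hw, FreeMonoid.length_of]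
      · rw [trf_mul, cod_injective h2]
    · rintro ⟨w, hw, rfl⟩
      obtain ⟨w, a, hw', rfl⟩ := FreeMonoid.exists_eq_mul_of hw
      exact ⟨I.cod (I.trf w), cod_lt _, (ih _).2 ⟨w, hw', rfl⟩, a, a.2,
        by rw [letter_num, comp_num, ← trf_mul]⟩

/-- The sets of transformations given by the words of a fixed length all occur for small lengths. -/
theorem exists_layer_eq (k : ℕ) : ∃ j < 2 ^ nT I.num, ∀ g : I.Trf,
    (∃ w : I.Word, w.length = j + 1 ∧ I.trf w = g) ↔
      ∃ w : I.Word, w.length = k + 1 ∧ I.trf w = g := by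
  let F : Set I.Trf → Set I.Trf := fun S =>
    {g | ∃ h ∈ S, ∃ a, g = I.trf (FreeMonoid.of a) ∘ h}
  let S : ℕ → Set I.Trf := fun k => {g | ∃ w : I.Word, w.length = k ∧ I.trf w = g}
  have hS : ∀ k, S (k + 1) = F (S k) := by
    intro k
    ext g
    constructor
    · rintro ⟨w, hw, rfl⟩
      obtain ⟨w, a, hw', rfl⟩ := FreeMonoid.exists_eq_mul_of hw
      exact ⟨_, ⟨w, hw', rfl⟩, a, trf_mul _ _ _⟩
    · rintro ⟨_, ⟨w, hw, rfl⟩, a, rfl⟩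
      exact ⟨w * FreeMonoid.of a, by rw [FreeMonoid.length_mul, hw, FreeMonoid.length_of],
        trf_mul _ _ _⟩
  have hiter : ∀ k, F^[k] (S 1) = S (k + 1) := by
    intro k
    induction k with
    | zero => rfl
    | succ k ih => rw [Function.iterate_succ_apply', ih, hS (k + 1)]
  obtain ⟨j, hj, h⟩ := exists_iterate_lt_card F (S 1) Finset.univ (fun _ => Finset.mem_univ _) k
  rw [hiter, hiter] at h
  refine ⟨j, ?_, fun g => Set.ext_iff.1 h g⟩
  rwa [Finset.card_univ, Fintype.card_set, card_trf] at hj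

/-- The condition `Valid` describes the morphisms. -/
theorem valid_iff (C : HomCategory) {X : Finset ℕ} {L : List ℕ} (hL : ∀ x, x ∈ L ↔ x ∈ X) {V : ℕ}
    (hV : ∀ x ∈ X, x < V) (e : ℕ) : Valid L V I.num e C ↔ ∃ f : FreeMonoid X →* I.Word,
      C.Mem f ∧ ∀ x : X, dig (nT I.num) e x = I.cod (I.trf (f (FreeMonoid.of x))) := by
  have hdig : ∀ x, ∃ g, I.cod g = dig (nT I.num) e x := fun x =>
    exists_cod (Nat.mod_lt _ (nT_pos _))
  have hletter : ∀ (a : ℕ) (ha : a < I.numLetters),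
      letter I.num a = I.cod (I.trf (FreeMonoid.of ⟨a, ha⟩)) := fun a ha => letter_num ⟨a, ha⟩
  cases C with
  | ne =>
    simp only [Valid, hL, nA_num, HomCategory.Mem, FreeMonoid.preimage_one_iff]
    constructor
    · intro h
      have h' : ∀ x : X, ∃ w : I.Word, w ≠ 1 ∧ dig (nT I.num) e x = I.cod (I.trf w) := by
        intro x
        obtain ⟨a, ha, t, ht, h1, h2⟩ := h x x.2
        obtain ⟨g, rfl⟩ := exists_cod ht
        obtain ⟨w, rfl⟩ := (inMonoid_num g).1 h1
        refine ⟨FreeMonoid.of ⟨a, ha⟩ * w, fun h => ?_, ?_⟩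
        · exact FreeMonoid.of_ne_one _ (FreeMonoid.left_eq_one_of_mul_eq_one h)
        · rw [h2, hletter a ha, comp_num, trf_mul]
      choose w hw using h'
      exact ⟨FreeMonoid.lift w, fun x => by simpa using (hw x).1, fun x => by simpa using (hw x).2⟩
    · rintro ⟨f, hf, he⟩ x hx
      have h1 := he ⟨x, hx⟩
      have h2 := hf ⟨x, hx⟩
      generalize f (FreeMonoid.of ⟨x, hx⟩) = w at h1 h2
      induction w using FreeMonoid.casesOn with
      | one => exact absurd rfl h2
      | of_mul a w =>
        refine ⟨a, a.2, I.cod (I.trf w), cod_lt _, (inMonoid_num _).2 ⟨w, rfl⟩, ?_⟩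
        rw [h1, letter_num, comp_num, trf_mul]
  | l =>
    simp only [Valid, hL, nA_num, HomCategory.Mem]
    constructor
    · intro h
      have h' : ∀ x : X, ∃ a : Fin I.numLetters,
          dig (nT I.num) e x = I.cod (I.trf (FreeMonoid.of a)) := by
        intro x
        obtain ⟨a, ha, h1⟩ := h x x.2
        exact ⟨⟨a, ha⟩, h1.trans (hletter a ha)⟩
      choose a ha using h'
      exact ⟨FreeMonoid.lift fun x => FreeMonoid.of (a x), fun x => ⟨a x, by simp⟩,
        fun x => by simpa using ha x⟩
    · rintro ⟨f, hf, he⟩ x hx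
      obtain ⟨a, ha⟩ := hf ⟨x, hx⟩
      exact ⟨a, a.2, by rw [letter_num, ← ha]; exact he ⟨x, hx⟩⟩
  | s =>
    simp only [Valid, hL, nA_num, HomCategory.Mem, FreeMonoid.surjective_iff]
    constructor
    · rintro ⟨r, -, h1, h2⟩
      have h' : ∀ x : X, ∃ w : I.Word, dig (nT I.num) e x = I.cod (I.trf w) ∧
          ∀ a : Fin I.numLetters, dig (I.numLetters + 1) r x = a + 1 → w = FreeMonoid.of a := by
        intro x
        obtain ⟨h3, h4⟩ := h1 x x.2
        rcases Nat.eq_zero_or_pos (dig (I.numLetters + 1) r x) with h0 | h0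
        · obtain ⟨g, hg⟩ := hdig x
          rw [← hg] at h3 ⊢
          obtain ⟨w, rfl⟩ := (inMonoid_num g).1 h3
          exact ⟨w, rfl, fun a ha => by omega⟩
        · have hlt : dig (I.numLetters + 1) r x < I.numLetters + 1 := Nat.mod_lt _ (by omega)
          refine ⟨FreeMonoid.of ⟨dig (I.numLetters + 1) r x - 1, by omega⟩, ?_, fun a ha => ?_⟩
          · rw [h4 h0.ne', hletter _ (by omega)]
          · congr 1
            ext
            simp only
            omega
      choose w hw using h'
      refine ⟨FreeMonoid.lift w, fun a => ?_, fun x => by simpa using (hw x).1⟩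
      obtain ⟨x, hx, hxa⟩ := h2 a a.2
      exact ⟨⟨x, hx⟩, by simpa using (hw ⟨x, hx⟩).2 a hxa⟩
    · rintro ⟨f, hf, he⟩
      choose x hx using hf
      have hxinj : Function.Injective x := fun a b h => by
        have := (hx a).symm.trans ((congrArg (fun x => f (FreeMonoid.of x)) h).trans (hx b))
        exact FreeMonoid.of_injective this
      classical
      -- a variable that represents the letter `a` is marked by the digit `a + 1`
      obtain ⟨r, hr, hr'⟩ := exists_dig_eq (n := I.numLetters + 1) (by omega) hV
        (fun y => if h : ∃ a, x a = y then (h.choose : ℕ) + 1 else 0) (fun y => by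
          split_ifs with h
          · have := h.choose.2
            omega
          · omega)
      refine ⟨r, hr, fun y hy => ⟨?_, fun h0 => ?_⟩, fun a ha => ⟨x ⟨a, ha⟩, (x ⟨a, ha⟩).2, ?_⟩⟩
      · rw [show dig (nT I.num) e y = _ from he ⟨y, hy⟩]
        exact (inMonoid_num _).2 ⟨_, rfl⟩
      · have h1 := hr' ⟨y, hy⟩
        simp only at h1
        rw [h1] at h0 ⊢
        split_ifs at h0 ⊢ with h
        · rw [Nat.add_sub_cancel, letter_num, ← hx, h.choose_spec]
          exact he ⟨y, hy⟩
        · exact absurd rfl h0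
      · have h : ∃ b, x b = x ⟨a, ha⟩ := ⟨_, rfl⟩
        rw [hr', dif_pos h, hxinj h.choose_spec]
  | lm =>
    simp only [Valid, hL, HomCategory.Mem]
    have hlayer : ∀ k x, dig 2 (layer I.num k) (dig (nT I.num) e x) = 1 ↔
        ∃ w : I.Word, w.length = k ∧ dig (nT I.num) e x = I.cod (I.trf w) := by
      intro k x
      obtain ⟨g, hg⟩ := hdig x
      rw [← hg, layer_num]
      simp only [cod_injective.eq_iff, eq_comm]
    constructor
    · rintro ⟨k, -, h⟩
      have h' : ∀ x : X, ∃ w : I.Word, w.length = k + 1 ∧ dig (nT I.num) e x = I.cod (I.trf w) :=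
        fun x => (hlayer _ _).1 (h x x.2)
      choose w hw using h'
      exact ⟨FreeMonoid.lift w, ⟨k + 1, by omega, fun x => by simpa using (hw x).1⟩,
        fun x => by simpa using (hw x).2⟩
    · rintro ⟨f, ⟨k, hk, hf⟩, he⟩
      obtain ⟨j, hj, hjk⟩ := exists_layer_eq (I := I) (k - 1)
      rw [Nat.sub_add_cancel hk] at hjk
      refine ⟨j, hj, fun x hx => ?_⟩
      rw [show dig (nT I.num) e x = _ from he ⟨x, hx⟩, layer_num, hjk]
      exact ⟨_, hf _, rfl⟩

/-- Whether the inequality holds is expressed by bounded quantifiers over numbers. -/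
theorem holds_iff_forall_lt (C : HomCategory) (u v : OmegaTerm) {L : List ℕ}
    (hL : ∀ x, x ∈ L ↔ x ∈ u.vars ∪ v.vars) {V : ℕ} (hV : ∀ x ∈ u.vars ∪ v.vars, x < V) :
    I.aut.Holds C u v ↔ ∀ e < nT I.num ^ V, Valid L V I.num e C → ∀ p < nS I.num,
      leq I.num (app I.num (value I.num e u) p) (app I.num (value I.num e v) p) := by
  rw [holds_iff C u v (B := nT I.num ^ V) fun f _ =>
    exists_dig_eq (nT_pos _) hV _ fun _ => cod_lt _]
  simp only [valid_iff C hL hV]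

end InputSemiautomaton

/-! ### Decision in polynomial space -/

namespace Codes

section

variable {bd : Prop} {α : Type} [Ctx α] [Ctx.Full α]

/-- Powers with a constant exponent. -/
theorem lim_pow_const {f : α → ℕ} (hf : Lim bd f) (V : ℕ) : Lim bd (fun a => f a ^ V) := by
  induction V with
  | zero => simp only [pow_zero]; fun_prop
  | succ V ih => simp only [pow_succ]; fun_prop

/-- For fixed terms, the condition that expresses that the inequality holds only involves numbers of
polynomial length. -/
theorem lim_forall_valid (bd : Prop) {C : HomCategory} (hC : C = .ne ∨ C = .l ∨ C = .s)
    (L : List ℕ) (V : ℕ) (u v : OmegaTerm) :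
    Lim bd (fun N : ℕ => ∀ e < nT N ^ V, Valid L V N e C → ∀ p < nS N,
      leq N (app N (value N e u) p) (app N (value N e v) p)) := by
  refine .forall_lt (lim_pow_const (by fun_prop) V) (.imp ?_ (by fun_prop))
  rcases hC with rfl | rfl | rfl
  · exact .forall_mem L fun x => by fun_prop
  · exact .forall_mem L fun x => by fun_prop
  · refine .exists_lt (lim_pow_const (by fun_prop) V) (.and ?_ (.forall_lt (by fun_prop) ?_))
    · exact .forall_mem L fun x => .and (by fun_prop) (.imp (.ne_zero (by fun_prop)) (by fun_prop))
    · exact .exists_mem L fun x => by fun_prop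

end

end Codes

namespace InputSemiautomaton

theorem decidableInPolySpace_holds {C : HomCategory} (hC : C = .ne ∨ C = .l ∨ C = .s)
    (u v : OmegaTerm) : DecidableInPolySpace InputSemiautomaton.code
      fun I : InputSemiautomaton => I.aut.Holds C u v := by
  classical
  obtain ⟨F, hF, hF'⟩ := (Codes.lim_forall_valid True hC (u.vars ∪ v.vars).toList
    ((u.vars ∪ v.vars).sup id + 1) u v).indicator.exists_limRec
  refine hF.decidableInPolySpace _ _ fun I r hr => ?_
  rw [holds_iff_forall_lt C u v (fun _ => Finset.mem_toList)
    fun x hx => Nat.lt_succ_of_le (Finset.le_sup (f := id) hx)] at hr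
  refine (hF' I.num).trans ?_
  cases r
  · exact if_neg fun h => by simpa using hr.2 h
  · exact if_pos (hr.1 rfl)

end InputSemiautomaton

/-! ### Primitive recursive functions -/

theorem LimRec.primrec' {bd : Prop} {k : ℕ} {f : (Fin k → ℕ) → ℕ} (hf : LimRec bd f) :
    Nat.Primrec' (fun v : List.Vector ℕ k => f v.get) := by
  induction hf with
  | zero => exact .const 0
  | succ _ ih => exact Nat.Primrec'.succ.comp₁ _ ih
  | get i => exact .get i
  | comp _ _ ih1 ih2 =>
    refine (Nat.Primrec'.comp _ ih1 ih2).of_eq fun v => ?_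
    congr 1
    funext i
    simp
  | @prec k n g h _ _ _ _ ih1 ih2 ih3 =>
    refine (Nat.Primrec'.prec' ih1 ih2 ih3).of_eq fun v => ?_
    change (Nat.rec (g v.get) (fun y IH => h (y ::ᵥ IH ::ᵥ v).get) (n v.get) : ℕ) =
      recVal g h v.get (n v.get)
    generalize n v.get = m
    induction m with
    | zero => rfl
    | succ i ih =>
      rw [recVal, ← ih]
      refine congrArg h (funext fun j => ?_)
      refine Fin.cases rfl (fun j => ?_) j
      refine Fin.cases rfl (fun j => ?_) j
      simp

/-- The description of an element by natural numbers is primitive recursive. -/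
class Ctx.Prim (α : Type) [Ctx α] [Primcodable α] : Prop where
  prim : Primrec fun a : α => List.Vector.ofFn (Ctx.coord a)

instance : Ctx.Prim ℕ := ⟨.vector_ofFn (n := 1) fun _ => .id⟩

instance {α : Type} [Ctx α] [Primcodable α] [Ctx.Prim α] : Ctx.Prim (ℕ × α) :=
  ⟨(Primrec.vector_cons.comp .fst (Ctx.Prim.prim.comp .snd)).of_eq fun _ => rfl⟩

theorem LimRec.primrec_comp {bd : Prop} {α : Type} [Ctx α] [Primcodable α] [Ctx.Prim α]
    {F : (Fin (Ctx.dim α) → ℕ) → ℕ} (hF : LimRec bd F) : Primrec fun a : α => F (Ctx.coord a) := by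
  refine (hF.primrec'.to_prim.comp Ctx.Prim.prim).of_eq fun a => congrArg F (funext fun i => ?_)
  simp

theorem Lim.primrec {bd : Prop} {α : Type} [Ctx α] [Primcodable α] [Ctx.Prim α] {f : α → ℕ}
    (hf : Lim bd f) : Primrec f := by
  obtain ⟨F, hF, hF'⟩ := hf.exists_limRec
  exact hF.primrec_comp.of_eq hF'

theorem Lim.primrecPred {bd : Prop} {α : Type} [Ctx α] [Primcodable α] [Ctx.Prim α] {P : α → Prop}
    (hP : Lim bd P) : PrimrecPred P := by
  classical
  exact (Primrec.eq.comp hP.indicator.primrec (.const 1)).of_eq fun a => by simp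

section

variable {α β : Type} [Primcodable α] [Primcodable β]

theorem PrimrecPred.imp {P Q : α → Prop} (hP : PrimrecPred P) (hQ : PrimrecPred Q) :
    PrimrecPred fun a => P a → Q a :=
  (hP.not.or hQ).of_eq fun _ => imp_iff_not_or.symm

theorem PrimrecPred.forall_mem {f : α → List β} {P : α → β → Prop} (hf : Primrec f)
    (hP : PrimrecPred fun p : β × α => P p.2 p.1) : PrimrecPred fun a => ∀ b ∈ f a, P a b :=
  (PrimrecRel.forall_mem_list (R := fun b a => P a b) hP).comp hf .id

theorem PrimrecPred.exists_mem {f : α → List β} {P : α → β → Prop} (hf : Primrec f)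
    (hP : PrimrecPred fun p : β × α => P p.2 p.1) : PrimrecPred fun a => ∃ b ∈ f a, P a b :=
  (PrimrecRel.exists_mem_list (R := fun b a => P a b) hP).comp hf .id

theorem PrimrecPred.forall_mem_lt {f : α → ℕ} {P : α → ℕ → Prop} (hf : Primrec f)
    (hP : PrimrecPred fun p : ℕ × α => P p.2 p.1) : PrimrecPred fun a => ∀ i < f a, P a i :=
  (forall_mem (Primrec.list_range.comp hf) hP).of_eq fun a => by simp

theorem PrimrecPred.exists_mem_lt {f : α → ℕ} {P : α → ℕ → Prop} (hf : Primrec f)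
    (hP : PrimrecPred fun p : ℕ × α => P p.2 p.1) : PrimrecPred fun a => ∃ i < f a, P a i :=
  (exists_mem (Primrec.list_range.comp hf) hP).of_eq fun a => by simp

end

theorem primrec_toMarkedNat : Primrec List.toMarkedNat := by
  have h : Primrec fun p : List Bool × Bool × ℕ => Nat.bit p.2.1 p.2.2 :=
    (Primrec.nat_add.comp (Primrec.nat_mul.comp (.const 2) (Primrec.snd.comp .snd))
      (Primrec.cond (Primrec.fst.comp .snd) (.const 1) (.const 0))).of_eq fun p => by
        rw [Nat.bit_val]; cases p.2.1 <;> rfl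
  exact Primrec.list_foldr .id (.const 1) h.to₂

/-! ### Decision with the terms as inputs -/

/-- The variables that occur in a term in reverse Polish notation. -/
def codeVars (l : List ℕ) : List ℕ := (l.filter fun y => 2 ≤ y).map (· - 2)

theorem mem_codeVars {l : List ℕ} {x : ℕ} : x ∈ codeVars l ↔ x + 2 ∈ l := by
  simp only [codeVars, List.mem_map, List.mem_filter, decide_eq_true_eq]
  constructor
  · rintro ⟨y, ⟨hy, h2⟩, rfl⟩
    rwa [Nat.sub_add_cancel h2]
  · exact fun h => ⟨x + 2, ⟨h, by omega⟩, by omega⟩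

theorem OmegaTerm.add_two_mem_code (x : ℕ) (u : OmegaTerm) : x + 2 ∈ u.code ↔ x ∈ u.vars := by
  induction u with
  | var y => simp [code, vars]
  | mul s t ihs iht => simp [code, vars, ihs, iht]
  | omega t ih => simp [code, vars, ih]

theorem List.lt_sum_add_one {l : List ℕ} {x : ℕ} (h : x ∈ l) : x < l.sum + 1 :=
  Nat.lt_succ_of_le (List.single_le_sum (fun _ _ => Nat.zero_le _) x h)

theorem primrec_codeVars : Primrec codeVars :=
  Primrec.list_map
    (Primrec.listFilter (p := fun y => 2 ≤ y) (Primrec.nat_le.comp (.const 2) .id))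
    (Primrec.nat_sub.comp .snd (.const 2)).to₂

theorem primrec_list_sum : Primrec (fun l : List ℕ => l.sum) :=
  (Primrec.list_foldr (f := fun l : List ℕ => l) (g := fun _ => 0) (h := fun _ p => p.1 + p.2)
    .id (.const 0) (Primrec.nat_add.comp (Primrec.fst.comp .snd) (Primrec.snd.comp .snd)).to₂).of_eq
    fun l => by rw [List.sum]

namespace Codes

/-- One step of the evaluation of a term in reverse Polish notation, on a stack of transformations.
-/
noncomputable def evalStep (N e : ℕ) (st : List ℕ) (y : ℕ) : List ℕ :=
  if y = 0 then comp N st.tail.headI st.headI :: st.tail.tail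
  else if y = 1 then omegaPower N st.headI :: st.tail
  else dig (nT N) e (y - 2) :: st

/-- The value of a term in reverse Polish notation. -/
noncomputable def codeValue (N e : ℕ) (l : List ℕ) : ℕ := (l.foldl (evalStep N e) []).headI

theorem foldl_evalStep (N e : ℕ) (u : OmegaTerm) (st : List ℕ) :
    u.code.foldl (evalStep N e) st = value N e u :: st := by
  induction u generalizing st with
  | var x => simp [OmegaTerm.code, evalStep, value]
  | mul s t ihs iht =>
    simp [OmegaTerm.code, List.foldl_append, ihs, iht, evalStep, value]
  | omega t ih => simp [OmegaTerm.code, List.foldl_append, ih, evalStep, value]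

theorem codeValue_code (N e : ℕ) (u : OmegaTerm) : codeValue N e u.code = value N e u := by
  rw [codeValue, foldl_evalStep, List.headI_cons]

theorem primrec_evalStep : Primrec fun p : (ℕ × ℕ) × List ℕ × ℕ =>
    evalStep p.1.1 p.1.2 p.2.1 p.2.2 := by
  have hN : Primrec fun p : (ℕ × ℕ) × List ℕ × ℕ => p.1.1 := .comp .fst .fst
  have he : Primrec fun p : (ℕ × ℕ) × List ℕ × ℕ => p.1.2 := .comp .snd .fst
  have hst : Primrec fun p : (ℕ × ℕ) × List ℕ × ℕ => p.2.1 := .comp .fst .snd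
  have hy : Primrec fun p : (ℕ × ℕ) × List ℕ × ℕ => p.2.2 := .comp .snd .snd
  have ht := Primrec.list_tail.comp hst
  have hcomp : Primrec fun p : ℕ × ℕ × ℕ => comp p.1 p.2.1 p.2.2 :=
    Lim.primrec (bd := False) (by fun_prop)
  have homega : Primrec fun p : ℕ × ℕ => omegaPower p.1 p.2 :=
    Lim.primrec (bd := False) (by fun_prop)
  have hdig : Primrec fun p : ℕ × ℕ × ℕ => dig (nT p.1) p.2.1 (p.2.2 - 2) :=
    Lim.primrec (bd := False) (by fun_prop)
  have h0 := Primrec.list_cons.comp (hcomp.comp (hN.pair ((Primrec.list_headI.comp ht).pair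
    (Primrec.list_headI.comp hst)))) (Primrec.list_tail.comp ht)
  have h1 := Primrec.list_cons.comp (homega.comp (hN.pair (Primrec.list_headI.comp hst))) ht
  have h2 := Primrec.list_cons.comp (hdig.comp (hN.pair (he.pair hy))) hst
  exact .ite (Primrec.eq.comp hy (.const 0)) h0 (.ite (Primrec.eq.comp hy (.const 1)) h1 h2)

theorem primrec_codeValue : Primrec fun p : (ℕ × ℕ) × List ℕ => codeValue p.1.1 p.1.2 p.2 :=
  Primrec.list_headI.comp (Primrec.list_foldl (f := fun p : (ℕ × ℕ) × List ℕ => p.2)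
    (g := fun _ => []) (h := fun p q => evalStep p.1.1 p.1.2 q.1 q.2) .snd (.const [])
    (primrec_evalStep.comp (.pair (.comp .fst .fst) .snd)).to₂)

/-- Without a bound for the length of the values, all powers are allowed. -/
@[fun_prop]
theorem lim_pow_false {α : Type} [Ctx α] [Ctx.Full α] {f g : α → ℕ} (hf : Lim False f)
    (hg : Lim False g) : Lim False (fun a => f a ^ g a) := .pow hf hg False.elim

theorem lim_layer {α : Type} [Ctx α] [Ctx.Full α] {N k : α → ℕ} (hN : Lim False N)
    (hk : Lim False k) : Lim False (fun a => layer (N a) (k a)) := by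
  classical
  have key : ∀ n i : ℕ, (Nat.rec (2 ^ one n) (fun _ x => tab 2 (nT n) fun t =>
      if ∃ s < nT n, dig 2 x s = 1 ∧ ∃ a < nA n, t = comp n s (letter n a) then 1 else 0) i : ℕ) =
      layer n i := fun n i => by
    induction i with
    | zero => rfl
    | succ i ih =>
      rw [layer, ← ih]
  refine (Lim.natRec (g := fun a => 2 ^ one (N a)) (h := fun _ x a => tab 2 (nT (N a)) fun t =>
    if ∃ s < nT (N a), dig 2 x s = 1 ∧ ∃ b < nA (N a), t = comp (N a) s (letter (N a) b) then 1
      else 0) hk (by fun_prop) ?_ False.elim).congr fun a => key _ _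
  unfold tab
  exact .sum (by fun_prop) (.mul (.ite (by fun_prop) (by fun_prop) (by fun_prop)) (by fun_prop))

theorem primrecPred_valid (C : HomCategory) :
    PrimrecPred fun p : (List ℕ × ℕ) × ℕ × ℕ => Valid p.1.1 p.1.2 p.2.1 p.2.2 C := by
  have hL : Primrec fun p : (List ℕ × ℕ) × ℕ × ℕ => p.1.1 := .comp .fst .fst
  have hV : Primrec fun p : (List ℕ × ℕ) × ℕ × ℕ => p.1.2 := .comp .snd .fst
  have hN : Primrec fun p : (List ℕ × ℕ) × ℕ × ℕ => p.2.1 := .comp .fst .snd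
  have h1 : Primrec fun p : ℕ × (List ℕ × ℕ) × ℕ × ℕ => (p.1, p.2.2) :=
    .pair .fst (.comp .snd .snd)
  have h2 : Primrec fun p : ℕ × ℕ × (List ℕ × ℕ) × ℕ × ℕ => (p.1, p.2.1, p.2.2.2) :=
    .pair .fst (h1.comp .snd)
  cases C with
  | ne =>
    refine .forall_mem hL ?_
    have := Lim.primrecPred (bd := False) (P := fun p : ℕ × ℕ × ℕ => ∃ a < nA p.2.1,
      ∃ t < nT p.2.1, InMonoid p.2.1 t ∧
        dig (nT p.2.1) p.2.2 p.1 = comp p.2.1 (letter p.2.1 a) t) (by fun_prop)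
    exact this.comp h1
  | l =>
    refine .forall_mem hL ?_
    have := Lim.primrecPred (bd := False) (P := fun p : ℕ × ℕ × ℕ => ∃ a < nA p.2.1,
      dig (nT p.2.1) p.2.2 p.1 = letter p.2.1 a) (by fun_prop)
    exact this.comp h1
  | s =>
    have hpow : Primrec fun p : ℕ × ℕ => (nA p.1 + 1) ^ p.2 :=
      Lim.primrec (bd := False) (by fun_prop)
    have hnA : Primrec nA := Lim.primrec (bd := False) (f := fun N => nA N) (by fun_prop)
    have := Lim.primrecPred (bd := False) (P := fun p : ℕ × ℕ × ℕ × ℕ =>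
      InMonoid p.2.2.1 (dig (nT p.2.2.1) p.2.2.2 p.1) ∧
        (dig (nA p.2.2.1 + 1) p.2.1 p.1 ≠ 0 → dig (nT p.2.2.1) p.2.2.2 p.1 =
          letter p.2.2.1 (dig (nA p.2.2.1 + 1) p.2.1 p.1 - 1)))
      (.and (by fun_prop) (.imp (.ne_zero (by fun_prop)) (by fun_prop)))
    have h' := Lim.primrecPred (bd := False) (P := fun p : ℕ × ℕ × ℕ × ℕ × ℕ =>
      dig (nA p.2.2.2.1 + 1) p.2.2.1 p.1 = p.2.1 + 1) (by fun_prop)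
    have hp := hpow.comp (hN.pair hV)
    have h3 := this.comp h2
    have h4 := hnA.comp (hN.comp (.snd (α := ℕ)))
    have h5 := h'.comp (Primrec.pair .fst (h2.comp (.snd (α := ℕ))))
    exact .exists_mem_lt hp (.and (.forall_mem (hL.comp .snd) h3)
      (.forall_mem_lt h4 (.exists_mem (hL.comp (.comp .snd .snd)) h5)))
  | lm =>
    have hpow : Primrec fun N : ℕ => 2 ^ nT N := Lim.primrec (bd := False) (by fun_prop)
    have := Lim.primrecPred (bd := False) (P := fun p : ℕ × ℕ × ℕ × ℕ =>
      dig 2 (layer p.2.2.1 (p.2.1 + 1)) (dig (nT p.2.2.1) p.2.2.2 p.1) = 1)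
      (.eq (lim_dig (by fun_prop) (lim_layer (by fun_prop) (by fun_prop)) (by fun_prop))
        (by fun_prop))
    have hp := hpow.comp hN
    have h3 := this.comp h2
    exact .exists_mem_lt hp (.forall_mem (hL.comp .snd) h3)

/-- The condition that expresses that an inequality holds, for terms in reverse Polish notation. -/
theorem primrecPred_forall_valid (C : HomCategory) :
    PrimrecPred fun p : ℕ × List ℕ × List ℕ =>
      ∀ e < nT p.1 ^ ((codeVars (p.2.1 ++ p.2.2)).sum + 1),
        Valid (codeVars (p.2.1 ++ p.2.2)) ((codeVars (p.2.1 ++ p.2.2)).sum + 1) p.1 e C →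
          ∀ q < nS p.1, leq p.1 (app p.1 (codeValue p.1 e p.2.1) q)
            (app p.1 (codeValue p.1 e p.2.2) q) := by
  have hL : Primrec fun p : ℕ × List ℕ × List ℕ => codeVars (p.2.1 ++ p.2.2) :=
    primrec_codeVars.comp (Primrec.list_append.comp (.comp .fst .snd) (.comp .snd .snd))
  have hV : Primrec fun p : ℕ × List ℕ × List ℕ => (codeVars (p.2.1 ++ p.2.2)).sum + 1 :=
    Primrec.succ.comp (primrec_list_sum.comp hL)
  have hpow : Primrec fun p : ℕ × ℕ => nT p.1 ^ p.2 := Lim.primrec (bd := False) (by fun_prop)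
  have hnS : Primrec nS := Lim.primrec (bd := False) (f := fun N => nS N) (by fun_prop)
  have hleq := Lim.primrecPred (bd := False) (P := fun p : ℕ × ℕ × ℕ × ℕ =>
    leq p.1 (app p.1 p.2.1 p.2.2.2) (app p.1 p.2.2.1 p.2.2.2)) (by fun_prop)
  have hN : Primrec fun p : ℕ × ℕ × ℕ × List ℕ × List ℕ => p.2.2.1 :=
    .comp .fst (.comp .snd .snd)
  have hNe : Primrec fun p : ℕ × ℕ × ℕ × List ℕ × List ℕ => (p.2.2.1, p.2.1) :=
    .pair hN (.comp .fst .snd)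
  have hu : Primrec fun p : ℕ × ℕ × ℕ × List ℕ × List ℕ => p.2.2.2.1 :=
    .comp .fst (.comp .snd (.comp .snd .snd))
  have hv : Primrec fun p : ℕ × ℕ × ℕ × List ℕ × List ℕ => p.2.2.2.2 :=
    .comp .snd (.comp .snd (.comp .snd .snd))
  have h1 := hpow.comp (Primrec.fst.pair hV)
  have h2 := (primrecPred_valid C).comp
    (((hL.comp (.snd (α := ℕ))).pair (hV.comp .snd)).pair (.pair (.comp .fst .snd) .fst))
  have h3 := hnS.comp (Primrec.fst.comp (.snd (α := ℕ) (β := ℕ × List ℕ × List ℕ)))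
  have h4 := hleq.comp (hN.pair ((primrec_codeValue.comp (hNe.pair hu)).pair
    ((primrec_codeValue.comp (hNe.pair hv)).pair .fst)))
  exact .forall_mem_lt h1 (.imp h2 (.forall_mem_lt h3 h4))

end Codes

theorem InputSemiautomaton.exists_computable_holds (C : HomCategory) :
    ∃ d : List Bool × List ℕ × List ℕ → Bool, Computable d ∧
      ∀ (I : InputSemiautomaton) (u v : OmegaTerm),
        d (I.code, u.code, v.code) = true ↔ I.aut.Holds C u v := by
  obtain ⟨_, h⟩ := Codes.primrecPred_forall_valid C
  refine ⟨_, (h.comp (.pair (primrec_toMarkedNat.comp .fst) .snd)).to_comp, fun I u v => ?_⟩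
  have hL : ∀ x, x ∈ codeVars (u.code ++ v.code) ↔ x ∈ u.vars ∪ v.vars := fun x => by
    rw [mem_codeVars, List.mem_append, Finset.mem_union, OmegaTerm.add_two_mem_code,
      OmegaTerm.add_two_mem_code]
  rw [decide_eq_true_iff, holds_iff_forall_lt C u v hL fun x hx =>
    List.lt_sum_add_one ((hL x).2 hx)]
  simp only [Codes.codeValue_code]
  rfl

theorem theoremt :
    (∀ C : HomCategory, ∃ d : List Bool × List ℕ × List ℕ → Bool, Computable d ∧
      ∀ (I : InputSemiautomaton) (u v : OmegaTerm),
        d (I.code, u.code, v.code) = true ↔ I.aut.Holds C u v) ∧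
    (∀ C : HomCategory, C = .ne ∨ C = .l ∨ C = .s → ∀ u v : OmegaTerm,
      DecidableInPolySpace InputSemiautomaton.code
        fun I : InputSemiautomaton => I.aut.Holds C u v) :=
  ⟨InputSemiautomaton.exists_computable_holds, fun _ hC u v =>
    InputSemiautomaton.decidableInPolySpace_holds hC u v⟩
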